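/- Let $A=(a_{ij})$ be a $d\times n$ integer matrix with columns $a_1,\dots,a_n$ such that $(1,\dots,1)$ is not in the $\mathbb Q$-row span of $A$. Let $\mathrm{conv}(A)$ be the convex hull of the columns of $A$, and $\Delta_A$ the convex hull of the columns and the origin. A $(d-1)$-simplex of $A$ is a set $\sigma\subseteq\{1,\dots,n\}$ such that $(a_i)_{i\in\sigma}$ is a basis of $\mathbb R^d$. A vector $v\in\mathbb C^n$ is associated with $\sigma$ (for $\beta\in\mathbb C^d$) if $Av=\beta$ and $v_i\in\mathbb N$ for all $i\notin\sigma$. Let $\mathrm{nsupp}(v)=\{i : v_i\in\mathbb Z_{<0}\}$, $N_v=\{u\in\ker(A)\cap\mathbb Z^n : \mathrm{nsupp}(v+u)=\mathrm{nsupp}(v)\}$ and $$\phi_v(x)=\sum_{u\in N_v}\frac{[v]_{u_-}}{[v+u]_{u_+}}\,x^{v+u},\qquad [v]_u=\prod_i\prod_{j=1}^{u_i}(v_i-j+1).$$ For $w\in\mathbb Z^n$ and $\alpha\in\mathbb C$, the modified system $\mathcal M_{A,w,\alpha}(\beta)$ on $\mathbb C^{n}_x\times\mathbb C_t$ is $$\Big(\sum_j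 a_{ij}x_j\partial_j-\beta_i\Big)\bullet f=0\ (1\le i\le d),\qquad \Big(\sum_j w_jx_j\partial_j-t\partial_t-\alpha\Big)\bullet f=0,\qquad \big(\partial^{a}t^{a_{n+1}}-\partial^{b}t^{b_{n+1}}\big)\bullet f=0$$ for all $(a,a_{n+1}),(b,b_{n+1})\in\mathbb N^{n+1}$ having the same image under $\widetilde A(w)=\begin{pmatrix}A&0\\ w&1\end{pmatrix}$. Let $T=\{t=0\}$. A formal power series along $T$ at $p\in T$ is a series $\sum_{m\ge0}f_m(x)t^m$ with all $f_m$ holomorphic in a common neighbourhood of $p$. It is Gevrey of order $s\in\mathbb R$ if $\sum_m (m!)^{1-s}f_m(x)t^m$ converges to a holomorphic function near $p$, and it has Gevrey index $s$ if it is Gevrey of order $s$ but of no order $s'<s$. A statement holds for very generic $\beta$ if it holds for all $\beta$ outside the union of a locally finite countable family of proper Zariski closed subsets of $\mathbb C^d$; here the family depends only on $A$. **Proposition.** Let $\beta\in\mathbb C^d$ be very generic, $\kappa$ a positive integer, $w=(-\kappa,\dots,-\kappa)$, $\alpha\in\mathbb C$, $\sigma$ a $(d-1)$-simplex of $A$,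 and $v$ a vector associated with $\sigma$. Then, up to multiplication by a factor $t^\gamma$ for some $\gamma\in\mathbb C$, the series $$\psi(x,t)=t^{-\alpha}\phi_v(t^{w_1}x_1,\dots,t^{w_n}x_n)$$ is a formal power series along $T$ (at some point of $T$) if and only if $\sigma$ is contained in a facet of $\mathrm{conv}(A)$ that is not a facet of $\Delta_A$. Moreover, in that case there is $R>0$ such that, at every point $p=(x,0)\in T$ with $x_i\ne0$ for $i\in\sigma$ and $|x_j|<R\prod_{i\in\sigma}|x_i|^{(A_\sigma^{-1}a_j)_i}$ for all $j\notin\sigma$ for which the coordinates of $A_\sigma^{-1}a_j$ sum to $1$, the series $\psi$ is of the form $t^\gamma\sum_{m\ge0}f_m(x)t^m$ with $\sum_m f_mt^m$ a formal power series along $T$ at $p$; and for every such representation at $p$, $\psi$ is a solution of $\mathcal M_{A,w,\alpha}(\beta)$ and $\sum_m f_m t^m$ has Gevrey index exactly $1+1/\kappa$. -/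

import Mathlib

open Topology

noncomputable section

namespace ModifiedGKZ

/-! ### Convex geometry of the columns -/

/-- The `j`-th column of `A`, as a point of `ℝ^d`. -/
def col {d n : ℕ} (A : Matrix (Fin d) (Fin n) ℤ) (j : Fin n) : Fin d → ℝ :=
  fun i => (A i j : ℝ)

/-- `conv(A)`, the convex hull of the columns of `A`. -/
def convA {d n : ℕ} (A : Matrix (Fin d) (Fin n) ℤ) : Set (Fin d → ℝ) :=
  convexHull ℝ (Set.range (col A))

/-- `Δ_A`, the convex hull of the columns of `A` and the origin. -/
def deltaA {d n : ℕ} (A : Matrix (Fin d) (Fin n) ℤ) : Set (Fin d → ℝ) :=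
  convexHull ℝ (insert 0 (Set.range (col A)))

/-- `F` is a facet of the polytope `P`: a nonempty (exposed) face of codimension one in `P`. -/
def IsFacet {d : ℕ} (P F : Set (Fin d → ℝ)) : Prop :=
  F.Nonempty ∧ IsExposed ℝ P F ∧
    Module.finrank ℝ (vectorSpan ℝ F) + 1 = Module.finrank ℝ (vectorSpan ℝ P)

/-- `σ` is a `(d-1)`-simplex of `A`: the columns indexed by `σ` form a basis of `ℝ^d`. -/
def IsSimplex {d n : ℕ} (A : Matrix (Fin d) (Fin n) ℤ) (σ : Finset (Fin n)) : Prop :=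
  LinearIndependent ℝ (fun i : σ => col A i) ∧
    Submodule.span ℝ (Set.range (fun i : σ => col A i)) = ⊤

/-- `σ` is contained in a facet of `conv(A)` that is not a facet of `Δ_A`. -/
def LiesInInnerFacet {d n : ℕ} (A : Matrix (Fin d) (Fin n) ℤ) (σ : Finset (Fin n)) : Prop :=
  ∃ F : Set (Fin d → ℝ), IsFacet (convA A) F ∧ ¬ IsFacet (deltaA A) F ∧ ∀ i ∈ σ, col A i ∈ F

/-- `c` is the vector of coordinates of `a_j` in the columns indexed by `σ`
(that is `A_σ⁻¹ a_j`, extended by zero outside `σ`). -/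
def IsCoords {d n : ℕ} (A : Matrix (Fin d) (Fin n) ℤ) (σ : Finset (Fin n)) (j : Fin n)
    (c : Fin n → ℝ) : Prop :=
  (∀ i, i ∉ σ → c i = 0) ∧ ∑ i ∈ σ, c i • col A i = col A j

/-! ### Very generic parameters -/

/-- A proper Zariski closed subset of `ℂ^d`. -/
def IsProperZariskiClosed {d : ℕ} (Z : Set (Fin d → ℂ)) : Prop :=
  Z ≠ Set.univ ∧
    ∃ S : Set (MvPolynomial (Fin d) ℂ), Z = {β | ∀ q ∈ S, MvPolynomial.eval β q = 0}

/-- `P β` holds for very generic `β`: for all `β` outside the union of some locally finite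
countable family of proper Zariski closed subsets. -/
def ForVeryGeneric {d : ℕ} (P : (Fin d → ℂ) → Prop) : Prop :=
  ∃ Z : ℕ → Set (Fin d → ℂ), (∀ k, IsProperZariskiClosed (Z k)) ∧ LocallyFinite Z ∧
    ∀ β : Fin d → ℂ, β ∉ ⋃ k, Z k → P β

/-! ### The series `φ_v` -/

/-- `v` is associated with `σ`: `v_i ∈ ℕ` for `i ∉ σ` and `A v = β`. -/
def IsAssociated {d n : ℕ} (A : Matrix (Fin d) (Fin n) ℤ) (β : Fin d → ℂ)
    (σ : Finset (Fin n)) (v : Fin n → ℂ) : Prop :=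
  (∀ i, i ∉ σ → ∃ k : ℕ, v i = k) ∧ ∀ r, ∑ j, (A r j : ℂ) * v j = β r

/-- The negative support of a complex vector. -/
def nsupp {n : ℕ} (v : Fin n → ℂ) : Set (Fin n) :=
  {i | ∃ k : ℤ, k < 0 ∧ v i = k}

/-- The index set `N_v` of the series `φ_v`. -/
def supportSet {d n : ℕ} (A : Matrix (Fin d) (Fin n) ℤ) (v : Fin n → ℂ) : Set (Fin n → ℤ) :=
  {u | A.mulVec u = 0 ∧ nsupp (fun i => v i + (u i : ℂ)) = nsupp v}

/-- `[z]_k = z (z - 1) ⋯ (z - k + 1)`. -/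
def fallingFactorial (z : ℂ) (k : ℕ) : ℂ :=
  ∏ j ∈ Finset.range k, (z - (j : ℂ))

/-- The coefficient `[v]_{u₋} / [v + u]_{u₊}` of `x^(v+u)` in `φ_v`. -/
def phiCoeff {n : ℕ} (v : Fin n → ℂ) (u : Fin n → ℤ) : ℂ :=
  (∏ i, fallingFactorial (v i) (-(u i)).toNat) /
    ∏ i, fallingFactorial (v i + (u i : ℂ)) (u i).toNat

/-- The determination of `z ^ e` for `z` near `p`. For `p ≠ 0` it is holomorphic near `p`, and
another choice of the branch changes all the `z ^ (e + k)`, `k ∈ ℤ`, by one common constant factor;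
for `p = 0` it is the usual power when `e ∈ ℕ` (the only case that is used). -/
def localPow (p z e : ℂ) : ℂ :=
  if p = 0 then z ^ e else p ^ e * (z / p) ^ e

/-- The monomial `x ^ e` for `x` near `p`. -/
def localMonomial {n : ℕ} (p x e : Fin n → ℂ) : ℂ :=
  ∏ i, localPow (p i) (x i) (e i)

/-- The exponent of `t` in the monomial of `t^(-α) φ_v(t^w x)` that comes from `x^(v+u)`. -/
def tExponent {n : ℕ} (w : Fin n → ℤ) (α : ℂ) (v : Fin n → ℂ) (u : Fin n → ℤ) : ℂ :=
  -α + ∑ i, (w i : ℂ) * (v i + (u i : ℂ))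

/-! ### Formal power series along `T = {t = 0}`

A germ at `(p, 0)` of a formal power series `∑_m f_m(x) t^m` along `T` is given by the sequence
`f` of its coefficients, all holomorphic in a common neighbourhood of `p`. -/

/-- All the coefficients are holomorphic in a common neighbourhood of `p`. -/
def IsFormalGerm {n : ℕ} (p : Fin n → ℂ) (f : ℕ → (Fin n → ℂ) → ℂ) : Prop :=
  ∃ V : Set (Fin n → ℂ), IsOpen V ∧ p ∈ V ∧ ∀ m, AnalyticOnNhd ℂ (f m) V

/-- The series `∑_m f_m(x) t^m` is the germ at `(p, 0)` of a holomorphic function of `(x, t)`. -/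
def IsConvergentGerm {n : ℕ} (p : Fin n → ℂ) (f : ℕ → (Fin n → ℂ) → ℂ) : Prop :=
  ∃ G : (Fin n → ℂ) × ℂ → ℂ, AnalyticAt ℂ G (p, 0) ∧
    ∀ᶠ q in 𝓝 ((p, 0) : (Fin n → ℂ) × ℂ), HasSum (fun m : ℕ => f m q.1 * q.2 ^ m) (G q)

/-- `∑_m f_m(x) t^m` is a Gevrey series of order `s` along `T` at `p`. -/
def IsGevrey {n : ℕ} (s : ℝ) (p : Fin n → ℂ) (f : ℕ → (Fin n → ℂ) → ℂ) : Prop :=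
  IsFormalGerm p f ∧
    IsConvergentGerm p (fun m x => f m x / (((m.factorial : ℝ) ^ (s - 1) : ℝ) : ℂ))

/-- The Gevrey index of `∑_m f_m(x) t^m` along `T` at `p` is `s`: order `s`, and no smaller one. -/
def HasGevreyIndex {n : ℕ} (s : ℝ) (p : Fin n → ℂ) (f : ℕ → (Fin n → ℂ) → ℂ) : Prop :=
  IsGevrey s p f ∧ ∀ s' : ℝ, s' < s → ¬ IsGevrey s' p f

/-- At the point `p` of `T`, the series `t^(-α) φ_v(t^w x)` is `t^γ ∑_m f_m(x) t^m` with
`∑_m f_m(x) t^m` a formal power series along `T`: the monomials are holomorphic at `p`, each power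
of `t` that occurs is `t^(γ + m)` with `m ∈ ℕ`, and the terms with `t^(γ + m)` sum up to `f_m` in a
neighbourhood of `p` which is common to all `m`, where the `f_m` are holomorphic. -/
def IsExpansion {d n : ℕ} (A : Matrix (Fin d) (Fin n) ℤ) (w : Fin n → ℤ) (α : ℂ)
    (v : Fin n → ℂ) (γ : ℂ) (p : Fin n → ℂ) (f : ℕ → (Fin n → ℂ) → ℂ) : Prop :=
  (∀ i, p i = 0 → ∃ k : ℕ, v i = k) ∧
  (∀ u ∈ supportSet A v, ∃ m : ℕ, tExponent w α v u = γ + m) ∧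
  ∃ V : Set (Fin n → ℂ), IsOpen V ∧ p ∈ V ∧ ∀ m : ℕ, AnalyticOnNhd ℂ (f m) V ∧
    ∀ x ∈ V, HasSum
      (fun u : {u : Fin n → ℤ // u ∈ supportSet A v ∧ tExponent w α v u = γ + m} =>
        phiCoeff v u.1 * localMonomial p x (fun i => v i + (u.1 i : ℂ)))
      (f m x)

/-! ### The modified `A`-hypergeometric system -/

/-- The matrix `Ã(w)`, with last row `(w, 1)`. -/
def modifiedMatrix {d n : ℕ} (A : Matrix (Fin d) (Fin n) ℤ) (w : Fin n → ℤ) :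
    Matrix (Fin d ⊕ Unit) (Fin n ⊕ Unit) ℤ :=
  Matrix.fromBlocks A 0 (Matrix.of fun _ j => w j) 1

/-- The partial derivative `∂_j`. -/
def pderiv {n : ℕ} (j : Fin n) (g : (Fin n → ℂ) → ℂ) : (Fin n → ℂ) → ℂ :=
  fun x => fderiv ℂ g x (Pi.single j 1)

/-- `∂^a = ∂_1^{a_1} ⋯ ∂_n^{a_n}`. -/
def monomialDeriv {n : ℕ} (a : Fin n → ℕ) (g : (Fin n → ℂ) → ℂ) : (Fin n → ℂ) → ℂ :=
  (List.finRange n).foldr (fun j h => (pderiv j)^[a j] h) g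

/-- The coefficients of `t^k ∑_m f_m(x) t^m`. -/
def mulTPow {n : ℕ} (k : ℕ) (f : ℕ → (Fin n → ℂ) → ℂ) : ℕ → (Fin n → ℂ) → ℂ :=
  fun m => if k ≤ m then f (m - k) else 0

/-- `t^γ ∑_m f_m(x) t^m` is, at the point `p` of `T`, a solution of the modified system
`H_{A,w,α}(β)`; each equation is written out for the coefficient of `t^(γ + m)`:
the Euler equations `(∑_j a_{rj} x_j ∂_j - β_r) • f = 0`,
the equation `(∑_j w_j x_j ∂_j - t ∂_t - α) • f = 0`, and
the toric equations `(∂^a t^{a_{n+1}} - ∂^b t^{b_{n+1}}) • f = 0` for `Ã(w) a = Ã(w) b`. -/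
def IsModifiedSolution {d n : ℕ} (A : Matrix (Fin d) (Fin n) ℤ) (w : Fin n → ℤ) (α : ℂ)
    (β : Fin d → ℂ) (γ : ℂ) (p : Fin n → ℂ) (f : ℕ → (Fin n → ℂ) → ℂ) : Prop :=
  ∃ V : Set (Fin n → ℂ), IsOpen V ∧ p ∈ V ∧ (∀ m, AnalyticOnNhd ℂ (f m) V) ∧
    ∀ x ∈ V, ∀ m : ℕ,
      (∀ r, ∑ j, (A r j : ℂ) * (x j * pderiv j (f m) x) - β r * f m x = 0) ∧
      (∑ j, (w j : ℂ) * (x j * pderiv j (f m) x) - (γ + m) * f m x - α * f m x = 0) ∧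
      (∀ a b : Fin n ⊕ Unit → ℕ,
        (modifiedMatrix A w).mulVec (fun i => (a i : ℤ)) =
          (modifiedMatrix A w).mulVec (fun i => (b i : ℤ)) →
        monomialDeriv (fun i => a (Sum.inl i)) (mulTPow (a (Sum.inr ())) f m) x -
          monomialDeriv (fun i => b (Sum.inl i)) (mulTPow (b (Sum.inr ())) f m) x = 0)

/-- The points `x` with `x_i ≠ 0` for `i ∈ σ`, and `|x_j| < R |x_σ^{A_σ⁻¹ a_j}|` for the `j ∉ σ`
with `|A_σ⁻¹ a_j| = 1`. It contains all `x` with `x_i ≠ 0` for `i ∈ σ` and `x_j = 0` for `j ∉ σ`. -/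
def region {d n : ℕ} (A : Matrix (Fin d) (Fin n) ℤ) (σ : Finset (Fin n)) (R : ℝ) :
    Set (Fin n → ℂ) :=
  {x | (∀ i ∈ σ, x i ≠ 0) ∧
    ∀ j, j ∉ σ → ∀ c : Fin n → ℝ, IsCoords A σ j c → ∑ i ∈ σ, c i = 1 →
      ‖x j‖ < R * ∏ i ∈ σ, ‖x i‖ ^ c i}

end ModifiedGKZ

end

/-!
The series `φ_v` is a hypergeometric series, and everything follows from the size of its
coefficients together with the geometry of the columns relative to the simplex `σ`.

*Genericity.* A coordinate `v_i` with `i ∈ σ` is an affine function of `β`, with linear part a row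
of `A_σ⁻¹`. Hence the conditions `v_i ∉ ℤ` are avoided by a locally finite family of hyperplanes
(`forVeryGeneric_notInt`). Outside these hyperplanes `nsupp v = ∅`, the index set of `φ_v` consists
of the `u` in the kernel with `v_j + u_j ≥ 0` for `j ∉ σ`, and the coefficient of `x^(v+u)` is
`∏ Γ(v_i + 1) / ∏ Γ(v_i + u_i + 1)` (`phiCoeff_eq`).

*Geometry.* Let `ℓ` be the linear form equal to `1` on the columns of `σ`; `height j` is `ℓ(a_j)`
times a common denominator `D` of `A_σ⁻¹`. The hypothesis on `A` says that `ℓ` is not identically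
`1` on the columns. Hence `σ` lies in a facet of `conv(A)` which is not a facet of `Δ_A` if and only
if `ℓ(a_j) ≥ 1` for all `j` (`liesInInnerFacet_iff`). For `u` in the kernel,
`∑ u_i = ∑_{j ∉ σ} (1 - ℓ(a_j)) u_j`, and the exponent of `t` in the monomial of `u` is a constant
minus `κ ∑ u_i`. Hence the exponents of `t` are bounded below exactly under this condition on `ℓ`
(`AssocData.le_height_of_bounded`, `AssocData.exists_bounded`).

*Gevrey order.* By estimates of the Gamma function, the coefficient of `x^(v+u)` is, up to geometric
factors, `(-∑ u_i)!` (`AssocData.exists_phiCoeff_bounds`), which for the power `t^(γ + m)` is about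
`(m!)^(1/κ)`. After division by this factor the series becomes an absolutely convergent power series
in `t` and the functions `x_j x_σ^{-A_σ⁻¹ a_j}`, `j ∉ σ`; only the `j` with `ℓ(a_j) = 1` restrict the
domain of convergence, because for the others a small `t` compensates
(`AssocData.exists_summable`, `AssocData.isGevrey_of_isExpansion`).

*Sharpness.* There is a column `a_j` with `ℓ(a_j) > 1`. The multiples of the corresponding kernel
vector give monomials whose coefficients really have the size `(m!)^(1/κ)`. The monomials which
belong to a fixed power of `t` have different exponents in the coordinates outside `σ`, so an
individual coefficient is recovered by the Cauchy estimates on a torus around the origin. A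
convergent germ gives bounds only near one point `z₀` of the domain of convergence; these are
carried over to a small torus around the origin by the maximum principle, applied on the lines
through `z₀` (`exists_norm_pow_le_of_arc`, `le_of_coeff_growth`). If the Gevrey order were smaller,
the coefficients would be too small (`AssocData.not_isGevrey_of_isExpansion`).

*Equations.* Up to a common constant, `φ_v` is the sum of the divided monomials
`x^(v+u) / ∏ Γ(v_i + u_i + 1)`. Partial derivatives shift the exponents of divided monomials, and
these are zero when some exponent is a negative integer; so termwise differentiation
(`NormalSum.pderiv`) turns the equations of the modified system into identities between the
coefficients (`isModifiedSolution_of_normalSum`).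
-/


noncomputable section

namespace ModifiedGKZ

/-! ### Power series in several complex variables -/

/-- The sequence `s ^ K u`, `u ∈ U`, depends holomorphically on `s` in the unit disc, as a bounded
function of `u`. -/
theorem exists_analytic_pow_family {U : Type} [TopologicalSpace U] [DiscreteTopology U]
    (K : U → ℕ) :
    ∃ M : ℂ → BoundedContinuousFunction U ℂ, AnalyticOnNhd ℂ M (Metric.ball 0 1) ∧
      ∀ s ∈ Metric.ball (0 : ℂ) 1, ∀ u, M s u = s ^ K u := by
  classical
  have hbd : ∀ k : ℕ, ∀ u : U, ‖(if K u = k then (1 : ℂ) else 0)‖ ≤ 1 := by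
    intro k u; split_ifs <;> simp
  set e : ℕ → BoundedContinuousFunction U ℂ := fun k =>
    BoundedContinuousFunction.ofNormedAddCommGroupDiscrete
      (fun u => if K u = k then (1 : ℂ) else 0) 1 (hbd k) with he
  have hen : ∀ k, ‖e k‖ ≤ 1 := fun k =>
    (BoundedContinuousFunction.norm_le zero_le_one).2 (hbd k)
  have hnorm : ∀ (k : ℕ) (s : ℂ), ‖s ^ k • e k‖ ≤ ‖s‖ ^ k := by
    intro k s
    rw [norm_smul, norm_pow]
    exact mul_le_of_le_one_right (by positivity) (hen k)
  refine ⟨fun s => ∑' k, s ^ k • e k, ?_, ?_⟩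
  · intro s hs
    obtain ⟨r, hsr, hr1⟩ := exists_between (mem_ball_zero_iff.1 hs)
    have hr0 : 0 < r := (norm_nonneg s).trans_lt hsr
    have hd : DifferentiableOn ℂ (fun s : ℂ => ∑' k, s ^ k • e k) (Metric.ball 0 r) := by
      refine Complex.differentiableOn_tsum_of_summable_norm
        (summable_geometric_of_lt_one hr0.le hr1) (fun k => ?_) Metric.isOpen_ball ?_
      · fun_prop
      · intro k w hw
        exact (hnorm k w).trans
          (pow_le_pow_left₀ (norm_nonneg _) (mem_ball_zero_iff.1 hw).le k)
    exact hd.analyticAt (Metric.isOpen_ball.mem_nhds (mem_ball_zero_iff.2 hsr))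
  · intro s hs u
    have hsum : Summable fun k => s ^ k • e k :=
      Summable.of_norm_bounded
        (summable_geometric_of_lt_one (norm_nonneg s) (mem_ball_zero_iff.1 hs)) (fun k => hnorm k s)
    have h1 := (BoundedContinuousFunction.evalCLM ℂ u).map_tsum hsum
    have h2 : (∑' k, s ^ k • e k) u =
        ∑' k, (BoundedContinuousFunction.evalCLM ℂ u) (s ^ k • e k) := h1
    show (∑' k, s ^ k • e k) u = s ^ K u
    rw [h2, tsum_eq_single (K u)]
    · simp [he]
    · intro k hk
      simp [he, hk.symm]

/-- A power series in several variables which converges absolutely at the radii `r` is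
analytic on the open polydisc of radii `r`. -/
theorem analyticOnNhd_tsum_monomial {ι U : Type} [Fintype ι] (a : U → ℂ) (K : U → ι → ℕ)
    (r : ι → ℝ) (hr : ∀ i, 0 < r i) (hs : Summable fun u => ‖a u‖ * ∏ i, r i ^ K u i) :
    AnalyticOnNhd ℂ (fun z : ι → ℂ => ∑' u, a u * ∏ i, z i ^ K u i) {z | ∀ i, ‖z i‖ < r i} := by
  classical
  let _ : TopologicalSpace U := ⊥
  have _ : DiscreteTopology U := ⟨rfl⟩
  choose M hM hMs using fun i => exists_analytic_pow_family (U := U) fun u => K u i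
  set b : U → ℂ := fun u => a u * ∏ i, (r i : ℂ) ^ K u i with hb
  have hbn : ∀ u, ‖b u‖ = ‖a u‖ * ∏ i, r i ^ K u i := by
    intro u
    simp [hb, norm_prod, abs_of_pos, hr]
  have hbs : Summable fun u => ‖b u‖ := by simpa only [hbn] using hs
  -- the functional `F ↦ ∑ b_u F(u)` on bounded functions of `u`
  have hLs : Summable fun u => b u • (BoundedContinuousFunction.evalCLM ℂ u :
      BoundedContinuousFunction U ℂ →L[ℂ] ℂ) := by
    refine Summable.of_norm_bounded hbs fun u => ?_
    rw [norm_smul]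
    refine mul_le_of_le_one_right (norm_nonneg _) ?_
    refine ContinuousLinearMap.opNorm_le_bound _ zero_le_one fun F => ?_
    simpa using F.norm_coe_le_norm u
  set L : BoundedContinuousFunction U ℂ →L[ℂ] ℂ :=
    ∑' u, b u • BoundedContinuousFunction.evalCLM ℂ u with hL
  have hLF : ∀ F, L F = ∑' u, b u * F u := by
    intro F
    have := (ContinuousLinearMap.apply ℂ ℂ F).map_tsum hLs
    simpa using this
  have hscale : ∀ z : ι → ℂ, (∀ i, ‖z i‖ < r i) → ∀ i, z i / r i ∈ Metric.ball (0 : ℂ) 1 := by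
    intro z hz i
    rw [mem_ball_zero_iff, norm_div, Complex.norm_real, Real.norm_of_nonneg (hr i).le]
    exact (div_lt_one (hr i)).2 (hz i)
  have hopen : IsOpen {z : ι → ℂ | ∀ i, ‖z i‖ < r i} := by
    simp only [Set.ofPred_forall]
    exact isOpen_iInter_of_finite fun i => isOpen_lt (by fun_prop) continuous_const
  have han : AnalyticOnNhd ℂ (fun z : ι → ℂ => L (∏ i, M i (z i / r i)))
      {z | ∀ i, ‖z i‖ < r i} := by
    intro z hz
    have h1 : AnalyticAt ℂ (fun z : ι → ℂ => ∏ i, M i (z i / r i)) z := by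
      refine Finset.analyticAt_fun_prod _ fun i _ => ?_
      have h2 : AnalyticAt ℂ (fun z : ι → ℂ => z i / r i) z := by
        have : AnalyticAt ℂ (fun z : ι → ℂ => z i) z :=
          (ContinuousLinearMap.proj (R := ℂ) (φ := fun _ : ι => ℂ) i).analyticAt z
        exact this.div analyticAt_const (by exact_mod_cast (hr i).ne')
      exact AnalyticAt.fun_comp (hM i _ (hscale z hz i)) h2
    exact (L.analyticAt _).fun_comp h1
  refine han.congr hopen fun z hz => ?_
  simp only [hLF]
  refine tsum_congr fun u => ?_
  have h3 : (∏ i, M i (z i / r i)) u = ∏ i, (z i / r i) ^ K u i := by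
    have := map_prod (M := BoundedContinuousFunction U ℂ) (N := ℂ)
      ({ toFun := fun F => F u, map_one' := rfl, map_mul' := fun _ _ => rfl } :
        BoundedContinuousFunction U ℂ →* ℂ) (fun i => M i (z i / r i)) Finset.univ
    refine this.trans ?_
    exact Finset.prod_congr rfl fun i _ => hMs i _ (hscale z hz i) u
  rw [h3, hb]
  simp only
  rw [mul_assoc, ← Finset.prod_mul_distrib]
  congr 1
  refine Finset.prod_congr rfl fun i _ => ?_
  rw [← mul_pow, mul_div_cancel₀]
  exact_mod_cast (hr i).ne'

theorem norm_fourier_apply (n : ℤ) (θ : AddCircle (1 : ℝ)) : ‖(fourier n θ : ℂ)‖ = 1 := by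
  rw [fourier_apply, Circle.norm_coe]

theorem integral_fourier (n : ℤ) :
    ∫ θ : AddCircle (1 : ℝ), (fourier n θ : ℂ) ∂AddCircle.haarAddCircle = if n = 0 then 1 else 0 := by
  have h := (orthonormal_iff_ite.mp (orthonormal_fourier (T := 1))) 0 n
  simp only [MeasureTheory.ContinuousMap.inner_toLp, ← fourier_neg, ← fourier_add] at h
  simpa [eq_comm] using h

/-- The Cauchy estimate for the coefficients of a power series in several variables. -/
theorem norm_coeff_mul_le {ι U : Type} [Fintype ι] [Countable U] (a : U → ℂ) (K : U → ι → ℕ)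
    (hK : Function.Injective K) (ρ : ι → ℝ) (hρ : ∀ i, 0 ≤ ρ i)
    (hs : Summable fun u => ‖a u‖ * ∏ i, ρ i ^ K u i) (B : ℝ)
    (hB : ∀ z : ι → ℂ, (∀ i, ‖z i‖ = ρ i) → ‖∑' u, a u * ∏ i, z i ^ K u i‖ ≤ B) (u₀ : U) :
    ‖a u₀‖ * ∏ i, ρ i ^ K u₀ i ≤ B := by
  classical
  set μ : MeasureTheory.Measure (ι → AddCircle (1 : ℝ)) :=
    MeasureTheory.Measure.pi fun _ => AddCircle.haarAddCircle with hμ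
  set b : U → ℂ := fun u => a u * ∏ i, (ρ i : ℂ) ^ K u i with hb
  have hbn : ∀ u, ‖b u‖ = ‖a u‖ * ∏ i, ρ i ^ K u i := by
    intro u
    simp [hb, norm_prod, abs_of_nonneg, hρ]
  set E : U → (ι → AddCircle (1 : ℝ)) → ℂ := fun u θ =>
    b u * ∏ i, (fourier ((K u i : ℤ) - K u₀ i) (θ i) : ℂ) with hE
  have hEn : ∀ u θ, ‖E u θ‖ = ‖b u‖ := by
    intro u θ
    simp [hE, norm_prod, norm_fourier_apply, -fourier_apply]
  have hEc : ∀ u, Continuous (E u) := by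
    intro u
    simp only [hE]
    fun_prop
  have hEint : ∀ u, MeasureTheory.Integrable (E u) μ := fun u =>
    MeasureTheory.Integrable.of_bound (hEc u).aestronglyMeasurable ‖b u‖
      (Filter.Eventually.of_forall fun θ => (hEn u θ).le)
  have hEs : ∀ θ, Summable fun u => E u θ := fun θ =>
    Summable.of_norm (by simpa only [hEn, hbn] using hs)
  have hI : ∀ u, ∫ θ, E u θ ∂μ = if u = u₀ then b u₀ else 0 := by
    intro u
    simp only [hE]
    rw [MeasureTheory.integral_const_mul, hμ,
      MeasureTheory.integral_fintype_prod_eq_prod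
        (fun i (θ : AddCircle (1 : ℝ)) => (fourier ((K u i : ℤ) - K u₀ i) θ : ℂ))]
    simp only [integral_fourier]
    split_ifs with h
    · subst h; simp
    · have : K u ≠ K u₀ := fun h' => h (hK h')
      obtain ⟨i, hi⟩ := Function.ne_iff.1 this
      rw [Finset.prod_eq_zero (Finset.mem_univ i), mul_zero]
      rw [if_neg]
      intro h0
      exact hi (by exact_mod_cast sub_eq_zero.1 h0)
  have hsum := MeasureTheory.hasSum_integral_of_summable_integral_norm (μ := μ) hEint (by
    simp only [hEn]
    simpa [hbn] using hs)
  simp only [hI] at hsum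
  have h1 := hsum.unique (hasSum_ite_eq u₀ (b u₀))
  rw [← hbn, ← h1]
  have h2 := MeasureTheory.norm_integral_le_of_norm_le_const (μ := μ) (C := B)
    (f := fun θ => ∑' u, E u θ) (Filter.Eventually.of_forall fun θ => ?_)
  · simpa using h2
  · have hz := hB (fun i => ρ i * (fourier 1 (θ i) : ℂ))
      (fun i => by simp [norm_fourier_apply, -fourier_apply, abs_of_nonneg, hρ])
    have h3 : ∑' u, E u θ = (∑' u, a u * ∏ i, (ρ i * (fourier 1 (θ i) : ℂ)) ^ K u i) *
        ∏ i, (fourier (-(K u₀ i : ℤ)) (θ i) : ℂ) := by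
      rw [← tsum_mul_right]
      refine tsum_congr fun u => ?_
      simp only [hE, hb, mul_pow, Finset.prod_mul_distrib, sub_eq_add_neg, fourier_add]
      have : ∀ i, (fourier (K u i : ℤ) (θ i) : ℂ) = (fourier 1 (θ i) : ℂ) ^ K u i := by
        intro i
        rw [fourier_apply, fourier_apply, one_zsmul, AddCircle.toCircle_zsmul]
        simp
      simp only [this]
      ring
    rw [h3, norm_mul, norm_prod]
    simpa only [norm_fourier_apply, Finset.prod_const_one, mul_one] using hz

/-! ### Bounds on the coefficients from bounds near one point -/

/-- If a holomorphic function on the unit disc is bounded by `B` on the unit circle and by `b` on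
the arc around `1` of points at distance less than `δ`, then `|h(0)|^N ≤ b B^(N-1)` for some `N`
depending on `δ` only: apply the maximum principle to the product of `N` rotations of `h`. -/
theorem exists_norm_pow_le_of_arc {δ : ℝ} (hδ : 0 < δ) :
    ∃ N : ℕ, 0 < N ∧ ∀ h : ℂ → ℂ, DiffContOnCl ℂ h (Metric.ball 0 1) → ∀ B b : ℝ,
      (∀ ζ : ℂ, ‖ζ‖ = 1 → ‖h ζ‖ ≤ B) → (∀ ζ : ℂ, ‖ζ‖ = 1 → ‖ζ - 1‖ < δ → ‖h ζ‖ ≤ b) →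
      ‖h 0‖ ^ N ≤ b * B ^ (N - 1) := by
  obtain ⟨N, hN⟩ := exists_nat_gt (2 * Real.pi / δ)
  have hN0' : (0 : ℝ) < N := lt_of_le_of_lt (by positivity) hN
  have hN0 : 0 < N := by exact_mod_cast hN0'
  refine ⟨N, hN0, fun h hh B b hB hb => ?_⟩
  have hB0 : 0 ≤ B := (norm_nonneg _).trans (hB 1 (by simp))
  have hb0 : 0 ≤ b := (norm_nonneg _).trans (hb 1 (by simp) (by simpa using hδ))
  set ω : ℤ → ℂ := fun l => Complex.exp ((2 * Real.pi * l / N : ℝ) * Complex.I) with hω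
  have hωn : ∀ l, ‖ω l‖ = 1 := fun l => Complex.norm_exp_ofReal_mul_I _
  have hωmod : ∀ l : ℤ, ω l = ω (l % N) := by
    intro l
    simp only [hω]
    refine Complex.exp_eq_exp_iff_exists_int.2 ⟨l / N, ?_⟩
    have h1 : (l : ℂ) = (l % N : ℤ) + N * (l / N : ℤ) := by
      exact_mod_cast (Int.emod_add_mul_ediv l N).symm
    have hNc : (N : ℂ) ≠ 0 := by exact_mod_cast hN0.ne'
    push_cast
    rw [h1]
    field_simp
  set G : ℂ → ℂ := fun ζ => ∏ l ∈ Finset.range N, h (ω l * ζ) with hG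
  have hmaps : ∀ l, Set.MapsTo (fun ζ => ω l * ζ) (Metric.ball 0 1) (Metric.ball 0 1) := by
    intro l ζ hζ
    simpa [hωn] using hζ
  have hGd : DiffContOnCl ℂ G (Metric.ball 0 1) := by
    have h1 : ∀ l : ℕ, DiffContOnCl ℂ (fun ζ => h (ω l * ζ)) (Metric.ball 0 1) := fun l =>
      DiffContOnCl.comp hh (Differentiable.diffContOnCl
        (show Differentiable ℂ fun ζ => ω l * ζ by fun_prop)) (hmaps l)
    constructor
    · exact DifferentiableOn.fun_finsetProd fun l _ => (h1 l).differentiableOn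
    · exact continuousOn_finsetProd _ fun l _ => (h1 l).continuousOn
  have hbound : ∀ ζ ∈ frontier (Metric.ball (0 : ℂ) 1), ‖G ζ‖ ≤ b * B ^ (N - 1) := by
    intro ζ hζ
    have hζ1 : ‖ζ‖ = 1 := by
      rw [frontier_ball _ one_ne_zero] at hζ
      simpa using hζ
    -- a rotation which brings `ζ` into the arc
    set x : ℝ := -ζ.arg * N / (2 * Real.pi) with hx
    set l : ℤ := round x with hl
    have harc : ‖ω l * ζ - 1‖ < δ := by
      have h1 : ω l * ζ = Complex.exp (Complex.I * ((2 * Real.pi * (l - x) / N : ℝ) : ℂ)) := by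
        conv_lhs => rw [← Complex.norm_mul_exp_arg_mul_I ζ, hζ1]
        simp only [hω, Complex.ofReal_one, one_mul]
        rw [← Complex.exp_add]
        congr 1
        have hNc : (N : ℂ) ≠ 0 := by exact_mod_cast hN0.ne'
        have hpi : (Real.pi : ℂ) ≠ 0 := by exact_mod_cast Real.pi_ne_zero
        rw [hx]
        push_cast
        field_simp
        ring
      rw [h1]
      refine (Real.norm_exp_I_mul_ofReal_sub_one_le).trans_lt ?_
      have h2 : |(l : ℝ) - x| ≤ 1 / 2 := by
        rw [abs_sub_comm]; exact abs_sub_round x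
      rw [Real.norm_eq_abs, abs_div, abs_mul, abs_of_pos (by positivity : 0 < 2 * Real.pi),
        abs_of_pos hN0', div_lt_iff₀ hN0']
      rw [div_lt_iff₀ hδ] at hN
      nlinarith [Real.pi_pos]
    have hmod0 : 0 ≤ l % N := Int.emod_nonneg _ (by exact_mod_cast hN0.ne')
    have hmodN : l % N < N := Int.emod_lt_of_pos _ (by exact_mod_cast hN0)
    set k : ℕ := (l % N).toNat with hk
    have hkl : (k : ℤ) = l % N := Int.toNat_of_nonneg hmod0
    have hkN : k ∈ Finset.range N := by
      rw [Finset.mem_range]; omega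
    simp only [hG]
    rw [norm_prod, ← Finset.mul_prod_erase _ _ hkN]
    have hcard : ((Finset.range N).erase k).card = N - 1 := by
      rw [Finset.card_erase_of_mem hkN, Finset.card_range]
    refine mul_le_mul ?_ ?_ (Finset.prod_nonneg fun _ _ => norm_nonneg _) hb0
    · refine hb _ (by rw [norm_mul, hωn, hζ1, one_mul]) ?_
      rwa [hkl, ← hωmod]
    · rw [← hcard, ← Finset.prod_const]
      exact Finset.prod_le_prod (fun _ _ => norm_nonneg _)
        fun j _ => hB _ (by rw [norm_mul, hωn, hζ1, one_mul])
  have h0 := Complex.norm_le_of_forall_mem_frontier_norm_le Metric.isBounded_ball hGd hbound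
    (z := 0) (subset_closure (Metric.mem_ball_self one_pos))
  simpa [hG] using h0

/-- The coefficients of a convergent germ grow at most geometrically, uniformly near `p`. -/
theorem IsConvergentGerm.exists_bound {n : ℕ} {p : Fin n → ℂ} {g : ℕ → (Fin n → ℂ) → ℂ}
    (hg : IsConvergentGerm p g) :
    ∃ C : ℝ, 0 < C ∧ ∀ᶠ x in 𝓝 p, ∀ m, ‖g m x‖ ≤ C ^ (m + 1) := by
  obtain ⟨G, hG, hsum⟩ := hg
  have hGb : ∀ᶠ q in 𝓝 ((p, 0) : (Fin n → ℂ) × ℂ), ‖G q‖ < ‖G (p, 0)‖ + 1 :=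
    hG.continuousAt.norm.eventually (gt_mem_nhds (lt_add_one _))
  obtain ⟨ε, hε, hball⟩ := Metric.eventually_nhds_iff_ball.1 (hGb.and hsum)
  set M := ‖G (p, 0)‖ + 1 with hM
  have hM1 : 1 ≤ M := by rw [hM]; linarith [norm_nonneg (G (p, 0))]
  set ρ := ε / 2 with hρ
  have hρ0 : 0 < ρ := half_pos hε
  refine ⟨(1 / ρ + 1) * M, by positivity, ?_⟩
  filter_upwards [Metric.ball_mem_nhds p hε] with x hx m
  have hin : ∀ t : ℂ, ‖t‖ = ρ → (x, t) ∈ Metric.ball ((p, 0) : (Fin n → ℂ) × ℂ) ε := by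
    intro t ht
    rw [Metric.mem_ball, Prod.dist_eq, max_lt_iff]
    refine ⟨hx, ?_⟩
    rw [dist_zero_right, ht]
    exact half_lt_self hε
  have h1 := norm_coeff_mul_le (ι := Unit) (U := ℕ) (fun k => g k x) (fun k _ => k)
    (fun a b h => congrFun h ()) (fun _ => ρ) (fun _ => hρ0.le) ?_ M ?_ m
  · simp only [Finset.univ_unique, Finset.prod_singleton] at h1
    have h2 : ‖g m x‖ ≤ M * (1 / ρ) ^ m := by
      rw [one_div, inv_pow, ← div_eq_mul_inv, le_div_iff₀ (by positivity)]
      exact h1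
    refine h2.trans ?_
    rw [pow_succ, mul_comm]
    have h3 : 1 / ρ ≤ (1 / ρ + 1) * M := by
      nlinarith [show 0 < 1 / ρ by positivity]
    have h4 : M ≤ (1 / ρ + 1) * M := by
      nlinarith [show 0 < 1 / ρ by positivity]
    gcongr
  · have := (hball _ (hin (ρ : ℂ) (by simp [hρ0.le]))).2.summable.norm
    simpa [abs_of_pos hρ0] using this
  · intro z hz
    have := hball _ (hin (z ()) (hz ()))
    simp only [Finset.univ_unique, Finset.prod_singleton]
    rw [show (default : Unit) = () from rfl, this.2.tsum_eq]
    exact this.1.le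

/-- No positive power of the factorial is dominated by a geometric sequence. -/
theorem le_zero_of_factorial_rpow_le {ε Γ : ℝ} (hΓ : 0 < Γ) {N : ℕ → ℕ}
    (hN : Filter.Tendsto N Filter.atTop Filter.atTop)
    (h : ∀ q, ((N q).factorial : ℝ) ^ ε ≤ Γ ^ (N q + 1)) : ε ≤ 0 := by
  by_contra! hε
  set D : ℝ := max 1 (Γ ^ (1 / ε)) with hD
  have hD1 : 1 ≤ D := le_max_left _ _
  have h1 := ((FloorSemiring.tendsto_pow_div_factorial_atTop D).comp hN).eventually
    (gt_mem_nhds (show (0 : ℝ) < 1 / (2 * D) by positivity))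
  obtain ⟨q, hq⟩ := h1.exists
  simp only [Function.comp] at hq
  have hf : (0 : ℝ) < (N q).factorial := by exact_mod_cast Nat.factorial_pos _
  have h2 : ((N q).factorial : ℝ) ≤ D ^ (N q + 1) := by
    have h3 := Real.rpow_le_rpow (by positivity) (h q) (show 0 ≤ 1 / ε by positivity)
    rw [← Real.rpow_mul hf.le, mul_one_div_cancel hε.ne', Real.rpow_one] at h3
    refine h3.trans ?_
    rw [← Real.rpow_natCast, ← Real.rpow_mul hΓ.le, mul_comm, Real.rpow_mul hΓ.le,
      Real.rpow_natCast]
    exact pow_le_pow_left₀ (by positivity) (le_max_right _ _) _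
  rw [div_lt_div_iff₀ hf (by positivity), one_mul] at hq
  rw [pow_succ] at h2
  have h4 : 0 < D ^ N q := by positivity
  nlinarith

/-- In an absolutely convergent series `∑ a_u / (m_u!)^e r^{K u} τ^{m u}`, the terms with a fixed
power of `τ` form an absolutely convergent series. -/
theorem summable_fiber {ι U : Type} [Fintype ι] {a : U → ℂ} {K : U → ι → ℕ} {m : U → ℕ} {e : ℝ}
    {r : ι → ℝ} {τ : ℝ} (hτ : 0 < τ)
    (hs : Summable fun u => ‖a u‖ / ((m u).factorial : ℝ) ^ e * (∏ i, r i ^ K u i) * τ ^ m u)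
    (k : ℕ) : Summable fun v : {u // m u = k} => ‖a v‖ * ∏ i, r i ^ K v i := by
  have h := (hs.comp_injective (Subtype.val_injective (p := fun u => m u = k))).mul_right
    ((k.factorial : ℝ) ^ e * (1 / τ) ^ k)
  refine h.congr ?_
  rintro ⟨v, rfl⟩
  have : ((m v).factorial : ℝ) ^ e ≠ 0 :=
    (Real.rpow_pos_of_pos (by exact_mod_cast (m v).factorial_pos) _).ne'
  simp only [Function.comp, one_div, inv_pow]
  field_simp

/-- If the coefficients `a_u` of the series `∑ a_u z^{K u} t^{m u}` have, up to geometric factors,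
the size of `(m!)^e` along a sequence of indices, then the coefficients of the powers of `t` cannot
be bounded by `C^{n+1} (n!)^s` with `s < e`, even on a small neighbourhood of a point `z₀` of the
domain of convergence. For `c` on a small torus around the origin, the function
`ζ ↦ P_n(c + ζ (z₀ - c))` is small for `ζ` in an arc around `1`, hence at `ζ = 0`, and the Cauchy
estimates on the torus bound the coefficients. -/
theorem le_of_coeff_growth {ι U : Type} [Fintype ι] [Countable U] (a : U → ℂ) (K : U → ι → ℕ)
    (hK : Function.Injective K) (m : U → ℕ) (e s : ℝ) (z₀ : ι → ℂ) (r : ι → ℝ)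
    (hr : ∀ i, ‖z₀ i‖ < r i) (τ : ℝ) (hτ : 0 < τ)
    (hs : Summable fun u => ‖a u‖ / ((m u).factorial : ℝ) ^ e * (∏ i, r i ^ K u i) * τ ^ m u)
    (C : ℝ) (hC : 0 < C)
    (hsmall : ∀ᶠ z in 𝓝 z₀, ∀ k : ℕ,
      ‖∑' u : {u // m u = k}, a u * ∏ i, z i ^ K u i‖ ≤ C ^ (k + 1) * (k.factorial : ℝ) ^ s)
    (u : ℕ → U) (hu : Filter.Tendsto (fun q => m (u q)) Filter.atTop Filter.atTop)
    (c : ℝ) (hc : 0 < c)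
    (hlow : ∀ q, c ^ (m (u q) + 1) * ((m (u q)).factorial : ℝ) ^ e ≤ ‖a (u q)‖)
    (E : ℕ) (hE : ∀ q, ∑ i, K (u q) i ≤ E * (m (u q) + 1)) : e ≤ s := by
  classical
  have hr0 : ∀ i, 0 < r i := fun i => (norm_nonneg _).trans_lt (hr i)
  set T : U → ℝ := fun u =>
    ‖a u‖ / ((m u).factorial : ℝ) ^ e * (∏ i, r i ^ K u i) * τ ^ m u with hT
  have hprod0 : ∀ v, 0 ≤ ∏ i, r i ^ K v i := fun v =>
    Finset.prod_nonneg fun i _ => pow_nonneg (hr0 i).le _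
  have hfac : ∀ k : ℕ, 0 < (k.factorial : ℝ) ^ e := fun k =>
    Real.rpow_pos_of_pos (by exact_mod_cast k.factorial_pos) _
  have hfacs : ∀ k : ℕ, 0 < (k.factorial : ℝ) ^ s := fun k =>
    Real.rpow_pos_of_pos (by exact_mod_cast k.factorial_pos) _
  have hT0 : ∀ v, 0 ≤ T v := fun v => by
    simp only [hT]
    have := hprod0 v
    have := hfac (m v)
    positivity
  -- the terms of the coefficient of `t ^ k`
  have hterm : ∀ k : ℕ, ∀ v : {u // m u = k},
      ‖a v‖ * ∏ i, r i ^ K v i = T v * ((k.factorial : ℝ) ^ e * (1 / τ) ^ k) := by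
    rintro k ⟨v, rfl⟩
    have := (hfac (m v)).ne'
    simp only [hT, one_div, inv_pow]
    field_simp
  have hfib : ∀ k : ℕ, Summable fun v : {u // m u = k} => ‖a v‖ * ∏ i, r i ^ K v i :=
    summable_fiber hτ hs
  set S : ℝ := ∑' v, T v with hS
  have hS0 : 0 ≤ S := tsum_nonneg hT0
  set P : ℕ → (ι → ℂ) → ℂ := fun k z => ∑' v : {u // m u = k}, a v * ∏ i, z i ^ K v i with hP
  have hbig : ∀ k z, (∀ i, ‖z i‖ ≤ r i) →
      ‖P k z‖ ≤ S * ((k.factorial : ℝ) ^ e * (1 / τ) ^ k) := by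
    intro k z hz
    have h1 : ∀ v : {u // m u = k},
        ‖a v * ∏ i, z i ^ K v i‖ ≤ ‖a v‖ * ∏ i, r i ^ K v i := by
      intro v
      rw [norm_mul, norm_prod]
      refine mul_le_mul_of_nonneg_left ?_ (norm_nonneg _)
      refine Finset.prod_le_prod (fun _ _ => norm_nonneg _) fun i _ => ?_
      rw [norm_pow]
      exact pow_le_pow_left₀ (norm_nonneg _) (hz i) _
    refine (tsum_of_norm_bounded (hfib k).hasSum h1).trans ?_
    simp only [hterm]
    rw [tsum_mul_right]
    have := hfac k
    refine mul_le_mul_of_nonneg_right ?_ (by positivity)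
    exact hs.tsum_subtype_le _ _ hT0
  obtain ⟨η, hη, hball⟩ := Metric.eventually_nhds_iff_ball.1 hsmall
  set ρ : ι → ℝ := fun i => (r i - ‖z₀ i‖) / 3 with hρ
  have hρ0 : ∀ i, 0 < ρ i := fun i => by simp only [hρ]; linarith [hr i]
  have hρr : ∀ i, ρ i ≤ r i := fun i => by simp only [hρ]; linarith [norm_nonneg (z₀ i), hr0 i]
  set W : ℝ := ∑ i, (ρ i + ‖z₀ i‖) + 1 with hW
  have hW1 : ∀ i, ρ i + ‖z₀ i‖ ≤ W := fun i => by
    have := Finset.single_le_sum (f := fun i => ρ i + ‖z₀ i‖)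
      (fun j _ => add_nonneg (hρ0 j).le (norm_nonneg _)) (Finset.mem_univ i)
    simp only [hW]
    linarith
  have hW0 : 0 < W := by
    have : 0 ≤ ∑ i, (ρ i + ‖z₀ i‖) :=
      Finset.sum_nonneg fun j _ => add_nonneg (hρ0 j).le (norm_nonneg _)
    simp only [hW]
    linarith
  obtain ⟨N, hN0, hN⟩ := exists_norm_pow_le_of_arc (show 0 < η / W by positivity)
  -- the bound on the small torus
  have htorus : ∀ k : ℕ, ∀ z : ι → ℂ, (∀ i, ‖z i‖ = ρ i) →
      ‖P k z‖ ^ N ≤ C ^ (k + 1) * (k.factorial : ℝ) ^ s *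
        (S * ((k.factorial : ℝ) ^ e * (1 / τ) ^ k)) ^ (N - 1) := by
    intro k z hz
    have hline : ∀ ζ : ℂ, ‖ζ‖ ≤ 1 → ∀ i, ‖z i + ζ * (z₀ i - z i)‖ < r i := by
      intro ζ hζ i
      have h1 : ‖z i + ζ * (z₀ i - z i)‖ ≤ ρ i + 1 * (‖z₀ i‖ + ρ i) := by
        refine (norm_add_le _ _).trans ?_
        rw [norm_mul, hz i]
        gcongr
        exact (norm_sub_le _ _).trans (by rw [hz i])
      have := hr i
      simp only [hρ] at h1
      linarith
    have hPan : AnalyticOnNhd ℂ (P k) {z | ∀ i, ‖z i‖ < r i} :=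
      analyticOnNhd_tsum_monomial (fun v : {u // m u = k} => a v) (fun v => K v) r hr0 (hfib k)
    have hd : DiffContOnCl ℂ (fun ζ : ℂ => P k (fun i => z i + ζ * (z₀ i - z i)))
        (Metric.ball 0 1) := by
      apply DifferentiableOn.diffContOnCl
      rw [closure_ball _ one_ne_zero]
      intro ζ hζ
      have h1 := (hPan _ (hline ζ (by simpa using hζ))).differentiableAt
      have h2 : DifferentiableAt ℂ (fun ζ : ℂ => fun i => z i + ζ * (z₀ i - z i)) ζ := by
        fun_prop
      exact (DifferentiableAt.comp (f := fun ζ : ℂ => fun i => z i + ζ * (z₀ i - z i)) ζ h1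
        h2).differentiableWithinAt
    have h3 := hN _ hd (S * ((k.factorial : ℝ) ^ e * (1 / τ) ^ k))
      (C ^ (k + 1) * (k.factorial : ℝ) ^ s)
      (fun ζ hζ => hbig k _ fun i => (hline ζ hζ.le i).le) ?_
    · simpa using h3
    · intro ζ hζ hζ1
      refine hball _ ?_ k
      rw [mem_ball_iff_norm, pi_norm_lt_iff hη]
      intro i
      have h4 : z i + ζ * (z₀ i - z i) - z₀ i = (ζ - 1) * (z₀ i - z i) := by ring
      simp only [Pi.sub_apply]
      rw [h4, norm_mul]
      have h5 : ‖z₀ i - z i‖ ≤ W := by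
        refine (norm_sub_le _ _).trans ?_
        rw [hz i]
        linarith [hW1 i]
      calc ‖ζ - 1‖ * ‖z₀ i - z i‖ ≤ ‖ζ - 1‖ * W := by gcongr
        _ < η / W * W := by gcongr
        _ = η := by field_simp
  -- the Cauchy estimates on the torus
  have hcoef : ∀ v : U, (‖a v‖ * ∏ i, ρ i ^ K v i) ^ N ≤
      C ^ (m v + 1) * ((m v).factorial : ℝ) ^ s *
        (S * (((m v).factorial : ℝ) ^ e * (1 / τ) ^ m v)) ^ (N - 1) := by
    intro v
    set X := C ^ (m v + 1) * ((m v).factorial : ℝ) ^ s *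
        (S * (((m v).factorial : ℝ) ^ e * (1 / τ) ^ m v)) ^ (N - 1) with hX
    have hX0 : 0 ≤ X := by
      have := hfac (m v)
      have := hfacs (m v)
      positivity
    have hNne : (N : ℝ) ≠ 0 := by exact_mod_cast hN0.ne'
    have h1 := norm_coeff_mul_le (fun w : {u // m u = m v} => a w) (fun w => K w)
      (hK.comp Subtype.val_injective) ρ (fun i => (hρ0 i).le)
      (Summable.of_nonneg_of_le
        (fun w => mul_nonneg (norm_nonneg _)
          (Finset.prod_nonneg fun i _ => pow_nonneg (hρ0 i).le _))
        (fun w => mul_le_mul_of_nonneg_left (Finset.prod_le_prod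
          (fun i _ => pow_nonneg (hρ0 i).le _)
          fun i _ => pow_le_pow_left₀ (hρ0 i).le (hρr i) _) (norm_nonneg _)) (hfib (m v)))
      (X ^ (1 / (N : ℝ))) ?_ ⟨v, rfl⟩
    · have h0 : 0 ≤ ‖a v‖ * ∏ i, ρ i ^ K v i := mul_nonneg (norm_nonneg _)
          (Finset.prod_nonneg fun i _ => pow_nonneg (hρ0 i).le _)
      calc (‖a v‖ * ∏ i, ρ i ^ K v i) ^ N ≤ (X ^ (1 / (N : ℝ))) ^ N :=
            pow_le_pow_left₀ h0 h1 _
        _ = X := by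
            rw [← Real.rpow_natCast, ← Real.rpow_mul hX0, one_div_mul_cancel hNne, Real.rpow_one]
    · intro z hz
      have h2 := htorus (m v) z hz
      have h3 := Real.rpow_le_rpow (by positivity) h2 (show 0 ≤ 1 / (N : ℝ) by positivity)
      rwa [← Real.rpow_natCast, ← Real.rpow_mul (norm_nonneg _), mul_one_div_cancel hNne,
        Real.rpow_one] at h3
  -- a common lower bound for the radii of the torus
  obtain ⟨ρ₁, hρ₁, hρ₁1, hρ₁le⟩ : ∃ ρ₁ : ℝ, 0 < ρ₁ ∧ ρ₁ ≤ 1 ∧ ∀ i, ρ₁ ≤ ρ i := by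
    have : ∀ᶠ x : ℝ in 𝓝[>] 0, ∀ i, x ≤ ρ i := by
      rw [Filter.eventually_all]
      intro i
      exact nhdsWithin_le_nhds (ge_mem_nhds (hρ0 i))
    have h1 : ∀ᶠ x : ℝ in 𝓝[>] 0, x ≤ 1 := nhdsWithin_le_nhds (ge_mem_nhds one_pos)
    obtain ⟨x, ⟨h2, h3⟩, h4⟩ := ((this.and h1).and self_mem_nhdsWithin).exists
    exact ⟨x, h4, h3, h2⟩
  have hprodlow : ∀ q, (ρ₁ ^ E) ^ (m (u q) + 1) ≤ ∏ i, ρ i ^ K (u q) i := by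
    intro q
    calc (ρ₁ ^ E) ^ (m (u q) + 1) = ρ₁ ^ (E * (m (u q) + 1)) := by rw [pow_mul]
      _ ≤ ρ₁ ^ (∑ i, K (u q) i) := pow_le_pow_of_le_one hρ₁.le hρ₁1 (hE q)
      _ = ∏ i, ρ₁ ^ K (u q) i := by rw [Finset.prod_pow_eq_pow_sum]
      _ ≤ ∏ i, ρ i ^ K (u q) i :=
        Finset.prod_le_prod (fun _ _ => by positivity)
          fun i _ => pow_le_pow_left₀ hρ₁.le (hρ₁le i) _
  set Y : ℝ := (S + 1) * (1 / τ + 1) with hY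
  have hY0 : 0 < Y := by positivity
  have hYle : ∀ k : ℕ, S * (1 / τ) ^ k ≤ Y ^ (k + 1) := by
    intro k
    have h1 : 1 / τ ≤ Y := by
      have : 0 < 1 / τ := by positivity
      simp only [hY]
      nlinarith
    have h2 : S ≤ Y := by
      have : 0 < 1 / τ := by positivity
      simp only [hY]
      nlinarith
    rw [pow_succ, mul_comm]
    gcongr
  set L : ℝ := (c * ρ₁ ^ E) ^ N with hL
  have hL0 : 0 < L := by positivity
  have hmain : ∀ q, ((m (u q)).factorial : ℝ) ^ (e - s) ≤
      (C * Y ^ (N - 1) / L) ^ (m (u q) + 1) := by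
    intro q
    set k := m (u q) with hk
    set F : ℝ := (k.factorial : ℝ) ^ e with hF
    have hF0 : 0 < F := hfac k
    have h1 : (c ^ (k + 1) * F * (ρ₁ ^ E) ^ (k + 1)) ^ N ≤
        C ^ (k + 1) * (k.factorial : ℝ) ^ s * (F * Y ^ (k + 1)) ^ (N - 1) := by
      calc (c ^ (k + 1) * F * (ρ₁ ^ E) ^ (k + 1)) ^ N
          ≤ (‖a (u q)‖ * ∏ i, ρ i ^ K (u q) i) ^ N := by
            refine pow_le_pow_left₀ (by positivity) ?_ _
            exact mul_le_mul (hlow q) (hprodlow q) (by positivity) (norm_nonneg _)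
        _ ≤ _ := hcoef (u q)
        _ ≤ _ := by
            have := hfacs k
            refine mul_le_mul_of_nonneg_left (pow_le_pow_left₀ (by positivity) ?_ _)
              (by positivity)
            calc S * (F * (1 / τ) ^ k) = F * (S * (1 / τ) ^ k) := by ring
              _ ≤ F * Y ^ (k + 1) := by gcongr; exact hYle k
    have h2 : (c ^ (k + 1) * F * (ρ₁ ^ E) ^ (k + 1)) ^ N = L ^ (k + 1) * (F * F ^ (N - 1)) := by
      rw [hL, ← pow_succ', Nat.sub_add_cancel hN0]
      simp only [mul_pow, ← pow_mul]
      ring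
    have h3 : C ^ (k + 1) * (k.factorial : ℝ) ^ s * (F * Y ^ (k + 1)) ^ (N - 1) =
        (C * Y ^ (N - 1)) ^ (k + 1) * ((k.factorial : ℝ) ^ s * F ^ (N - 1)) := by
      simp only [mul_pow, ← pow_mul]
      ring
    rw [h2, h3] at h1
    have hFp : 0 < F ^ (N - 1) := by positivity
    have h4 : L ^ (k + 1) * F ≤ (C * Y ^ (N - 1)) ^ (k + 1) * (k.factorial : ℝ) ^ s := by
      refine le_of_mul_le_mul_right ?_ hFp
      linarith
    have h5 : (0 : ℝ) < k.factorial := by exact_mod_cast k.factorial_pos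
    rw [Real.rpow_sub h5, div_pow, div_le_div_iff₀ (hfacs k) (by positivity)]
    linarith
  have := le_zero_of_factorial_rpow_le (by positivity) hu hmain
  linarith

/-! ### Factorials and the growth of the coefficients -/

theorem factorial_add_le (a b : ℕ) : (a + b).factorial ≤ 2 ^ (a + b) * (a.factorial * b.factorial) := by
  rw [← Nat.add_choose_mul_factorial_mul_factorial a b, mul_assoc]
  exact Nat.mul_le_mul_right _ (Nat.choose_le_two_pow _ _)

theorem factorial_sum_le {ι : Type} (s : Finset ι) (f : ι → ℕ) :
    (∑ i ∈ s, f i).factorial ≤ 2 ^ (s.card * ∑ i ∈ s, f i) * ∏ i ∈ s, (f i).factorial := by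
  classical
  induction s using Finset.induction_on with
  | empty => simp
  | insert a s ha ih =>
    rw [Finset.sum_insert ha, Finset.prod_insert ha, Finset.card_insert_of_notMem ha]
    set S := ∑ i ∈ s, f i
    calc (f a + S).factorial ≤ 2 ^ (f a + S) * ((f a).factorial * S.factorial) :=
          factorial_add_le _ _
      _ ≤ 2 ^ (f a + S) * ((f a).factorial *
          (2 ^ (s.card * S) * ∏ i ∈ s, (f i).factorial)) := by gcongr
      _ = 2 ^ (f a + S + s.card * S) * ((f a).factorial * ∏ i ∈ s, (f i).factorial) := by
          rw [pow_add 2 (f a + S)]; ring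
      _ ≤ _ := by
          gcongr
          · norm_num
          · nlinarith [Nat.zero_le (s.card * f a)]

/-- The order of magnitude, up to geometric factors, of `1 / Γ(z + n + 1)` for `n ∈ ℤ`:
it is `1 / n!` for `n ≥ 0` and `|n|!` for `n ≤ 0`. -/
def recipFactorial (n : ℤ) : ℝ := ((-n).toNat.factorial : ℝ) / (n.toNat.factorial : ℝ)

theorem recipFactorial_pos (n : ℤ) : 0 < recipFactorial n := by
  unfold recipFactorial
  have := (-n).toNat.factorial_pos
  have := n.toNat.factorial_pos
  positivity

theorem prod_recipFactorial {ι : Type} [Fintype ι] (w : ι → ℤ) :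
    ∏ i, recipFactorial (w i) =
      ((∏ i, (-(w i)).toNat.factorial : ℕ) : ℝ) / ((∏ i, (w i).toNat.factorial : ℕ) : ℝ) := by
  simp [recipFactorial, Finset.prod_div_distrib]

theorem sum_toNat_sub {ι : Type} [Fintype ι] (w : ι → ℤ) :
    (-∑ i, w i).toNat = ∑ i, (-(w i)).toNat - ∑ i, (w i).toNat := by
  have h : -∑ i, w i = ((∑ i, (-(w i)).toNat : ℕ) : ℤ) - ((∑ i, (w i).toNat : ℕ) : ℤ) := by
    push_cast
    rw [← Finset.sum_sub_distrib, ← Finset.sum_neg_distrib]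
    refine Finset.sum_congr rfl fun i _ => ?_
    omega
  rw [h]
  omega

theorem sum_toNat_add {ι : Type} [Fintype ι] (w : ι → ℤ) :
    ∑ i, (-(w i)).toNat + ∑ i, (w i).toNat = ∑ i, (w i).natAbs := by
  rw [← Finset.sum_add_distrib]
  refine Finset.sum_congr rfl fun i _ => ?_
  omega

/-- Since multinomial coefficients are bounded by geometric factors, so is the quotient of a product
of values of `recipFactorial` by the factorial of minus the sum of the arguments (of `0`, if that
number is negative). -/
theorem prod_recipFactorial_le {ι : Type} [Fintype ι] (w : ι → ℤ) :
    ∏ i, recipFactorial (w i) ≤ (2 ^ (Fintype.card ι + 1) : ℝ) ^ (∑ i, (w i).natAbs) *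
      ((-∑ i, w i).toNat.factorial : ℝ) := by
  rw [prod_recipFactorial, div_le_iff₀ (by
    have : 0 < ∏ i, (w i).toNat.factorial := Finset.prod_pos fun i _ => Nat.factorial_pos _
    exact_mod_cast this), sum_toNat_sub, ← sum_toNat_add]
  set P := ∑ i, (-(w i)).toNat
  set Q := ∑ i, (w i).toNat with hQ
  have h1 : ∏ i, (-(w i)).toNat.factorial ≤ P.factorial :=
    Nat.le_of_dvd (Nat.factorial_pos _) (Nat.prod_factorial_dvd_factorial_sum _ _)
  have h2 : Q.factorial ≤ 2 ^ (Fintype.card ι * Q) * ∏ i, (w i).toNat.factorial :=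
    factorial_sum_le Finset.univ _
  have h3 : P.factorial ≤ 2 ^ P * (Q.factorial * (P - Q).factorial) := by
    rcases le_total P Q with h | h
    · calc P.factorial ≤ Q.factorial := Nat.factorial_le h
        _ ≤ _ := by
          rw [Nat.sub_eq_zero_of_le h, Nat.factorial_zero, mul_one]
          exact Nat.le_mul_of_pos_left _ (by positivity)
    · have := factorial_add_le Q (P - Q)
      rwa [Nat.add_sub_cancel' h] at this
  have h4 : ∏ i, (-(w i)).toNat.factorial ≤ (2 ^ (Fintype.card ι + 1)) ^ (P + Q) *
      (P - Q).factorial * ∏ i, (w i).toNat.factorial := by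
    calc ∏ i, (-(w i)).toNat.factorial ≤ 2 ^ P * (Q.factorial * (P - Q).factorial) := h1.trans h3
      _ ≤ 2 ^ P * ((2 ^ (Fintype.card ι * Q) * ∏ i, (w i).toNat.factorial) *
          (P - Q).factorial) := by gcongr
      _ = 2 ^ (P + Fintype.card ι * Q) * (P - Q).factorial * ∏ i, (w i).toNat.factorial := by
          rw [pow_add]; ring
      _ ≤ _ := by
          rw [← pow_mul]
          gcongr
          · norm_num
          · nlinarith [Nat.zero_le (Fintype.card ι * P)]
  exact_mod_cast h4

theorem le_prod_recipFactorial {ι : Type} [Fintype ι] (w : ι → ℤ) (hw : ∑ i, w i ≤ 0) :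
    ((-∑ i, w i).toNat.factorial : ℝ) ≤ (2 ^ (Fintype.card ι + 1) : ℝ) ^ (∑ i, (w i).natAbs) *
      ∏ i, recipFactorial (w i) := by
  have hpos : 0 < ∏ i, (w i).toNat.factorial := Finset.prod_pos fun i _ => Nat.factorial_pos _
  have hQP : ∑ i, (w i).toNat ≤ ∑ i, (-(w i)).toNat := by
    have h : ∑ i, w i = ((∑ i, (w i).toNat : ℕ) : ℤ) - ((∑ i, (-(w i)).toNat : ℕ) : ℤ) := by
      push_cast
      rw [← Finset.sum_sub_distrib]
      refine Finset.sum_congr rfl fun i _ => ?_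
      omega
    omega
  rw [prod_recipFactorial, ← mul_div_assoc, le_div_iff₀ (by exact_mod_cast hpos), sum_toNat_sub,
    ← sum_toNat_add]
  set P := ∑ i, (-(w i)).toNat with hP
  set Q := ∑ i, (w i).toNat
  have h1 : ∏ i, (w i).toNat.factorial ≤ Q.factorial :=
    Nat.le_of_dvd (Nat.factorial_pos _) (Nat.prod_factorial_dvd_factorial_sum _ _)
  have h2 : P.factorial ≤ 2 ^ (Fintype.card ι * P) * ∏ i, (-(w i)).toNat.factorial :=
    factorial_sum_le Finset.univ _
  have h3 : (P - Q).factorial * Q.factorial ≤ P.factorial := by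
    have := Nat.le_of_dvd (Nat.factorial_pos _) (Nat.factorial_mul_factorial_dvd_factorial_add (P - Q) Q)
    rwa [Nat.sub_add_cancel hQP] at this
  have h4 : (P - Q).factorial * ∏ i, (w i).toNat.factorial ≤
      (2 ^ (Fintype.card ι + 1)) ^ (P + Q) * ∏ i, (-(w i)).toNat.factorial := by
    calc (P - Q).factorial * ∏ i, (w i).toNat.factorial ≤ (P - Q).factorial * Q.factorial := by
          gcongr
      _ ≤ 2 ^ (Fintype.card ι * P) * ∏ i, (-(w i)).toNat.factorial := h3.trans h2
      _ ≤ _ := by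
          rw [← pow_mul]
          refine Nat.mul_le_mul_right _ (Nat.pow_le_pow_right (by norm_num) ?_)
          nlinarith [Nat.zero_le (Fintype.card ι * Q)]
  exact_mod_cast h4

/-- `M!^κ ≤ (κ M)!`, since a product of factorials divides the factorial of the sum. -/
theorem factorial_le_rpow {κ M m : ℕ} (hκ : 0 < κ) (h : κ * M ≤ m) :
    (M.factorial : ℝ) ≤ (m.factorial : ℝ) ^ (1 / (κ : ℝ)) := by
  have h1 : M.factorial ^ κ ≤ m.factorial := by
    have := Nat.le_of_dvd (Nat.factorial_pos _)
      (Nat.prod_factorial_dvd_factorial_sum (Finset.range κ) fun _ => M)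
    simp only [Finset.prod_const, Finset.sum_const, Finset.card_range, smul_eq_mul] at this
    exact this.trans (Nat.factorial_le h)
  have h2 : ((M.factorial : ℝ) ^ κ) ^ (1 / (κ : ℝ)) ≤ (m.factorial : ℝ) ^ (1 / (κ : ℝ)) :=
    Real.rpow_le_rpow (by positivity) (by exact_mod_cast h1) (by positivity)
  rwa [one_div, Real.pow_rpow_inv_natCast (by positivity) hκ.ne', ← one_div] at h2

/-- A converse of `factorial_le_rpow` up to geometric factors. -/
theorem rpow_le_factorial {κ M m₀ : ℕ} (hκ : 0 < κ) :
    ((κ * M + m₀).factorial : ℝ) ^ (1 / (κ : ℝ)) ≤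
      (4 * m₀.factorial : ℝ) ^ (κ * M + m₀ + 1) * M.factorial := by
  set m := κ * M + m₀ with hm
  have h1 : (κ * M).factorial ≤ 2 ^ (κ * (κ * M)) * M.factorial ^ κ := by
    have := factorial_sum_le (Finset.range κ) fun _ => M
    simpa using this
  have h2 : m.factorial ≤ 2 ^ m * m₀.factorial * (2 ^ (κ * (κ * M)) * M.factorial ^ κ) := by
    calc m.factorial ≤ 2 ^ m * ((κ * M).factorial * m₀.factorial) := factorial_add_le _ _
      _ ≤ 2 ^ m * ((2 ^ (κ * (κ * M)) * M.factorial ^ κ) * m₀.factorial) := by gcongr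
      _ = _ := by ring
  have h3 : m.factorial ≤ ((4 * m₀.factorial) ^ (m + 1) * M.factorial) ^ κ := by
    refine h2.trans ?_
    rw [mul_pow, ← mul_assoc]
    gcongr
    have hf := m₀.factorial_pos
    calc 2 ^ m * m₀.factorial * 2 ^ (κ * (κ * M))
        ≤ (2 ^ m * m₀.factorial) ^ κ * (2 ^ m) ^ κ := by
          refine Nat.mul_le_mul (Nat.le_self_pow hκ.ne' _) ?_
          rw [← pow_mul, mul_comm m κ]
          exact pow_le_pow_right₀ (by norm_num) (Nat.mul_le_mul_left _ (by omega))
      _ = (2 ^ m * 2 ^ m * m₀.factorial) ^ κ := by ring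
      _ ≤ ((4 * m₀.factorial) ^ (m + 1)) ^ κ := by
          refine Nat.pow_le_pow_left ?_ κ
          rw [← mul_pow 2 2, mul_pow 4]
          exact Nat.mul_le_mul (Nat.pow_le_pow_right (by norm_num) (by omega))
            (Nat.le_self_pow (by omega) _)
  have h4 : (m.factorial : ℝ) ^ (1 / (κ : ℝ)) ≤
      (((4 * m₀.factorial : ℝ) ^ (m + 1) * M.factorial) ^ κ) ^ (1 / (κ : ℝ)) :=
    Real.rpow_le_rpow (by positivity) (by exact_mod_cast h3) (by positivity)
  rwa [one_div, Real.pow_rpow_inv_natCast (by positivity) hκ.ne', ← one_div] at h4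

/-- The ratio between consecutive values of `recipFactorial`. -/
def stepRatio (n : ℤ) : ℝ := if 1 ≤ n then n else 1 - n

theorem recipFactorial_sub_one (n : ℤ) :
    recipFactorial (n - 1) = stepRatio n * recipFactorial n := by
  unfold recipFactorial stepRatio
  split_ifs with h
  · obtain ⟨k, rfl⟩ : ∃ k : ℕ, n = k + 1 := ⟨(n - 1).toNat, by omega⟩
    have h1 : (-((k : ℤ) + 1 - 1)).toNat = 0 := by omega
    have h2 : ((k : ℤ) + 1 - 1).toNat = k := by omega
    have h3 : (-((k : ℤ) + 1)).toNat = 0 := by omega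
    have h4 : ((k : ℤ) + 1).toNat = k + 1 := by omega
    rw [h1, h2, h3, h4, Nat.factorial_succ]
    have : (k.factorial : ℝ) ≠ 0 := by exact_mod_cast k.factorial_ne_zero
    push_cast
    field_simp
  · obtain ⟨k, rfl⟩ : ∃ k : ℕ, n = -k := ⟨(-n).toNat, by omega⟩
    have h1 : (-(-(k : ℤ) - 1)).toNat = k + 1 := by omega
    have h2 : (-(k : ℤ) - 1).toNat = 0 := by omega
    have h3 : (-(-(k : ℤ))).toNat = k := by omega
    have h4 : (-(k : ℤ)).toNat = 0 := by omega
    rw [h1, h2, h3, h4, Nat.factorial_succ]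
    push_cast
    ring

theorem stepRatio_bounds (n : ℤ) : (|(n : ℝ)| + 1) / 2 ≤ stepRatio n ∧ stepRatio n ≤ |(n : ℝ)| + 1 := by
  unfold stepRatio
  split_ifs with h
  · have : (1 : ℝ) ≤ n := by exact_mod_cast h
    rw [abs_of_pos (by linarith)]
    constructor <;> linarith
  · have : (n : ℝ) ≤ 0 := by exact_mod_cast (by omega : n ≤ 0)
    rw [abs_of_nonpos this]
    constructor <;> linarith

/-- The steps `z + n` of the recursion for `Γ` are comparable with those of `recipFactorial`, since
`z` has a positive distance from the integers. -/
theorem exists_norm_add_int_bounds {z : ℂ} (hz : ∀ k : ℤ, z ≠ k) :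
    ∃ C : ℝ, 1 ≤ C ∧ ∀ n : ℤ, stepRatio n ≤ C * ‖z + n‖ ∧ ‖z + n‖ ≤ C * stepRatio n := by
  obtain ⟨δ, hδ, hball⟩ : ∃ δ > 0, ∀ n : ℤ, δ ≤ ‖z + n‖ := by
    have hcl : IsClosed (Set.range (fun n : ℤ => (n : ℂ))) :=
      Complex.isClosedEmbedding_intCast.isClosed_range
    have hmem : z ∈ (Set.range (fun n : ℤ => (n : ℂ)))ᶜ := by
      rintro ⟨k, hk⟩
      exact hz k hk.symm
    obtain ⟨δ, hδ, h⟩ := Metric.isOpen_iff.1 hcl.isOpen_compl z hmem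
    refine ⟨δ, hδ, fun n => ?_⟩
    by_contra! hn
    refine h (a := ((-n : ℤ) : ℂ)) ?_ ⟨-n, rfl⟩
    rw [Metric.mem_ball, dist_comm, dist_eq_norm]
    push_cast
    simpa using hn
  refine ⟨2 * (‖z‖ + 1) + (‖z‖ + 1) / δ + 1, ?_, fun n => ?_⟩
  · have : 0 ≤ (‖z‖ + 1) / δ := by positivity
    linarith [norm_nonneg z]
  have hn : ‖(n : ℂ)‖ = |(n : ℝ)| := by simp
  have h1 : ‖z + n‖ ≤ ‖z‖ + |(n : ℝ)| := hn ▸ norm_add_le _ _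
  have h2 : |(n : ℝ)| ≤ ‖z + n‖ + ‖z‖ := by
    rw [← hn]
    calc ‖(n : ℂ)‖ = ‖(z + n) - z‖ := by ring_nf
      _ ≤ _ := norm_sub_le _ _
  obtain ⟨h3, h4⟩ := stepRatio_bounds n
  have h5 := hball n
  have hz0 := norm_nonneg z
  have habs := abs_nonneg (n : ℝ)
  have h6 : ‖z‖ + 1 ≤ (‖z‖ + 1) / δ * ‖z + n‖ := by
    rw [div_mul_eq_mul_div, le_div_iff₀ hδ]
    gcongr
  constructor
  · nlinarith [mul_nonneg hz0 (norm_nonneg (z + n))]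
  · have h7 : 0 ≤ (‖z‖ + 1) / δ * stepRatio n := mul_nonneg (by positivity) (by linarith)
    nlinarith [mul_nonneg hz0 habs, mul_nonneg hz0 (show (0 : ℝ) ≤ stepRatio n - (|(n : ℝ)| + 1) / 2 by linarith)]

/-- For `z ∉ ℤ`, the numbers `1 / Γ(z + n + 1)`, `n ∈ ℤ`, have the size of `recipFactorial n` up to
geometric factors. -/
theorem exists_norm_inv_Gamma_bounds {z : ℂ} (hz : ∀ k : ℤ, z ≠ k) :
    ∃ C : ℝ, 1 ≤ C ∧ ∀ n : ℤ,
      ‖(Complex.Gamma (z + n + 1))⁻¹‖ ≤ C ^ (n.natAbs + 1) * recipFactorial n ∧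
      recipFactorial n ≤ C ^ (n.natAbs + 1) * ‖(Complex.Gamma (z + n + 1))⁻¹‖ := by
  obtain ⟨C₀, hC₀, hb⟩ := exists_norm_add_int_bounds hz
  set g : ℤ → ℝ := fun n => ‖(Complex.Gamma (z + n + 1))⁻¹‖ with hg
  have hstep : ∀ n : ℤ, g (n - 1) = ‖z + n‖ * g n := by
    intro n
    simp only [hg]
    rw [← norm_mul, ← Complex.one_div_Gamma_eq_self_mul_one_div_Gamma_add_one]
    push_cast
    ring_nf
  have hg0 : 0 < g 0 := by
    simp only [hg]
    rw [norm_pos_iff]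
    refine inv_ne_zero (Complex.Gamma_ne_zero fun k hk => ?_)
    refine hz (-k - 1) ?_
    push_cast at hk ⊢
    linear_combination hk
  set C := max C₀ (max (g 0) (1 / g 0)) with hC
  have hCC₀ : C₀ ≤ C := le_max_left _ _
  have hC1 : 1 ≤ C := hC₀.trans hCC₀
  have hCg : g 0 ≤ C := (le_max_left _ _).trans (le_max_right _ _)
  have hCg' : 1 ≤ C * g 0 := by
    have : 1 / g 0 ≤ C := (le_max_right _ _).trans (le_max_right _ _)
    rwa [div_le_iff₀ hg0] at this
  have hgn : ∀ n, 0 ≤ g n := fun n => norm_nonneg _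
  have hb' : ∀ n : ℤ, stepRatio n ≤ C * ‖z + n‖ ∧ ‖z + n‖ ≤ C * stepRatio n := by
    intro n
    have h0 : 0 < stepRatio n := by
      have := (stepRatio_bounds n).1
      linarith [abs_nonneg (n : ℝ)]
    refine ⟨(hb n).1.trans ?_, (hb n).2.trans ?_⟩ <;> gcongr
  have hs0 : ∀ n : ℤ, 0 < stepRatio n := fun n => by
    have := (stepRatio_bounds n).1
    linarith [abs_nonneg (n : ℝ)]
  have hC0 : 0 ≤ C := by linarith
  refine ⟨C, hC1, fun n => ?_⟩
  change g n ≤ _ ∧ _ ≤ _ * g n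
  induction n using Int.induction_on with
  | zero => simpa [recipFactorial] using ⟨hCg, hCg'⟩
  | succ k ih =>
    have h1 := hstep (k + 1)
    have h2 := recipFactorial_sub_one (k + 1)
    rw [add_sub_cancel_right] at h1 h2
    have h3 : ((k : ℤ) + 1).natAbs = (k : ℤ).natAbs + 1 := by omega
    rw [h1, h2] at ih
    rw [h3]
    set s := stepRatio (k + 1)
    set t := ‖z + ((k + 1 : ℤ) : ℂ)‖
    set D := C ^ ((k : ℤ).natAbs + 1)
    have hD : 0 ≤ D := by positivity
    have hs := hs0 (k + 1)
    obtain ⟨hb1, hb2⟩ : s ≤ C * t ∧ t ≤ C * s := hb' (k + 1)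
    have ht : 0 < t := by
      by_contra! h
      nlinarith
    have hrp := recipFactorial_pos (k + 1)
    rw [pow_succ C]
    constructor
    · refine le_of_mul_le_mul_left (ih.1.trans ?_) ht
      have : D * recipFactorial (k + 1) * s ≤ D * recipFactorial (k + 1) * (C * t) := by gcongr
      linarith
    · refine le_of_mul_le_mul_left (ih.2.trans ?_) hs
      have : D * g (k + 1) * t ≤ D * g (k + 1) * (C * s) := by
        have := hgn (k + 1)
        gcongr
      linarith
  | pred k ih =>
    have h3 : (-(k : ℤ) - 1).natAbs = (-(k : ℤ)).natAbs + 1 := by omega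
    rw [hstep, recipFactorial_sub_one, h3, pow_succ C]
    obtain ⟨hb1, hb2⟩ := hb' (-k)
    have hrp := recipFactorial_pos (-k)
    have := hs0 (-k)
    constructor
    · calc ‖z + ((-k : ℤ) : ℂ)‖ * g (-k) ≤ (C * stepRatio (-k)) *
            (C ^ ((-(k : ℤ)).natAbs + 1) * recipFactorial (-k)) :=
          mul_le_mul hb2 ih.1 (hgn _) (by positivity)
        _ = _ := by ring
    · calc stepRatio (-k) * recipFactorial (-k) ≤ (C * ‖z + ((-k : ℤ) : ℂ)‖) *
            (C ^ ((-(k : ℤ)).natAbs + 1) * g (-k)) :=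
          mul_le_mul hb1 ih.2 hrp.le (by positivity)
        _ = _ := by ring

/-! ### Linear algebra of a simplex -/

/-- An integral form of the inverse of `A_σ`: the matrix `T` with rows indexed by `σ`
(extended by zero) is `D` times `A_σ⁻¹`. -/
structure SimplexInverse {d n : ℕ} (A : Matrix (Fin d) (Fin n) ℤ) (σ : Finset (Fin n)) where
  /-- A common denominator of the entries of `A_σ⁻¹`. -/
  D : ℕ
  /-- The matrix `D A_σ⁻¹`. -/
  T : Fin n → Fin d → ℤ
  D_pos : 0 < D
  T_off : ∀ i, i ∉ σ → T i = 0
  T_mul : ∀ i ∈ σ, ∀ j ∈ σ, ∑ r, T i r * A r j = if i = j then (D : ℤ) else 0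
  mul_T : ∀ r s, ∑ i ∈ σ, A r i * T i s = if r = s then (D : ℤ) else 0

theorem IsSimplex.nonempty_simplexInverse {d n : ℕ} {A : Matrix (Fin d) (Fin n) ℤ}
    {σ : Finset (Fin n)} (h : IsSimplex A σ) : Nonempty (SimplexInverse A σ) := by
  classical
  obtain ⟨hli, hsp⟩ := h
  have hcard : Fintype.card (Fin d) = Fintype.card σ := by
    have := Module.finrank_eq_card_basis (Module.Basis.mk hli hsp.ge)
    simpa using this
  let e : Fin d ≃ σ := Fintype.equivOfCardEq hcard
  let B : Matrix (Fin d) (Fin d) ℤ := Matrix.of fun r s => A r (e s)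
  have hdet : B.det ≠ 0 := by
    have hli' : LinearIndependent ℝ (B.map (Int.castRingHom ℝ)).col := by
      have := hli.comp e e.injective
      exact this
    have hu := Matrix.linearIndependent_cols_iff_isUnit.1 hli'
    rw [Matrix.isUnit_iff_isUnit_det] at hu
    intro h0
    rw [← RingHom.mapMatrix_apply, ← RingHom.map_det, h0] at hu
    simp at hu
  have hD : ((B.det.natAbs ^ 2 : ℕ) : ℤ) = B.det * B.det := by
    push_cast
    rw [sq_abs, sq]
  refine ⟨⟨B.det.natAbs ^ 2, fun i r =>
    if hi : i ∈ σ then B.det * B.adjugate (e.symm ⟨i, hi⟩) r else 0,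
    pow_pos (Int.natAbs_pos.2 hdet) 2, ?_, ?_, ?_⟩⟩
  · intro i hi
    funext r
    simp [hi]
  · intro i hi j hj
    simp only [hi, dif_pos]
    have h1 := congrFun (congrFun (Matrix.adjugate_mul B) (e.symm ⟨i, hi⟩)) (e.symm ⟨j, hj⟩)
    rw [Matrix.mul_apply] at h1
    have h2 : ∀ r, B r (e.symm ⟨j, hj⟩) = A r j := by
      intro r
      simp [B]
    simp only [h2] at h1
    rw [hD]
    simp only [mul_assoc]
    rw [← Finset.mul_sum, h1]
    by_cases hij : i = j
    · subst hij
      simp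
    · have : e.symm ⟨i, hi⟩ ≠ e.symm ⟨j, hj⟩ := by
        intro h
        exact hij (congrArg Subtype.val (e.symm.injective h))
      simp [Matrix.one_apply_ne this, hij]
  · intro r s
    have h1 := congrFun (congrFun (Matrix.mul_adjugate B) r) s
    rw [Matrix.mul_apply] at h1
    rw [← Finset.sum_attach]
    simp only [Finset.coe_mem, dif_pos, Subtype.coe_eta]
    have h2 : ∑ i : σ, A r i * (B.det * B.adjugate (e.symm i) s) =
        ∑ k, A r (e k) * (B.det * B.adjugate k s) := by
      rw [← e.sum_comp]
      simp
    rw [Finset.univ_eq_attach] at h2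
    rw [h2, hD]
    have h3 : ∑ k, A r (e k) * (B.det * B.adjugate k s) = B.det * ∑ k, B r k * B.adjugate k s := by
      rw [Finset.mul_sum]
      refine Finset.sum_congr rfl fun k _ => ?_
      simp only [B, Matrix.of_apply]
      ring
    rw [h3, h1]
    by_cases hrs : r = s
    · subst hrs; simp
    · simp [Matrix.one_apply_ne hrs, hrs]

namespace SimplexInverse

variable {d n : ℕ} {A : Matrix (Fin d) (Fin n) ℤ} {σ : Finset (Fin n)} (S : SimplexInverse A σ)

/-- `D` times the coordinates of the column `a_j` in the basis `σ`. -/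
def coord (j i : Fin n) : ℤ := ∑ r, S.T i r * A r j

/-- `D` times the sum of the coordinates of the column `a_j` in the basis `σ`. -/
def height (j : Fin n) : ℤ := ∑ i, S.coord j i

theorem coord_of_notMem {i : Fin n} (hi : i ∉ σ) (j : Fin n) : S.coord j i = 0 := by
  simp [coord, S.T_off i hi]

theorem coord_of_mem {i j : Fin n} (hi : i ∈ σ) (hj : j ∈ σ) :
    S.coord j i = if i = j then (S.D : ℤ) else 0 := S.T_mul i hi j hj

theorem height_of_mem {j : Fin n} (hj : j ∈ σ) : S.height j = S.D := by
  unfold height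
  rw [Finset.sum_eq_single j]
  · simp [S.coord_of_mem hj hj]
  · intro i _ hij
    by_cases hi : i ∈ σ
    · simp [S.coord_of_mem hi hj, hij]
    · exact S.coord_of_notMem hi j
  · simp

theorem sum_coord_smul {R : Type} [CommRing R] (r : Fin d) (x : Fin d → R) :
    ∑ i ∈ σ, (A r i : R) * ∑ s, (S.T i s : R) * x s = S.D * x r := by
  have h1 : ∀ s, ∑ i ∈ σ, (A r i : R) * (S.T i s : R) = if r = s then (S.D : R) else 0 := by
    intro s
    have := congrArg (Int.cast : ℤ → R) (S.mul_T r s)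
    push_cast at this
    exact this
  simp only [Finset.mul_sum]
  rw [Finset.sum_comm]
  simp only [← mul_assoc, ← Finset.sum_mul, h1]
  simp

/-- The relation `D a_j = ∑_{i ∈ σ} (coord j i) a_i`. -/
theorem sum_mul_coord (r : Fin d) (j : Fin n) :
    ∑ i ∈ σ, A r i * S.coord j i = S.D * A r j := by
  have := S.sum_coord_smul (R := ℤ) r (fun s => A s j)
  simpa [coord] using this

/-- The pairing of the row `T_i` with `∑_j y_j a_j`. -/
theorem sum_T_mul {R : Type} [CommRing R] (i : Fin n) (y : Fin n → R) :
    ∑ r, (S.T i r : R) * ∑ j, (A r j : R) * y j = ∑ j, (S.coord j i : R) * y j := by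
  simp only [Finset.mul_sum, coord]
  rw [Finset.sum_comm]
  refine Finset.sum_congr rfl fun j _ => ?_
  push_cast
  rw [Finset.sum_mul]
  exact Finset.sum_congr rfl fun r _ => by ring

theorem sum_coord_mul_eq {R : Type} [CommRing R] {i : Fin n} (hi : i ∈ σ) (y : Fin n → R) :
    ∑ j, (S.coord j i : R) * y j = S.D * y i + ∑ j ∈ σᶜ, (S.coord j i : R) * y j := by
  classical
  rw [← Finset.sum_add_sum_compl σ]
  congr 1
  rw [Finset.sum_eq_single i]
  · simp [S.coord_of_mem hi hi]
  · intro j hj hji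
    simp [S.coord_of_mem hi hj, hji.symm]
  · exact fun h => absurd hi h

theorem D_mul_eq_of_ker {u : Fin n → ℤ} (hu : A.mulVec u = 0) {i : Fin n} (hi : i ∈ σ) :
    (S.D : ℤ) * u i = -∑ j ∈ σᶜ, S.coord j i * u j := by
  have h1 := S.sum_T_mul (R := ℤ) i u
  have h2 := S.sum_coord_mul_eq (R := ℤ) hi u
  have h3 : ∀ r, ∑ j, A r j * u j = 0 := fun r => congrFun hu r
  simp only [Int.cast_id] at h1 h2
  simp only [h3, mul_zero, Finset.sum_const_zero] at h1
  linarith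

theorem D_mul_sum_of_ker {u : Fin n → ℤ} (hu : A.mulVec u = 0) :
    (S.D : ℤ) * ∑ i, u i = ∑ j ∈ σᶜ, (S.D - S.height j) * u j := by
  classical
  rw [← Finset.sum_add_sum_compl σ, mul_add, Finset.mul_sum,
    Finset.sum_congr rfl fun i hi => S.D_mul_eq_of_ker hu hi, Finset.sum_neg_distrib,
    Finset.sum_comm]
  have : ∀ j, ∑ i ∈ σ, S.coord j i * u j = S.height j * u j := by
    intro j
    rw [← Finset.sum_mul, height]
    congr 1
    exact Finset.sum_subset (Finset.subset_univ _) fun i _ hi => S.coord_of_notMem hi j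
  simp only [this, sub_mul, Finset.sum_sub_distrib, Finset.mul_sum]
  ring

/-- The element `q (D e_j - ∑_{i ∈ σ} (coord j i) e_i)` of the kernel of `A`. -/
def kerVec (j : Fin n) (q : ℤ) (i : Fin n) : ℤ :=
  q * ((if i = j then (S.D : ℤ) else 0) - S.coord j i)

theorem mulVec_kerVec (j : Fin n) (q : ℤ) : A.mulVec (S.kerVec j q) = 0 := by
  funext r
  have h1 : ∑ i, A r i * S.coord j i = S.D * A r j := by
    rw [← S.sum_mul_coord]
    exact (Finset.sum_subset (Finset.subset_univ _) fun i _ hi => by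
      rw [S.coord_of_notMem hi, mul_zero]).symm
  show ∑ i, A r i * S.kerVec j q i = 0
  have h2 : ∀ i, A r i * S.kerVec j q i =
      q * ((if i = j then A r i * (S.D : ℤ) else 0) - A r i * S.coord j i) := by
    intro i
    unfold kerVec
    split_ifs <;> ring
  simp only [h2]
  rw [← Finset.mul_sum, Finset.sum_sub_distrib, h1]
  simp
  ring_nf
  simp

theorem sum_kerVec (j : Fin n) (q : ℤ) : ∑ i, S.kerVec j q i = q * (S.D - S.height j) := by
  unfold kerVec
  rw [← Finset.mul_sum, Finset.sum_sub_distrib]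
  simp [height]

theorem kerVec_of_notMem {j i : Fin n} (hi : i ∉ σ) (q : ℤ) :
    S.kerVec j q i = if i = j then q * S.D else 0 := by
  unfold kerVec
  rw [S.coord_of_notMem hi]
  split_ifs <;> simp

/-- The coordinates of `a_j` in the basis `σ`. -/
theorem isCoords (j : Fin n) : IsCoords A σ j fun i => (S.coord j i : ℝ) / S.D := by
  have hD : (S.D : ℝ) ≠ 0 := by exact_mod_cast S.D_pos.ne'
  refine ⟨fun i hi => by simp [S.coord_of_notMem hi], ?_⟩
  funext r
  simp only [Finset.sum_apply, Pi.smul_apply, smul_eq_mul, col]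
  have h := congrArg (Int.cast : ℤ → ℝ) (S.sum_mul_coord r j)
  push_cast at h
  have h2 : ∀ i, (S.coord j i : ℝ) / S.D * (A r i : ℝ) = (A r i * S.coord j i : ℝ) / S.D := by
    intro i; ring
  simp only [h2]
  rw [← Finset.sum_div, h]
  field_simp

end SimplexInverse

/-- If `(1, …, 1)` is not in the row span of `A`, then some column does not lie on the hyperplane
through the columns of a simplex. -/
theorem SimplexInverse.exists_height_ne {d n : ℕ} {A : Matrix (Fin d) (Fin n) ℤ}
    {σ : Finset (Fin n)} (S : SimplexInverse A σ)
    (hA : (fun _ : Fin n => (1 : ℚ)) ∉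
      Submodule.span ℚ (Set.range (fun (r : Fin d) (j : Fin n) => (A r j : ℚ)))) :
    ∃ j, S.height j ≠ S.D := by
  by_contra! h
  apply hA
  have hD : (S.D : ℚ) ≠ 0 := by exact_mod_cast S.D_pos.ne'
  have h1 : (fun _ : Fin n => (1 : ℚ)) =
      ∑ r, ((∑ i, (S.T i r : ℚ)) / S.D) • (fun j : Fin n => (A r j : ℚ)) := by
    funext j
    have h2 := congrArg (Int.cast : ℤ → ℚ) (h j)
    simp only [SimplexInverse.height, SimplexInverse.coord] at h2
    push_cast at h2
    rw [Finset.sum_comm] at h2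
    simp only [Finset.sum_apply, Pi.smul_apply, smul_eq_mul]
    have h3 : ∀ r, (∑ i, (S.T i r : ℚ)) / S.D * (A r j : ℚ) =
        (∑ i, (S.T i r : ℚ) * (A r j : ℚ)) / S.D := by
      intro r
      rw [← Finset.sum_mul]
      ring
    simp only [h3]
    rw [← Finset.sum_div, h2, div_self hD]
  rw [h1]
  exact Submodule.sum_mem _ fun r _ =>
    Submodule.smul_mem _ _ (Submodule.subset_span ⟨r, rfl⟩)

/-! ### Very generic parameters -/

theorem ForVeryGeneric.mono {d : ℕ} {P Q : (Fin d → ℂ) → Prop} (h : ForVeryGeneric P)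
    (hPQ : ∀ β, P β → Q β) : ForVeryGeneric Q := by
  obtain ⟨Z, h1, h2, h3⟩ := h
  exact ⟨Z, h1, h2, fun β hβ => hPQ β (h3 β hβ)⟩

theorem isProperZariskiClosed_empty {d : ℕ} : IsProperZariskiClosed (∅ : Set (Fin d → ℂ)) :=
  ⟨Set.empty_ne_univ, {1}, by ext β; simp⟩

theorem isProperZariskiClosed_hyperplane {d : ℕ} (T x : Fin d → ℤ) (hT : ∑ r, T r * x r ≠ 0)
    (k : ℤ) : IsProperZariskiClosed {β : Fin d → ℂ | ∑ r, (T r : ℂ) * β r = k} := by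
  refine ⟨fun h => ?_, {∑ r, MvPolynomial.C (T r : ℂ) * MvPolynomial.X r - MvPolynomial.C (k : ℂ)},
    ?_⟩
  · have h0 : (0 : Fin d → ℂ) ∈ {β : Fin d → ℂ | ∑ r, (T r : ℂ) * β r = k} := h ▸ Set.mem_univ _
    have h1 : (fun r => (x r : ℂ)) ∈ {β : Fin d → ℂ | ∑ r, (T r : ℂ) * β r = k} :=
      h ▸ Set.mem_univ _
    simp only [Set.mem_ofPred_eq, Pi.zero_apply, mul_zero, Finset.sum_const_zero] at h0 h1
    rw [← h0] at h1
    exact hT (by exact_mod_cast h1)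
  · ext β
    simp [sub_eq_zero]

/-- For very generic `β`, the coordinates `v_i`, `i ∈ σ`, of a vector associated with a simplex `σ`
are not integers: otherwise `β` lies on one of countably many hyperplanes `T_i β ∈ ℤ`. -/
theorem forVeryGeneric_notInt {d n : ℕ} (A : Matrix (Fin d) (Fin n) ℤ) :
    ForVeryGeneric (fun β : Fin d → ℂ => ∀ σ : Finset (Fin n), IsSimplex A σ →
      ∀ v : Fin n → ℂ, IsAssociated A β σ v → ∀ i ∈ σ, ∀ k : ℤ, v i ≠ k) := by
  classical
  set S : ∀ σ : Finset (Fin n), IsSimplex A σ → SimplexInverse A σ :=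
    fun σ h => h.nonempty_simplexInverse.some
  -- the hyperplanes, indexed by `(σ, i)` and an integer
  set Z : (Finset (Fin n) × Fin n) × ℤ → Set (Fin d → ℂ) := fun p =>
    if h : IsSimplex A p.1.1 then
      if p.1.2 ∈ p.1.1 then {β | ∑ r, ((S p.1.1 h).T p.1.2 r : ℂ) * β r = p.2} else ∅
    else ∅ with hZ
  have hZp : ∀ p, IsProperZariskiClosed (Z p) := by
    intro p
    simp only [hZ]
    split_ifs with h h'
    · refine isProperZariskiClosed_hyperplane _ (fun r => A r p.1.2) ?_ _
      rw [(S p.1.1 h).T_mul _ h' _ h', if_pos rfl]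
      exact_mod_cast (S p.1.1 h).D_pos.ne'
    · exact isProperZariskiClosed_empty
    · exact isProperZariskiClosed_empty
  have hint : LocallyFinite fun k : ℤ => ({(k : ℂ)} : Set ℂ) := by
    intro x
    refine ⟨Metric.ball x (1 / 2), Metric.ball_mem_nhds _ (by norm_num), ?_⟩
    refine Set.Subsingleton.finite fun k hk l hl => ?_
    simp only [Set.singleton_inter_nonempty, Set.mem_ofPred_eq, Metric.mem_ball] at hk hl
    by_contra hkl
    have h1 : (1 : ℝ) ≤ dist (k : ℂ) (l : ℂ) := by
      rw [dist_eq_norm, ← Int.cast_sub, Complex.norm_intCast]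
      exact_mod_cast Int.one_le_abs (sub_ne_zero.2 hkl)
    have h2 := dist_triangle_right (k : ℂ) l x
    linarith
  have hZf : ∀ q, LocallyFinite fun k => Z (q, k) := by
    intro q
    simp only [hZ]
    split_ifs with h h'
    · have hc : Continuous fun β : Fin d → ℂ => ∑ r, ((S q.1 h).T q.2 r : ℂ) * β r := by fun_prop
      exact hint.preimage_continuous hc
    · exact fun x => ⟨Set.univ, Filter.univ_mem, by simp⟩
    · exact fun x => ⟨Set.univ, Filter.univ_mem, by simp⟩
  have hZl : LocallyFinite Z := by
    intro x
    choose W hW hWf using fun q => hZf q x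
    refine ⟨⋂ q, W q, Filter.iInter_mem.2 hW, ?_⟩
    refine (Set.Finite.biUnion (Set.finite_univ (α := Finset (Fin n) × Fin n))
      fun q _ => (hWf q).image fun k => (q, k)).subset ?_
    rintro ⟨q, k⟩ ⟨y, hy1, hy2⟩
    simp only [Set.mem_iUnion]
    exact ⟨q, Set.mem_univ _, k, ⟨y, hy1, Set.mem_iInter.1 hy2 q⟩, rfl⟩
  -- enumeration of the family by the natural numbers
  set Z' : ℕ → Set (Fin d → ℂ) := fun k =>
    match Encodable.decode₂ ((Finset (Fin n) × Fin n) × ℤ) k with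
    | some p => Z p
    | none => ∅ with hZ'
  refine ⟨Z', ?_, ?_, ?_⟩
  · intro k
    simp only [hZ']
    split
    · exact hZp _
    · exact isProperZariskiClosed_empty
  · intro x
    obtain ⟨W, hW, hWf⟩ := hZl x
    refine ⟨W, hW, (hWf.image Encodable.encode).subset ?_⟩
    rintro k ⟨y, hy1, hy2⟩
    simp only [hZ'] at hy1
    split at hy1
    · rename_i p hp
      exact ⟨p, ⟨y, hy1, hy2⟩, Encodable.decode₂_eq_some.1 hp⟩
    · exact absurd hy1 (Set.notMem_empty y)
  · intro β hβ σ hσ v hv i hi k hik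
    obtain ⟨hv1, hv2⟩ := hv
    choose V hV using hv1
    set l : ℤ := (S σ hσ).D * k +
      ∑ j ∈ (σᶜ).attach, (S σ hσ).coord j i * V j (Finset.mem_compl.1 j.2) with hl
    refine hβ (Set.mem_iUnion.2 ⟨Encodable.encode (((σ, i), l) : (Finset (Fin n) × Fin n) × ℤ), ?_⟩)
    simp only [hZ', Encodable.encodek₂]
    simp only [hZ, dif_pos hσ, if_pos hi, Set.mem_ofPred_eq]
    rw [Finset.sum_congr rfl fun r _ => by rw [← hv2 r], (S σ hσ).sum_T_mul,
      (S σ hσ).sum_coord_mul_eq hi, hik, hl]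
    push_cast
    congr 1
    rw [← Finset.sum_attach]
    exact Finset.sum_congr rfl fun j _ => by rw [hV j (Finset.mem_compl.1 j.2)]

/-! ### Facets of `conv(A)` and of `Δ_A` -/

variable {d n : ℕ} {A : Matrix (Fin d) (Fin n) ℤ} {σ : Finset (Fin n)}

namespace SimplexInverse

variable (S : SimplexInverse A σ)

/-- The linear form which takes the value `1` on the columns of the simplex. -/
def form : (Fin d → ℝ) →ₗ[ℝ] ℝ :=
  ∑ r, ((∑ i, (S.T i r : ℝ)) / S.D) • LinearMap.proj r

theorem form_apply (x : Fin d → ℝ) : S.form x = (∑ i, ∑ r, (S.T i r : ℝ) * x r) / S.D := by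
  simp only [form, LinearMap.sum_apply, LinearMap.smul_apply, LinearMap.proj_apply, smul_eq_mul]
  rw [Finset.sum_comm, Finset.sum_div]
  refine Finset.sum_congr rfl fun r _ => ?_
  rw [← Finset.sum_mul]
  ring

theorem form_col (j : Fin n) : S.form (col A j) = S.height j / S.D := by
  rw [form_apply]
  simp [height, coord, col]

theorem form_col_of_mem {i : Fin n} (hi : i ∈ σ) : S.form (col A i) = 1 := by
  rw [form_col, S.height_of_mem hi]
  have : (S.D : ℝ) ≠ 0 := by exact_mod_cast S.D_pos.ne'
  simp [this]

theorem sum_smul_col (x : Fin d → ℝ) :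
    ∑ i ∈ σ, ((∑ s, (S.T i s : ℝ) * x s) / S.D) • col A i = x := by
  have hD : (S.D : ℝ) ≠ 0 := by exact_mod_cast S.D_pos.ne'
  funext r
  have h := S.sum_coord_smul r x
  simp only [Finset.sum_apply, Pi.smul_apply, smul_eq_mul, col]
  have h2 : ∀ i, (∑ s, (S.T i s : ℝ) * x s) / S.D * (A r i : ℝ) =
      ((A r i : ℝ) * ∑ s, (S.T i s : ℝ) * x s) / S.D := by
    intro i; ring
  simp only [h2]
  rw [← Finset.sum_div, h]
  field_simp

theorem form_eq_sum (x : Fin d → ℝ) :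
    S.form x = ∑ i ∈ σ, (∑ s, (S.T i s : ℝ) * x s) / S.D := by
  conv_lhs => rw [← S.sum_smul_col x]
  rw [map_sum]
  refine Finset.sum_congr rfl fun i hi => ?_
  rw [map_smul, S.form_col_of_mem hi, smul_eq_mul, mul_one]

/-- A linear form which is constant on the columns of the simplex is a multiple of `form`. -/
theorem eq_mul_form (l : (Fin d → ℝ) →ₗ[ℝ] ℝ) {c : ℝ} (h : ∀ i ∈ σ, l (col A i) = c)
    (x : Fin d → ℝ) : l x = c * S.form x := by
  conv_lhs => rw [← S.sum_smul_col x]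
  rw [map_sum, S.form_eq_sum, Finset.mul_sum]
  refine Finset.sum_congr rfl fun i hi => ?_
  rw [map_smul, h i hi, smul_eq_mul, mul_comm]

theorem ker_form_le {F : Set (Fin d → ℝ)} {i₀ : Fin n} (hi₀ : i₀ ∈ σ)
    (hF : ∀ i ∈ σ, col A i ∈ F) : LinearMap.ker S.form ≤ vectorSpan ℝ F := by
  intro x hx
  rw [LinearMap.mem_ker, S.form_eq_sum] at hx
  have h1 : x = ∑ i ∈ σ, ((∑ s, (S.T i s : ℝ) * x s) / S.D) • (col A i -ᵥ col A i₀) := by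
    simp only [vsub_eq_sub, smul_sub, Finset.sum_sub_distrib]
    rw [S.sum_smul_col, ← Finset.sum_smul, hx, zero_smul, sub_zero]
  rw [h1]
  exact Submodule.sum_mem _ fun i hi =>
    Submodule.smul_mem _ _ (vsub_mem_vectorSpan ℝ (hF i hi) (hF i₀ hi₀))

theorem vectorSpan_eq_top {F : Set (Fin d → ℝ)} {i₀ : Fin n} (hi₀ : i₀ ∈ σ)
    (hF : ∀ i ∈ σ, col A i ∈ F) {x : Fin d → ℝ} (hx : x ∈ F) (hx1 : S.form x ≠ 1) :
    vectorSpan ℝ F = ⊤ := by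
  rw [eq_top_iff]
  intro y _
  have h0 : S.form (x - col A i₀) ≠ 0 := by
    rw [map_sub, S.form_col_of_mem hi₀]
    exact sub_ne_zero.2 hx1
  have h1 : y - (S.form y / S.form (x - col A i₀)) • (x - col A i₀) ∈ vectorSpan ℝ F := by
    apply S.ker_form_le hi₀ hF
    rw [LinearMap.mem_ker, map_sub, map_smul, smul_eq_mul, div_mul_cancel₀ _ h0, sub_self]
  have h2 : (S.form y / S.form (x - col A i₀)) • (x - col A i₀) ∈ vectorSpan ℝ F :=
    Submodule.smul_mem _ _ (vsub_mem_vectorSpan ℝ hx (hF i₀ hi₀))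
  simpa using Submodule.add_mem _ h1 h2

theorem finrank_ker_form {i₀ : Fin n} (hi₀ : i₀ ∈ σ) :
    Module.finrank ℝ (LinearMap.ker S.form) + 1 = d := by
  have h0 : S.form ≠ 0 := by
    intro h
    have := S.form_col_of_mem hi₀
    rw [h] at this
    simp at this
  have := Module.Dual.finrank_ker_add_one_of_ne_zero (f := (S.form : Module.Dual ℝ (Fin d → ℝ))) h0
  simpa using this

theorem form_vectorSpan {F : Set (Fin d → ℝ)} (hF : ∀ x ∈ F, S.form x = 1) :
    vectorSpan ℝ F ≤ LinearMap.ker S.form := by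
  rw [vectorSpan, Submodule.span_le]
  rintro _ ⟨x, hx, y, hy, rfl⟩
  simp [hF x hx, hF y hy]

end SimplexInverse

theorem linear_le_on_convexHull {E : Type} [AddCommGroup E] [Module ℝ E] (l : E →ₗ[ℝ] ℝ)
    {s : Set E} {c : ℝ} (h : ∀ x ∈ s, l x ≤ c) {x : E} (hx : x ∈ convexHull ℝ s) : l x ≤ c :=
  convexHull_min (t := {x | l x ≤ c}) h (convex_halfSpace_le l.isLinear c) hx

theorem col_mem_convA (j : Fin n) : col A j ∈ convA A := subset_convexHull ℝ _ ⟨j, rfl⟩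

theorem convA_subset_deltaA : convA A ⊆ deltaA A := convexHull_mono (Set.subset_insert _ _)

theorem zero_mem_deltaA : (0 : Fin d → ℝ) ∈ deltaA A :=
  subset_convexHull ℝ _ (Set.mem_insert _ _)

/-- A simplex lies in a facet of `conv(A)` which is not a facet of `Δ_A` if and only if the
hyperplane through its columns has no column strictly on the side of the origin, provided that some
column is not on it. -/
theorem liesInInnerFacet_iff (S : SimplexInverse A σ) (hn : ∃ j, S.height j ≠ S.D) :
    LiesInInnerFacet A σ ↔ ∀ j, (S.D : ℤ) ≤ S.height j := by
  obtain ⟨j₀, hj₀⟩ := hn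
  have hD : (0 : ℝ) < S.D := by exact_mod_cast S.D_pos
  have hj₀' : S.form (col A j₀) ≠ 1 := by
    rw [S.form_col]
    intro h
    rw [div_eq_one_iff_eq hD.ne'] at h
    exact hj₀ (by exact_mod_cast h)
  have hform : ∀ j, (S.D : ℤ) ≤ S.height j ↔ 1 ≤ S.form (col A j) := by
    intro j
    rw [S.form_col, le_div_iff₀ hD, one_mul]
    exact_mod_cast Iff.rfl
  simp only [hform]
  constructor
  · rintro ⟨F, ⟨hFne, hFexp, hFdim⟩, hFdelta, hσF⟩ j
    obtain ⟨l, hl⟩ := hFexp hFne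
    -- a simplex has a vertex, since the dimension of `conv(A)` is positive
    obtain ⟨i₀, hi₀⟩ : σ.Nonempty := by
      rw [Finset.nonempty_iff_ne_empty]
      rintro rfl
      have hd : d = 0 := by
        by_contra hd
        have h1 := S.mul_T ⟨0, Nat.pos_of_ne_zero hd⟩ ⟨0, Nat.pos_of_ne_zero hd⟩
        have := S.D_pos
        simp at h1
        omega
      subst hd
      have : Module.finrank ℝ (vectorSpan ℝ (convA A)) = 0 :=
        Nat.le_zero.1 (by simpa using Submodule.finrank_le (vectorSpan ℝ (convA A)))
      omega
    have htop : vectorSpan ℝ (convA A) = ⊤ :=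
      S.vectorSpan_eq_top hi₀ (fun i _ => col_mem_convA i) (col_mem_convA j₀) hj₀'
    have hmem : ∀ x, x ∈ F ↔ x ∈ convA A ∧ ∀ y ∈ convA A, l y ≤ l x := by
      intro x
      conv_lhs => rw [hl]
      rfl
    set c := l (col A i₀) with hc
    have hlc : ∀ i ∈ σ, l (col A i) = c := fun i hi =>
      le_antisymm (((hmem _).1 (hσF i₀ hi₀)).2 _ (col_mem_convA i))
        (((hmem _).1 (hσF i hi)).2 _ (col_mem_convA i₀))
    have hlf : ∀ x, l x = c * S.form x := fun x => S.eq_mul_form (l : (Fin d → ℝ) →ₗ[ℝ] ℝ) hlc x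
    have hle : ∀ y ∈ convA A, c * S.form y ≤ c := by
      intro y hy
      rw [← hlf]
      exact ((hmem _).1 (hσF i₀ hi₀)).2 y hy
    rcases lt_trichotomy c 0 with hc0 | hc0 | hc0
    · have := hle _ (col_mem_convA j)
      nlinarith
    · -- the exposing functional vanishes and `F` is all of `conv(A)`
      exfalso
      have : F = convA A := by
        ext x
        rw [hmem]
        simp [hlf, hc0]
      rw [this] at hFdim
      omega
    · -- otherwise the hyperplane also supports `Δ_A`
      exfalso
      apply hFdelta
      have hle1 : ∀ y ∈ convA A, S.form y ≤ 1 := fun y hy => by nlinarith [hle y hy]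
      have hdtop : vectorSpan ℝ (deltaA A) = ⊤ :=
        S.vectorSpan_eq_top hi₀ (fun i _ => convA_subset_deltaA (col_mem_convA i)) zero_mem_deltaA
          (by simp)
      refine ⟨hFne, fun _ => ⟨l, ?_⟩, by rw [hdtop, ← htop]; exact hFdim⟩
      have hled : ∀ y ∈ deltaA A, l y ≤ c := by
        intro y hy
        refine linear_le_on_convexHull (l : (Fin d → ℝ) →ₗ[ℝ] ℝ) ?_ hy
        rintro x (rfl | hx)
        · simpa using hc0.le
        · exact (hlf x).trans_le (hle x (subset_convexHull ℝ _ hx))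
      ext x
      constructor
      · intro hx
        obtain ⟨hx1, hx2⟩ := (hmem x).1 hx
        exact ⟨convA_subset_deltaA hx1, fun y hy => (hled y hy).trans (hx2 _ (col_mem_convA i₀))⟩
      · rintro ⟨hx1, hx2⟩
        have hxc : c ≤ l x := hx2 _ (convA_subset_deltaA (col_mem_convA i₀))
        have hx1' := hx1
        unfold deltaA at hx1'
        rw [convexHull_insert (⟨_, j₀, rfl⟩ : (Set.range (col A)).Nonempty), mem_convexJoin] at hx1'
        obtain ⟨z, hz, y, hy, hxy⟩ := hx1'
        rw [Set.mem_singleton_iff] at hz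
        subst hz
        obtain ⟨a, b, ha, hb, hab, rfl⟩ := hxy
        have hly := hle y hy
        rw [← hlf] at hly
        rw [smul_zero, zero_add, map_smul, smul_eq_mul] at hxc
        have hb1 : b = 1 := by nlinarith
        subst hb1
        rw [smul_zero, zero_add, one_smul] at hx2 ⊢
        exact (hmem y).2 ⟨hy, fun w hw => hx2 w (convA_subset_deltaA hw)⟩
  · intro h
    have hle1 : ∀ y ∈ convA A, 1 ≤ S.form y := by
      intro y hy
      have := linear_le_on_convexHull (-S.form) (s := Set.range (col A)) (c := -1) (by
        rintro _ ⟨j, rfl⟩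
        simpa using h j) hy
      simpa using this
    obtain ⟨i₀, hi₀⟩ : σ.Nonempty := by
      rw [Finset.nonempty_iff_ne_empty]
      rintro rfl
      have h1 := h j₀
      rw [S.form_eq_sum] at h1
      simp at h1
      linarith
    have htop : vectorSpan ℝ (convA A) = ⊤ :=
      S.vectorSpan_eq_top hi₀ (fun i _ => col_mem_convA i) (col_mem_convA j₀) hj₀'
    set F : Set (Fin d → ℝ) := {x ∈ convA A | S.form x = 1} with hF
    have hσF : ∀ i ∈ σ, col A i ∈ F := fun i hi => ⟨col_mem_convA i, S.form_col_of_mem hi⟩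
    have hspan : vectorSpan ℝ F = LinearMap.ker S.form :=
      le_antisymm (S.form_vectorSpan fun x hx => hx.2) (S.ker_form_le hi₀ hσF)
    refine ⟨F, ⟨⟨_, hσF i₀ hi₀⟩, fun _ => ⟨-LinearMap.toContinuousLinearMap S.form, ?_⟩, ?_⟩, ?_,
      hσF⟩
    · ext x
      simp only [hF, Set.mem_sep_iff, neg_apply,
        LinearMap.coe_toContinuousLinearMap', neg_le_neg_iff]
      refine and_congr_right fun hx => ⟨fun h1 y hy => h1 ▸ hle1 y hy, fun h1 => ?_⟩
      exact le_antisymm ((h1 _ (col_mem_convA i₀)).trans (S.form_col_of_mem hi₀).le) (hle1 x hx)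
    · rw [hspan, htop, S.finrank_ker_form hi₀, finrank_top]
      simp
    · -- a functional exposing `F` in `Δ_A` would be a multiple of `form`
      rintro ⟨hFne, hFexp, hFdim⟩
      obtain ⟨l, hl⟩ := hFexp hFne
      have hmem : ∀ x, x ∈ F ↔ x ∈ deltaA A ∧ ∀ y ∈ deltaA A, l y ≤ l x := by
        intro x
        conv_lhs => rw [hl]
        rfl
      set c := l (col A i₀) with hc
      have hlc : ∀ i ∈ σ, l (col A i) = c := fun i hi =>
        le_antisymm (((hmem _).1 (hσF i₀ hi₀)).2 _ (convA_subset_deltaA (col_mem_convA i)))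
          (((hmem _).1 (hσF i hi)).2 _ (convA_subset_deltaA (col_mem_convA i₀)))
      have hlf : ∀ x, l x = c * S.form x :=
        fun x => S.eq_mul_form (l : (Fin d → ℝ) →ₗ[ℝ] ℝ) hlc x
      have h0 := ((hmem _).1 (hσF i₀ hi₀)).2 0 zero_mem_deltaA
      have h1 := ((hmem _).1 (hσF i₀ hi₀)).2 _ (convA_subset_deltaA (col_mem_convA j₀))
      rw [map_zero] at h0
      have h0' : 0 ≤ c := h0
      have h1' : c * S.form (col A j₀) ≤ c := by
        rw [← hlf]
        exact h1
      have h2 : 1 < S.form (col A j₀) := lt_of_le_of_ne (h j₀) hj₀'.symm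
      have hc0 : c = 0 := by nlinarith
      have : (0 : Fin d → ℝ) ∈ F := by
        rw [hmem]
        refine ⟨zero_mem_deltaA, fun y _ => ?_⟩
        rw [hlf, hlf, hc0]
        simp
      have := this.2
      simp at this

/-! ### The coefficients of `φ_v` -/

/-- A vector `v` with coordinates in `ℕ` outside the simplex `σ` and no integer coordinate in `σ`,
together with the inverse of `A_σ`. -/
structure AssocData {d n : ℕ} (A : Matrix (Fin d) (Fin n) ℤ) (σ : Finset (Fin n))
    (v : Fin n → ℂ) where
  /-- The inverse of `A_σ`. -/
  inv : SimplexInverse A σ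
  /-- The coordinates of `v` outside `σ`, as natural numbers. -/
  V : Fin n → ℕ
  v_eq : ∀ j, j ∉ σ → v j = V j
  v_ne : ∀ i ∈ σ, ∀ k : ℤ, v i ≠ k

theorem fallingFactorial_mul_inv_Gamma (z : ℂ) (k : ℕ) :
    fallingFactorial z k * (Complex.Gamma (z + 1))⁻¹ = (Complex.Gamma (z - k + 1))⁻¹ := by
  induction k with
  | zero => simp [fallingFactorial]
  | succ k ih =>
    have h : fallingFactorial z (k + 1) = fallingFactorial z k * (z - k) :=
      Finset.prod_range_succ _ _
    rw [h, mul_right_comm, ih, mul_comm, ← Complex.one_div_Gamma_eq_self_mul_one_div_Gamma_add_one]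
    push_cast
    ring_nf

theorem Gamma_add_one_ne_zero {z : ℂ} (hz : ∀ k : ℤ, k < 0 → z ≠ k) :
    Complex.Gamma (z + 1) ≠ 0 := by
  refine Complex.Gamma_ne_zero fun k hk => hz (-k - 1) (by omega) ?_
  push_cast
  linear_combination hk

theorem fallingFactorial_div_fallingFactorial {z : ℂ} (hz : ∀ k : ℤ, k < 0 → z ≠ k) (u : ℤ) :
    fallingFactorial z (-u).toNat / fallingFactorial (z + u) u.toNat =
      Complex.Gamma (z + 1) * (Complex.Gamma (z + u + 1))⁻¹ := by
  have hG := Gamma_add_one_ne_zero hz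
  rcases le_total 0 u with hu | hu
  · obtain ⟨k, rfl⟩ := Int.eq_ofNat_of_zero_le hu
    have h := fallingFactorial_mul_inv_Gamma (z + (k : ℤ)) k
    have h1 : z + ((k : ℤ) : ℂ) - k + 1 = z + 1 := by push_cast; ring
    have h2 : (-(k : ℤ)).toNat = 0 := by omega
    rw [h1] at h
    rw [h2, Int.toNat_natCast]
    have hff : fallingFactorial (z + ((k : ℤ) : ℂ)) k ≠ 0 := by
      intro h0
      rw [h0, zero_mul] at h
      exact inv_ne_zero hG h.symm
    rw [div_eq_iff hff, mul_assoc, mul_comm (Complex.Gamma (z + ((k : ℤ) : ℂ) + 1))⁻¹, h,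
      mul_inv_cancel₀ hG]
    simp [fallingFactorial]
  · obtain ⟨k, rfl⟩ : ∃ k : ℕ, u = -k := ⟨(-u).toNat, by omega⟩
    have h := fallingFactorial_mul_inv_Gamma z k
    have h1 : (-(-(k : ℤ))).toNat = k := by omega
    have h2 : (-(k : ℤ)).toNat = 0 := by omega
    have h3 : z + ((-(k : ℤ) : ℤ) : ℂ) + 1 = z - k + 1 := by push_cast; ring
    rw [h1, h2, h3, ← h]
    simp only [fallingFactorial, Finset.range_zero, Finset.prod_empty, div_one]
    field_simp

/-- The coefficients of `φ_v` in terms of the entire function `1 / Γ`. -/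
theorem phiCoeff_eq {n : ℕ} {v : Fin n → ℂ} (hv : ∀ i, ∀ k : ℤ, k < 0 → v i ≠ k)
    (u : Fin n → ℤ) :
    phiCoeff v u = (∏ i, Complex.Gamma (v i + 1)) *
      ∏ i, (Complex.Gamma (v i + u i + 1))⁻¹ := by
  unfold phiCoeff
  rw [← Finset.prod_div_distrib, ← Finset.prod_mul_distrib]
  exact Finset.prod_congr rfl fun i _ => fallingFactorial_div_fallingFactorial (hv i) (u i)

namespace AssocData

variable {d n : ℕ} {A : Matrix (Fin d) (Fin n) ℤ} {σ : Finset (Fin n)} {v : Fin n → ℂ}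
  (P : AssocData A σ v)

theorem v_ne_neg (P : AssocData A σ v) (i : Fin n) (k : ℤ) (hk : k < 0) : v i ≠ k := by
  by_cases hi : i ∈ σ
  · exact P.v_ne i hi k
  · rw [P.v_eq i hi]
    intro h
    have : (P.V i : ℤ) = k := by exact_mod_cast h
    omega

theorem mem_supportSet_iff (u : Fin n → ℤ) :
    u ∈ supportSet A v ↔ A.mulVec u = 0 ∧ ∀ j, j ∉ σ → 0 ≤ (P.V j : ℤ) + u j := by
  have h0 : nsupp v = ∅ := by
    ext i
    simp only [nsupp, Set.mem_ofPred_eq, Set.mem_empty_iff_false, iff_false]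
    rintro ⟨k, hk, h⟩
    exact P.v_ne_neg i k hk h
  unfold supportSet
  rw [Set.mem_ofPred_eq, h0, Set.eq_empty_iff_forall_notMem]
  refine and_congr_right fun _ => ⟨fun h j hj => ?_, ?_⟩
  · by_contra! hneg
    refine h j ⟨P.V j + u j, hneg, ?_⟩
    simp only
    rw [P.v_eq j hj]
    push_cast
    rfl
  · rintro h i ⟨k, hk, hik⟩
    simp only at hik
    by_cases hi : i ∈ σ
    · refine P.v_ne i hi (k - u i) ?_
      push_cast
      linear_combination hik
    · rw [P.v_eq i hi] at hik
      have : (P.V i : ℤ) + u i = k := by exact_mod_cast hik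
      have := h i hi
      omega

/-- The exponents `k_j = v_j + u_j` of the variables outside `σ`, extended by zero. -/
def expo (u : Fin n → ℤ) (j : Fin n) : ℕ := if j ∈ σ then 0 else ((P.V j : ℤ) + u j).toNat

theorem expo_of_mem {j : Fin n} (hj : j ∈ σ) (u : Fin n → ℤ) : P.expo u j = 0 := if_pos hj

theorem expo_of_notMem {j : Fin n} (hj : j ∉ σ) {u : Fin n → ℤ} (hu : u ∈ supportSet A v) :
    (P.expo u j : ℤ) = P.V j + u j := by
  rw [expo, if_neg hj]
  exact Int.toNat_of_nonneg (((P.mem_supportSet_iff u).1 hu).2 j hj)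

theorem expo_injective : Function.Injective fun u : supportSet A v => P.expo u := by
  rintro ⟨u, hu⟩ ⟨u', hu'⟩ h
  have hoff : ∀ j, j ∉ σ → u j = u' j := by
    intro j hj
    have h1 := P.expo_of_notMem hj hu
    have h2 := P.expo_of_notMem hj hu'
    have h3 : P.expo u j = P.expo u' j := congrFun h j
    omega
  refine Subtype.ext (funext fun i => ?_)
  by_cases hi : i ∈ σ
  · have h1 := P.inv.D_mul_eq_of_ker ((P.mem_supportSet_iff u).1 hu).1 hi
    have h2 := P.inv.D_mul_eq_of_ker ((P.mem_supportSet_iff u').1 hu').1 hi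
    rw [Finset.sum_congr rfl fun j hj => by rw [hoff j (Finset.mem_compl.1 hj)], ← h2] at h1
    exact mul_left_cancel₀ (by exact_mod_cast P.inv.D_pos.ne') h1
  · exact hoff i hi

/-- The sum of the coordinates of `v` outside `σ`. -/
def total : ℕ := ∑ j ∈ σᶜ, P.V j

/-- The integral part of the exponents `v + u`: it is `u_i` for `i ∈ σ` and `v_j + u_j` for
`j ∉ σ`. -/
def intExpo (u : Fin n → ℤ) (i : Fin n) : ℤ := if i ∈ σ then u i else P.V i + u i

theorem sum_intExpo (u : Fin n → ℤ) : ∑ i, P.intExpo u i = ∑ i, u i + P.total := by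
  classical
  have h : ∀ i, P.intExpo u i = u i + if i ∈ σᶜ then (P.V i : ℤ) else 0 := by
    intro i
    unfold intExpo
    by_cases hi : i ∈ σ
    · simp [hi]
    · simp [hi, add_comm]
  simp only [h, Finset.sum_add_distrib, total]
  rw [Finset.sum_ite_mem, Finset.univ_inter]
  push_cast
  rfl

theorem exists_sum_natAbs_le : ∃ E : ℕ, ∀ u ∈ supportSet A v,
    ∑ i, (P.intExpo u i).natAbs ≤ E * (∑ j, P.expo u j + 1) := by
  classical
  set G : ℕ := ∑ i, ∑ j, (P.inv.coord j i).natAbs with hG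
  refine ⟨n * (G * (P.total + 1) + 1), fun u hu => ?_⟩
  set k : ℕ := ∑ j, P.expo u j with hk
  have hle : ∀ j, P.expo u j ≤ k := fun j =>
    Finset.single_le_sum (f := fun j => P.expo u j) (fun _ _ => Nat.zero_le _) (Finset.mem_univ j)
  have hVle : ∀ j, j ∉ σ → P.V j ≤ P.total := fun j hj =>
    Finset.single_le_sum (f := fun j => P.V j) (fun _ _ => Nat.zero_le _) (Finset.mem_compl.2 hj)
  have h1 : ∀ i, (P.intExpo u i).natAbs ≤ (G * (P.total + 1) + 1) * (k + 1) := by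
    intro i
    by_cases hi : i ∈ σ
    · have h2 := P.inv.D_mul_eq_of_ker ((P.mem_supportSet_iff u).1 hu).1 hi
      have h3 : (u i).natAbs ≤ (∑ j ∈ σᶜ, P.inv.coord j i * u j).natAbs := by
        have h4 := congrArg Int.natAbs h2
        rw [Int.natAbs_mul, Int.natAbs_neg, Int.natAbs_natCast] at h4
        rw [← h4]
        exact Nat.le_mul_of_pos_left _ P.inv.D_pos
      have h5 : (∑ j ∈ σᶜ, P.inv.coord j i * u j).natAbs ≤
          ∑ j ∈ σᶜ, (P.inv.coord j i).natAbs * (P.total + k) := by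
        refine (Int.natAbs_sum_le _ _).trans (Finset.sum_le_sum fun j hj => ?_)
        rw [Int.natAbs_mul]
        refine Nat.mul_le_mul_left _ ?_
        have hj' := Finset.mem_compl.1 hj
        have := P.expo_of_notMem hj' hu
        have := hle j
        have := hVle j hj'
        omega
      have h6 : ∑ j ∈ σᶜ, (P.inv.coord j i).natAbs ≤ G := by
        refine (Finset.sum_le_sum_of_subset (Finset.subset_univ _)).trans ?_
        exact Finset.single_le_sum (f := fun i => ∑ j, (P.inv.coord j i).natAbs)
          (fun _ _ => Nat.zero_le _) (Finset.mem_univ i)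
      rw [← Finset.sum_mul] at h5
      have h7 : (P.intExpo u i) = u i := if_pos hi
      rw [h7]
      calc (u i).natAbs ≤ (∑ j ∈ σᶜ, (P.inv.coord j i).natAbs) * (P.total + k) := h3.trans h5
        _ ≤ G * ((P.total + 1) * (k + 1)) := by
            refine Nat.mul_le_mul h6 ?_
            nlinarith [Nat.zero_le (P.total * k)]
        _ ≤ _ := by nlinarith
    · have h7 : (P.intExpo u i) = P.expo u i := by
        rw [P.expo_of_notMem hi hu]
        exact if_neg hi
      rw [h7, Int.natAbs_natCast]
      have := hle i
      nlinarith [Nat.zero_le (G * (P.total + 1) * (k + 1))]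
  calc ∑ i, (P.intExpo u i).natAbs ≤ ∑ _i : Fin n, (G * (P.total + 1) + 1) * (k + 1) :=
        Finset.sum_le_sum fun i _ => h1 i
    _ = _ := by simp; ring

theorem exists_norm_inv_Gamma_bounds (i : Fin n) : ∃ C : ℝ, 1 ≤ C ∧ ∀ u ∈ supportSet A v,
    ‖(Complex.Gamma (v i + u i + 1))⁻¹‖ ≤
      C ^ ((P.intExpo u i).natAbs + 1) * recipFactorial (P.intExpo u i) ∧
    recipFactorial (P.intExpo u i) ≤
      C ^ ((P.intExpo u i).natAbs + 1) * ‖(Complex.Gamma (v i + u i + 1))⁻¹‖ := by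
  by_cases hi : i ∈ σ
  · obtain ⟨C, hC, h⟩ := ModifiedGKZ.exists_norm_inv_Gamma_bounds (P.v_ne i hi)
    refine ⟨C, hC, fun u _ => ?_⟩
    rw [intExpo, if_pos hi]
    exact h (u i)
  · refine ⟨1, le_rfl, fun u hu => ?_⟩
    have h1 : P.intExpo u i = (P.expo u i : ℤ) := by
      rw [P.expo_of_notMem hi hu]
      exact if_neg hi
    have h2 : v i + u i + 1 = (P.expo u i : ℂ) + 1 := by
      rw [P.v_eq i hi]
      have := P.expo_of_notMem hi hu
      have h3 : (P.expo u i : ℂ) = P.V i + u i := by exact_mod_cast this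
      rw [h3]
    rw [h1, h2, Complex.Gamma_nat_eq_factorial]
    simp [recipFactorial]

/-- The coefficient of `x^{v+u}` in `φ_v` has, up to factors which are geometric in the exponents
outside `σ`, the size of the factorial of `-∑_i (intExpo u i)`. -/
theorem exists_phiCoeff_bounds : ∃ C : ℝ, 1 ≤ C ∧ ∀ u ∈ supportSet A v,
    ‖phiCoeff v u‖ ≤ C ^ (∑ j, P.expo u j + 1) *
      ((-∑ i, P.intExpo u i).toNat.factorial : ℝ) ∧
    (∑ i, P.intExpo u i ≤ 0 → ((-∑ i, P.intExpo u i).toNat.factorial : ℝ) ≤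
      C ^ (∑ j, P.expo u j + 1) * ‖phiCoeff v u‖) := by
  classical
  obtain ⟨E, hE⟩ := P.exists_sum_natAbs_le
  choose C₁ hC₁ hb using P.exists_norm_inv_Gamma_bounds
  set C₂ : ℝ := ∏ i, C₁ i with hC₂
  have hC₂1 : 1 ≤ C₂ := by
    have : ∏ _i : Fin n, (1 : ℝ) ≤ ∏ i, C₁ i :=
      Finset.prod_le_prod (fun _ _ => zero_le_one) fun i _ => hC₁ i
    simpa using this
  have hC₁₂ : ∀ i, C₁ i ≤ C₂ := by
    intro i
    rw [hC₂, ← Finset.mul_prod_erase _ _ (Finset.mem_univ i)]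
    refine le_mul_of_one_le_right (zero_le_one.trans (hC₁ i)) ?_
    have : ∏ _i ∈ Finset.univ.erase i, (1 : ℝ) ≤ ∏ i ∈ Finset.univ.erase i, C₁ i :=
      Finset.prod_le_prod (fun _ _ => zero_le_one) fun i _ => hC₁ i
    simpa using this
  set Γ₀ : ℝ := ‖∏ i, Complex.Gamma (v i + 1)‖ with hΓ₀
  have hΓ₀pos : 0 < Γ₀ := norm_pos_iff.2 <| Finset.prod_ne_zero_iff.2 fun i _ =>
    Gamma_add_one_ne_zero (P.v_ne_neg i)
  set B : ℝ := 2 ^ (Fintype.card (Fin n) + 1) with hB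
  have hB1 : 1 ≤ B := one_le_pow₀ (by norm_num)
  set C₃ : ℝ := max 1 (max Γ₀ (1 / Γ₀)) with hC₃
  have hC₃1 : 1 ≤ C₃ := le_max_left _ _
  have hC₃a : Γ₀ ≤ C₃ := (le_max_left _ _).trans (le_max_right _ _)
  have hC₃b : 1 ≤ C₃ * Γ₀ := by
    have : 1 / Γ₀ ≤ C₃ := (le_max_right _ _).trans (le_max_right _ _)
    rwa [div_le_iff₀ hΓ₀pos] at this
  have hCpos : ∀ u : Fin n → ℤ, 0 < ∏ i, C₁ i ^ ((P.intExpo u i).natAbs + 1) := fun u =>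
    Finset.prod_pos fun i _ => by have := hC₁ i; positivity
  -- the geometric factor in terms of the exponents
  have hprod : ∀ u ∈ supportSet A v, C₃ * (∏ i, C₁ i ^ ((P.intExpo u i).natAbs + 1)) *
      B ^ (∑ i, (P.intExpo u i).natAbs) ≤
      (C₃ * (C₂ * B) ^ (E + n)) ^ (∑ j, P.expo u j + 1) := by
    intro u hu
    set k := ∑ j, P.expo u j
    set s := ∑ i, (P.intExpo u i).natAbs with hs
    have h1 : ∏ i, C₁ i ^ ((P.intExpo u i).natAbs + 1) ≤ C₂ ^ (s + n) := by
      calc ∏ i, C₁ i ^ ((P.intExpo u i).natAbs + 1) ≤ ∏ i, C₂ ^ ((P.intExpo u i).natAbs + 1) :=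
            Finset.prod_le_prod (fun i _ => by have := hC₁ i; positivity) fun i _ =>
              pow_le_pow_left₀ (zero_le_one.trans (hC₁ i)) (hC₁₂ i) _
        _ = C₂ ^ (s + n) := by
            rw [Finset.prod_pow_eq_pow_sum, Finset.sum_add_distrib]
            simp [hs]
    have h2 : s + n ≤ (E + n) * (k + 1) := by
      have h3 : s ≤ E * (k + 1) := hE u hu
      nlinarith [Nat.zero_le (n * k)]
    calc C₃ * (∏ i, C₁ i ^ ((P.intExpo u i).natAbs + 1)) * B ^ s
        ≤ C₃ ^ (k + 1) * C₂ ^ (s + n) * B ^ (s + n) :=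
          mul_le_mul (mul_le_mul (le_self_pow₀ hC₃1 (by omega)) h1 (hCpos u).le (by positivity))
            (pow_le_pow_right₀ hB1 (by omega)) (by positivity) (by positivity)
      _ = C₃ ^ (k + 1) * (C₂ * B) ^ (s + n) := by rw [mul_pow, mul_assoc]
      _ ≤ C₃ ^ (k + 1) * (C₂ * B) ^ ((E + n) * (k + 1)) := by
          have : 1 ≤ C₂ * B := one_le_mul_of_one_le_of_one_le hC₂1 hB1
          gcongr
      _ = _ := by rw [mul_pow C₃, ← pow_mul]
  have hnorm : ∀ u : Fin n → ℤ, ‖phiCoeff v u‖ =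
      Γ₀ * ∏ i, ‖(Complex.Gamma (v i + u i + 1))⁻¹‖ := by
    intro u
    rw [phiCoeff_eq P.v_ne_neg, norm_mul, hΓ₀]
    congr 1
    exact norm_prod _ _
  refine ⟨C₃ * (C₂ * B) ^ (E + n), ?_, fun u hu => ⟨?_, fun hneg => ?_⟩⟩
  · exact one_le_mul_of_one_le_of_one_le hC₃1
      (one_le_pow₀ (one_le_mul_of_one_le_of_one_le hC₂1 hB1))
  · have h1 : ∏ i, ‖(Complex.Gamma (v i + u i + 1))⁻¹‖ ≤
        (∏ i, C₁ i ^ ((P.intExpo u i).natAbs + 1)) * ∏ i, recipFactorial (P.intExpo u i) := by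
      rw [← Finset.prod_mul_distrib]
      exact Finset.prod_le_prod (fun _ _ => norm_nonneg _) fun i _ => (hb i u hu).1
    have h2 := prod_recipFactorial_le (P.intExpo u)
    rw [hnorm]
    calc Γ₀ * ∏ i, ‖(Complex.Gamma (v i + u i + 1))⁻¹‖
        ≤ C₃ * ((∏ i, C₁ i ^ ((P.intExpo u i).natAbs + 1)) *
          (B ^ (∑ i, (P.intExpo u i).natAbs) * ((-∑ i, P.intExpo u i).toNat.factorial : ℝ))) := by
          refine mul_le_mul hC₃a (h1.trans ?_)
            (Finset.prod_nonneg fun _ _ => norm_nonneg _) (by positivity)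
          exact mul_le_mul_of_nonneg_left h2 (hCpos u).le
      _ = (C₃ * (∏ i, C₁ i ^ ((P.intExpo u i).natAbs + 1)) * B ^ (∑ i, (P.intExpo u i).natAbs)) *
          ((-∑ i, P.intExpo u i).toNat.factorial : ℝ) := by ring
      _ ≤ _ := mul_le_mul_of_nonneg_right (hprod u hu) (by positivity)
  · have h1 : ∏ i, recipFactorial (P.intExpo u i) ≤
        (∏ i, C₁ i ^ ((P.intExpo u i).natAbs + 1)) *
          ∏ i, ‖(Complex.Gamma (v i + u i + 1))⁻¹‖ := by
      rw [← Finset.prod_mul_distrib]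
      exact Finset.prod_le_prod (fun _ _ => (recipFactorial_pos _).le) fun i _ => (hb i u hu).2
    have h2 := le_prod_recipFactorial (P.intExpo u) hneg
    have h0 : 0 ≤ ∏ i, ‖(Complex.Gamma (v i + u i + 1))⁻¹‖ :=
      Finset.prod_nonneg fun _ _ => norm_nonneg _
    rw [hnorm]
    calc ((-∑ i, P.intExpo u i).toNat.factorial : ℝ)
        ≤ B ^ (∑ i, (P.intExpo u i).natAbs) * ((∏ i, C₁ i ^ ((P.intExpo u i).natAbs + 1)) *
          ∏ i, ‖(Complex.Gamma (v i + u i + 1))⁻¹‖) :=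
          h2.trans (mul_le_mul_of_nonneg_left h1 (by positivity))
      _ ≤ (C₃ * Γ₀) * (B ^ (∑ i, (P.intExpo u i).natAbs) *
          ((∏ i, C₁ i ^ ((P.intExpo u i).natAbs + 1)) *
          ∏ i, ‖(Complex.Gamma (v i + u i + 1))⁻¹‖)) :=
          le_mul_of_one_le_left
            (mul_nonneg (by positivity) (mul_nonneg (hCpos u).le h0)) hC₃b
      _ = (C₃ * (∏ i, C₁ i ^ ((P.intExpo u i).natAbs + 1)) * B ^ (∑ i, (P.intExpo u i).natAbs)) *
          (Γ₀ * ∏ i, ‖(Complex.Gamma (v i + u i + 1))⁻¹‖) := by ring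
      _ ≤ _ := mul_le_mul_of_nonneg_right (hprod u hu) (mul_nonneg hΓ₀pos.le h0)

end AssocData

theorem summable_prod_half_pow (n : ℕ) :
    Summable fun k : Fin n → ℕ => ∏ j, (1 / 2 : ℝ) ^ k j := by
  classical
  refine summable_of_sum_le (c := 2 ^ n) (fun k => by positivity) fun s => ?_
  set N : ℕ := ∑ k ∈ s, ∑ j, k j + 1 with hN
  have hsub : s ⊆ Fintype.piFinset fun _ : Fin n => Finset.range N := by
    intro k hk
    rw [Fintype.mem_piFinset]
    intro j
    rw [Finset.mem_range, hN, Nat.lt_succ_iff]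
    exact (Finset.single_le_sum (f := fun j => k j) (fun _ _ => Nat.zero_le _)
      (Finset.mem_univ j)).trans
      (Finset.single_le_sum (f := fun k : Fin n → ℕ => ∑ j, k j) (fun _ _ => Nat.zero_le _) hk)
  calc ∑ k ∈ s, ∏ j, (1 / 2 : ℝ) ^ k j
      ≤ ∑ k ∈ Fintype.piFinset fun _ : Fin n => Finset.range N, ∏ j, (1 / 2 : ℝ) ^ k j :=
        Finset.sum_le_sum_of_subset_of_nonneg hsub fun _ _ _ => by positivity
    _ = ∏ _j : Fin n, ∑ m ∈ Finset.range N, (1 / 2 : ℝ) ^ m :=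
        (Finset.prod_univ_sum (fun _ => Finset.range N) fun _ m => (1 / 2 : ℝ) ^ m).symm
    _ ≤ ∏ _j : Fin n, (2 : ℝ) := by
        refine Finset.prod_le_prod (fun _ _ => by positivity) fun _ _ => ?_
        have := (summable_geometric_two).sum_le_tsum (Finset.range N) fun _ _ => by positivity
        rwa [tsum_geometric_two] at this
    _ = 2 ^ n := by simp

/-! ### The exponents of `t` and absolute convergence -/

namespace AssocData

variable {d n : ℕ} {A : Matrix (Fin d) (Fin n) ℤ} {σ : Finset (Fin n)} {v : Fin n → ℂ}
  (P : AssocData A σ v) {κ : ℕ} {α γ : ℂ}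

theorem tExponent_eq (u : Fin n → ℤ) :
    tExponent (fun _ => -(κ : ℤ)) α v u =
      tExponent (fun _ => -(κ : ℤ)) α v 0 - (((κ : ℤ) * ∑ i, u i : ℤ) : ℂ) := by
  simp only [tExponent, Pi.zero_apply, Int.cast_zero, add_zero]
  push_cast
  simp only [mul_add, Finset.sum_add_distrib, neg_mul, Finset.sum_neg_distrib, ← Finset.mul_sum]
  ring

theorem zero_mem_supportSet : (0 : Fin n → ℤ) ∈ supportSet A v := by
  simp [supportSet]

theorem kerVec_mem_supportSet (j : Fin n) (q : ℕ) : P.inv.kerVec j q ∈ supportSet A v := by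
  refine (P.mem_supportSet_iff _).2 ⟨P.inv.mulVec_kerVec j q, fun i hi => ?_⟩
  rw [P.inv.kerVec_of_notMem hi]
  split_ifs <;> positivity

/-- If the exponents of `t` are bounded below in `γ + ℤ`, then no column lies strictly between the
origin and the hyperplane through the columns of `σ`. -/
theorem le_height_of_bounded (hκ : 0 < κ)
    (h : ∀ u ∈ supportSet A v, ∃ m : ℕ, tExponent (fun _ => -(κ : ℤ)) α v u = γ + m) (j : Fin n) :
    (P.inv.D : ℤ) ≤ P.inv.height j := by
  by_contra! hj
  obtain ⟨m₀, hm₀⟩ := h 0 zero_mem_supportSet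
  obtain ⟨m, hm⟩ := h _ (P.kerVec_mem_supportSet j (m₀ + 1))
  rw [tExponent_eq, hm₀, P.inv.sum_kerVec] at hm
  have h1 : (m₀ : ℂ) - (((κ : ℤ) * (((m₀ + 1 : ℕ) : ℤ) * (P.inv.D - P.inv.height j)) : ℤ) : ℂ) =
      m := by
    linear_combination hm
  have h2 : (m₀ : ℤ) - (κ : ℤ) * (((m₀ + 1 : ℕ) : ℤ) * (P.inv.D - P.inv.height j)) = m := by
    exact_mod_cast h1
  have h3 : (1 : ℤ) ≤ κ * (P.inv.D - P.inv.height j) := by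
    have h4 : (1 : ℤ) ≤ κ := by exact_mod_cast hκ
    nlinarith
  push_cast at h2
  nlinarith

/-- Conversely, if no column lies strictly between the origin and the hyperplane through `σ`, then
the exponents of `t` are bounded below. -/
theorem exists_bounded (hD : ∀ j, (P.inv.D : ℤ) ≤ P.inv.height j) :
    ∃ γ : ℂ, ∀ u ∈ supportSet A v, ∃ m : ℕ,
      tExponent (fun _ => -(κ : ℤ)) α v u = γ + m := by
  set L : ℤ := ∑ j ∈ σᶜ, (P.inv.height j - P.inv.D) * P.V j with hL
  refine ⟨tExponent (fun _ => -(κ : ℤ)) α v 0 - ((κ * L : ℤ) : ℂ), fun u hu => ?_⟩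
  have h1 := P.inv.D_mul_sum_of_ker ((P.mem_supportSet_iff u).1 hu).1
  have h2 : ∑ j ∈ σᶜ, (P.inv.D - P.inv.height j) * u j ≤ L := by
    refine Finset.sum_le_sum fun j hj => ?_
    have := ((P.mem_supportSet_iff u).1 hu).2 j (Finset.mem_compl.1 hj)
    nlinarith [hD j]
  have hDpos : (1 : ℤ) ≤ P.inv.D := by exact_mod_cast P.inv.D_pos
  have hL0 : 0 ≤ L := Finset.sum_nonneg fun j _ => mul_nonneg (by linarith [hD j]) (by positivity)
  have h3 : ∑ i, u i ≤ L := by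
    rw [← h1] at h2
    by_contra! h4
    nlinarith
  have h5 : 0 ≤ (κ : ℤ) * (L - ∑ i, u i) := mul_nonneg (by positivity) (by linarith)
  refine ⟨((κ : ℤ) * (L - ∑ i, u i)).toNat, ?_⟩
  have h6 : ((((κ : ℤ) * (L - ∑ i, u i)).toNat : ℕ) : ℂ) =
      (((κ : ℤ) * (L - ∑ i, u i) : ℤ) : ℂ) := by
    exact_mod_cast congrArg (Int.cast : ℤ → ℂ) (Int.toNat_of_nonneg h5)
  rw [tExponent_eq, h6]
  push_cast
  ring

variable {m : supportSet A v → ℕ}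

theorem grading_eq (hm : ∀ u : supportSet A v, tExponent (fun _ => -(κ : ℤ)) α v u = γ + m u)
    (u : supportSet A v) :
    (m u : ℤ) = m ⟨0, zero_mem_supportSet⟩ - κ * ∑ i, u.1 i := by
  have h1 := hm u
  rw [tExponent_eq, hm ⟨0, zero_mem_supportSet⟩] at h1
  have h2 : (m u : ℂ) =
      m ⟨0, zero_mem_supportSet⟩ - (((κ : ℤ) * ∑ i, u.1 i : ℤ) : ℂ) := by
    linear_combination -h1
  exact_mod_cast h2

theorem mul_toNat_le (hm : ∀ u : supportSet A v, tExponent (fun _ => -(κ : ℤ)) α v u = γ + m u)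
    (u : supportSet A v) : κ * (-∑ i, P.intExpo u i).toNat ≤ m u := by
  have h1 := grading_eq hm u
  rw [P.sum_intExpo]
  rcases le_total 0 (-(∑ i, u.1 i + (P.total : ℤ))) with h | h
  · zify
    rw [Int.toNat_of_nonneg h, h1]
    nlinarith [show (0 : ℤ) ≤ κ * P.total by positivity]
  · rw [Int.toNat_of_nonpos h]
    simp

theorem exists_sum_expo_le (hκ : 0 < κ)
    (hm : ∀ u : supportSet A v, tExponent (fun _ => -(κ : ℤ)) α v u = γ + m u)
    (hD : ∀ j, (P.inv.D : ℤ) ≤ P.inv.height j) :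
    ∃ E₀ : ℕ, ∀ u : supportSet A v,
      ∑ j, (if P.inv.height j = P.inv.D then 0 else P.expo u j) ≤ P.inv.D * m u + E₀ := by
  classical
  set L : ℤ := ∑ j ∈ σᶜ, (P.inv.height j - P.inv.D) * P.V j with hL
  have hL0 : 0 ≤ L := Finset.sum_nonneg fun j _ => mul_nonneg (by linarith [hD j]) (by positivity)
  refine ⟨(κ * L).toNat, fun u => ?_⟩
  have h1 := P.inv.D_mul_sum_of_ker ((P.mem_supportSet_iff u).1 u.2).1
  have h2 := grading_eq hm u
  have h3 : ∑ j ∈ σᶜ, (P.inv.height j - P.inv.D) * (P.expo u j : ℤ) =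
      L - P.inv.D * ∑ i, u.1 i := by
    rw [h1, hL, ← Finset.sum_sub_distrib]
    refine Finset.sum_congr rfl fun j hj => ?_
    rw [P.expo_of_notMem (Finset.mem_compl.1 hj) u.2]
    ring
  have h4 : ∑ j, (if P.inv.height j = P.inv.D then 0 else (P.expo u j : ℤ)) ≤
      ∑ j ∈ σᶜ, (P.inv.height j - P.inv.D) * (P.expo u j : ℤ) := by
    rw [← Finset.sum_add_sum_compl σ, Finset.sum_eq_zero (s := σ), zero_add]
    · refine Finset.sum_le_sum fun j _ => ?_
      split_ifs with h
      · rw [h, sub_self, zero_mul]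
      · have h5 : 1 ≤ P.inv.height j - P.inv.D := by
          have := lt_of_le_of_ne (hD j) (Ne.symm h)
          omega
        nlinarith [show (0 : ℤ) ≤ P.expo u j by positivity]
    · intro j hj
      rw [if_pos (P.inv.height_of_mem hj)]
  have h6 : 0 ≤ ∑ j ∈ σᶜ, (P.inv.height j - P.inv.D) * (P.expo u j : ℤ) :=
    Finset.sum_nonneg fun j _ => mul_nonneg (by linarith [hD j]) (by positivity)
  have hκ1 : (1 : ℤ) ≤ κ := by exact_mod_cast hκ
  have h7 : (κ : ℤ) * ∑ j ∈ σᶜ, (P.inv.height j - P.inv.D) * (P.expo u j : ℤ) ≤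
      P.inv.D * m u + κ * L := by
    rw [h3, h2]
    have : (0 : ℤ) ≤ P.inv.D * m ⟨0, zero_mem_supportSet⟩ := by positivity
    linarith
  zify
  rw [Int.toNat_of_nonneg (by positivity)]
  nlinarith

/-- Absolute convergence of `∑_u |phiCoeff u| / (m!)^{1/κ} r^k τ^m` for small radii `r_j` at the
columns on the hyperplane through `σ`, arbitrary radii at the other columns, and `τ` small. -/
theorem exists_summable (hκ : 0 < κ)
    (hm : ∀ u : supportSet A v, tExponent (fun _ => -(κ : ℤ)) α v u = γ + m u)
    (hD : ∀ j, (P.inv.D : ℤ) ≤ P.inv.height j) {C : ℝ} (hC : 1 ≤ C)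
    (hb : ∀ u ∈ supportSet A v, ‖phiCoeff v u‖ ≤ C ^ (∑ j, P.expo u j + 1) *
      ((-∑ i, P.intExpo u i).toNat.factorial : ℝ))
    (r : Fin n → ℝ) (hr : ∀ j, 0 < r j)
    (hrC : ∀ j, j ∉ σ → P.inv.height j = P.inv.D → C * r j ≤ 1 / 2) :
    ∃ τ : ℝ, 0 < τ ∧ Summable fun u : supportSet A v =>
      ‖phiCoeff v u‖ / ((m u).factorial : ℝ) ^ (1 / (κ : ℝ)) * (∏ j, r j ^ P.expo u j) *
        τ ^ m u := by
  classical
  obtain ⟨E₀, hE₀⟩ := P.exists_sum_expo_le hκ hm hD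
  have hC0 : 0 < C := by linarith
  set ρ : ℝ := 1 + ∑ j, C * r j with hρ
  have hCr : ∀ j, 0 < C * r j := fun j => mul_pos hC0 (hr j)
  have hρ1 : 1 ≤ ρ := by
    have : 0 ≤ ∑ j, C * r j := Finset.sum_nonneg fun j _ => (hCr j).le
    linarith
  have hρle : ∀ j, C * r j ≤ ρ := by
    intro j
    have := Finset.single_le_sum (f := fun j => C * r j) (fun j _ => (hCr j).le)
      (Finset.mem_univ j)
    linarith
  set τ : ℝ := ((2 * ρ) ^ P.inv.D)⁻¹ with hτ
  have hτ0 : 0 < τ := by positivity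
  refine ⟨τ, hτ0, ?_⟩
  have hsum : Summable fun u : supportSet A v =>
      C * (2 * ρ) ^ E₀ * ∏ j, (1 / 2 : ℝ) ^ P.expo u j :=
    ((summable_prod_half_pow n).comp_injective P.expo_injective).mul_left _
  refine Summable.of_nonneg_of_le (fun u => ?_) (fun u => ?_) hsum
  · have := Finset.prod_nonneg (s := Finset.univ) (f := fun j => r j ^ P.expo u j)
      fun j _ => pow_nonneg (hr j).le _
    positivity
  · have hf : 0 < ((m u).factorial : ℝ) ^ (1 / (κ : ℝ)) :=
      Real.rpow_pos_of_pos (by exact_mod_cast (m u).factorial_pos) _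
    have h1 : ‖phiCoeff v u‖ / ((m u).factorial : ℝ) ^ (1 / (κ : ℝ)) ≤
        C ^ (∑ j, P.expo u j + 1) := by
      rw [div_le_iff₀ hf]
      refine (hb u u.2).trans ?_
      gcongr
      exact factorial_le_rpow hκ (P.mul_toNat_le hm u)
    have h2 : C ^ (∑ j, P.expo u j + 1) * ∏ j, r j ^ P.expo u j =
        C * ∏ j, (C * r j) ^ P.expo u j := by
      rw [pow_succ, ← Finset.prod_pow_eq_pow_sum]
      simp only [mul_pow, Finset.prod_mul_distrib]
      ring
    have h3 : ∏ j, (C * r j) ^ P.expo u j ≤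
        (∏ j, (1 / 2 : ℝ) ^ P.expo u j) * (2 * ρ) ^ (P.inv.D * m u + E₀) := by
      calc ∏ j, (C * r j) ^ P.expo u j ≤ ∏ j, ((1 / 2 : ℝ) ^ P.expo u j *
            (2 * ρ) ^ (if P.inv.height j = P.inv.D then 0 else P.expo u j)) := by
            refine Finset.prod_le_prod (fun j _ => pow_nonneg (hCr j).le _) fun j _ => ?_
            by_cases hj : j ∈ σ
            · simp [P.expo_of_mem hj]
            · split_ifs with h
              · rw [pow_zero, mul_one]
                exact pow_le_pow_left₀ (hCr j).le (hrC j hj h) _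
              · rw [← mul_pow]
                refine pow_le_pow_left₀ (hCr j).le ?_ _
                linarith [hρle j]
        _ = (∏ j, (1 / 2 : ℝ) ^ P.expo u j) *
            (2 * ρ) ^ (∑ j, if P.inv.height j = P.inv.D then 0 else P.expo u j) := by
            rw [Finset.prod_mul_distrib]
            congr 1
            exact Finset.prod_pow_eq_pow_sum _ _ _
        _ ≤ _ := by
            refine mul_le_mul_of_nonneg_left ?_ (by positivity)
            exact pow_le_pow_right₀ (by linarith) (hE₀ u)
    have h4 : (2 * ρ) ^ (P.inv.D * m u + E₀) * τ ^ m u = (2 * ρ) ^ E₀ := by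
      have : (2 * ρ) ^ (P.inv.D * m u) ≠ 0 := by positivity
      rw [hτ, inv_pow, ← pow_mul, pow_add]
      field_simp
    have hprod : 0 ≤ ∏ j, r j ^ P.expo u j := Finset.prod_nonneg fun j _ => pow_nonneg (hr j).le _
    calc ‖phiCoeff v u‖ / ((m u).factorial : ℝ) ^ (1 / (κ : ℝ)) * (∏ j, r j ^ P.expo u j) * τ ^ m u
        ≤ C ^ (∑ j, P.expo u j + 1) * (∏ j, r j ^ P.expo u j) * τ ^ m u := by gcongr
      _ = C * (∏ j, (C * r j) ^ P.expo u j) * τ ^ m u := by rw [h2]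
      _ ≤ C * ((∏ j, (1 / 2 : ℝ) ^ P.expo u j) * (2 * ρ) ^ (P.inv.D * m u + E₀)) * τ ^ m u := by
          gcongr
      _ = C * (∏ j, (1 / 2 : ℝ) ^ P.expo u j) *
          ((2 * ρ) ^ (P.inv.D * m u + E₀) * τ ^ m u) := by ring
      _ = _ := by rw [h4]; ring

end AssocData

/-! ### Local monomials -/

theorem localPow_of_ne {p : ℂ} (hp : p ≠ 0) (z e : ℂ) : localPow p z e = p ^ e * (z / p) ^ e :=
  if_neg hp

theorem localPow_natCast (p z : ℂ) (k : ℕ) : localPow p z k = z ^ k := by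
  unfold localPow
  split_ifs with hp
  · exact Complex.cpow_natCast z k
  · rw [Complex.cpow_natCast, Complex.cpow_natCast, ← mul_pow, mul_div_cancel₀ _ hp]

theorem localPow_add {p z : ℂ} (hp : p ≠ 0) (hz : z ≠ 0) (e e' : ℂ) :
    localPow p z (e + e') = localPow p z e * localPow p z e' := by
  simp only [localPow_of_ne hp]
  rw [Complex.cpow_add _ _ hp, Complex.cpow_add _ _ (div_ne_zero hz hp)]
  ring

theorem localPow_nat_mul {p : ℂ} (hp : p ≠ 0) (z : ℂ) (k : ℕ) (e : ℂ) :
    localPow p z (k * e) = localPow p z e ^ k := by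
  simp only [localPow_of_ne hp]
  rw [Complex.cpow_nat_mul, Complex.cpow_nat_mul, mul_pow]

theorem localPow_zero {p : ℂ} (z : ℂ) : localPow p z 0 = 1 := by
  have := localPow_natCast p z 0
  simpa using this

theorem localPow_sum {ι : Type} {p z : ℂ} (hp : p ≠ 0) (hz : z ≠ 0) (s : Finset ι) (e : ι → ℂ) :
    localPow p z (∑ i ∈ s, e i) = ∏ i ∈ s, localPow p z (e i) := by
  classical
  induction s using Finset.induction_on with
  | empty => simp [localPow_zero]
  | insert a s ha ih => rw [Finset.sum_insert ha, Finset.prod_insert ha, localPow_add hp hz, ih]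

theorem localPow_self {p : ℂ} (hp : p ≠ 0) (e : ℂ) : localPow p p e = p ^ e := by
  rw [localPow_of_ne hp, div_self hp, Complex.one_cpow, mul_one]

theorem localPow_ne_zero {p z : ℂ} (hp : p ≠ 0) (hz : z ≠ 0) (e : ℂ) : localPow p z e ≠ 0 := by
  rw [localPow_of_ne hp]
  exact mul_ne_zero (by simp [Complex.cpow_eq_zero_iff, hp])
    (by simp [Complex.cpow_eq_zero_iff, hp, hz])

theorem analyticAt_localPow {p z : ℂ} (hp : p ≠ 0) (hz : z / p ∈ Complex.slitPlane) (e : ℂ) :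
    AnalyticAt ℂ (fun z => localPow p z e) z := by
  simp only [localPow_of_ne hp]
  have h1 : AnalyticAt ℂ (fun z : ℂ => z / p) z := analyticAt_id.div analyticAt_const hp
  exact analyticAt_const.mul (h1.cpow analyticAt_const hz)

theorem analyticAt_eval {n : ℕ} (i : Fin n) (x : Fin n → ℂ) :
    AnalyticAt ℂ (fun x : Fin n → ℂ => x i) x :=
  (ContinuousLinearMap.proj (R := ℂ) (φ := fun _ : Fin n => ℂ) i).analyticAt x

namespace AssocData

variable {d n : ℕ} {A : Matrix (Fin d) (Fin n) ℤ} {σ : Finset (Fin n)} {v : Fin n → ℂ}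
  (P : AssocData A σ v)

/-- The function `z_j = x_j x_σ^{-A_σ⁻¹ a_j}`, in the determination at `p`. -/
def ratio (p x : Fin n → ℂ) (j : Fin n) : ℂ :=
  x j * ∏ i ∈ σ, localPow (p i) (x i) (-(P.inv.coord j i : ℂ) / P.inv.D)

/-- The factor `x_σ^{A_σ⁻¹ β}` common to all the monomials of `φ_v`, in the determination
at `p`. -/
def factor (p x : Fin n → ℂ) : ℂ :=
  ∏ i ∈ σ, localPow (p i) (x i)
    (v i + (∑ j ∈ σᶜ, (P.inv.coord j i : ℂ) * P.V j) / P.inv.D)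

/-- Each monomial of `φ_v` is the common factor times a monomial in the functions `ratio`. -/
theorem localMonomial_eq {p x : Fin n → ℂ} (hp : ∀ i ∈ σ, p i ≠ 0) (hx : ∀ i ∈ σ, x i ≠ 0)
    {u : Fin n → ℤ} (hu : u ∈ supportSet A v) :
    localMonomial p x (fun i => v i + (u i : ℂ)) =
      P.factor p x * ∏ j, P.ratio p x j ^ P.expo u j := by
  classical
  have hDc : (P.inv.D : ℂ) ≠ 0 := by exact_mod_cast P.inv.D_pos.ne'
  have hexpo : ∀ j ∈ σᶜ, (P.expo u j : ℂ) = P.V j + u j := fun j hj => by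
    exact_mod_cast P.expo_of_notMem (Finset.mem_compl.1 hj) hu
  have h1 : ∀ i ∈ σ, localPow (p i) (x i) (v i + u i) =
      localPow (p i) (x i) (v i + (∑ j ∈ σᶜ, (P.inv.coord j i : ℂ) * P.V j) / P.inv.D) *
        ∏ j ∈ σᶜ, localPow (p i) (x i) (-(P.inv.coord j i : ℂ) / P.inv.D) ^ P.expo u j := by
    intro i hi
    have h2 : v i + u i = (v i + (∑ j ∈ σᶜ, (P.inv.coord j i : ℂ) * P.V j) / P.inv.D) +
        ∑ j ∈ σᶜ, (P.expo u j : ℂ) * (-(P.inv.coord j i : ℂ) / P.inv.D) := by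
      have h3 : (P.inv.D : ℂ) * u i = -∑ j ∈ σᶜ, (P.inv.coord j i : ℂ) * u j := by
        exact_mod_cast congrArg (Int.cast : ℤ → ℂ)
          (P.inv.D_mul_eq_of_ker ((P.mem_supportSet_iff u).1 hu).1 hi)
      have h4 : ∑ j ∈ σᶜ, (P.expo u j : ℂ) * (-(P.inv.coord j i : ℂ) / P.inv.D) =
          (-∑ j ∈ σᶜ, (P.inv.coord j i : ℂ) * P.V j - ∑ j ∈ σᶜ, (P.inv.coord j i : ℂ) * u j) /
            P.inv.D := by
        rw [← Finset.sum_neg_distrib, ← Finset.sum_sub_distrib, Finset.sum_div]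
        refine Finset.sum_congr rfl fun j hj => ?_
        rw [hexpo j hj]
        ring
      rw [h4, sub_eq_add_neg (-_), ← h3]
      field_simp
      ring
    rw [h2, localPow_add (hp i hi) (hx i hi), localPow_sum (hp i hi) (hx i hi)]
    congr 1
    exact Finset.prod_congr rfl fun j _ => localPow_nat_mul (hp i hi) _ _ _
  have h5 : ∀ j ∈ σᶜ, localPow (p j) (x j) (v j + u j) = x j ^ P.expo u j := by
    intro j hj
    rw [P.v_eq j (Finset.mem_compl.1 hj), ← hexpo j hj, localPow_natCast]
  unfold localMonomial factor ratio
  rw [← Finset.prod_mul_prod_compl σ, ← Finset.prod_mul_prod_compl σ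
    (fun j => (x j * ∏ i ∈ σ, localPow (p i) (x i) (-(P.inv.coord j i : ℂ) / P.inv.D)) ^
      P.expo u j), Finset.prod_congr rfl h1, Finset.prod_congr rfl h5, Finset.prod_mul_distrib,
    Finset.prod_comm, Finset.prod_eq_one (s := σ) (f := fun j => (_ : ℂ) ^ P.expo u j), one_mul]
  · simp only [mul_pow, Finset.prod_mul_distrib, Finset.prod_pow]
    ring
  · intro j hj
    rw [P.expo_of_mem hj, pow_zero]

theorem analyticAt_ratio {p x : Fin n → ℂ} (hp : ∀ i ∈ σ, p i ≠ 0)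
    (hx : ∀ i ∈ σ, x i / p i ∈ Complex.slitPlane) (j : Fin n) :
    AnalyticAt ℂ (fun x => P.ratio p x j) x := by
  refine (analyticAt_eval j x).mul (Finset.analyticAt_fun_prod _ fun i hi => ?_)
  exact AnalyticAt.fun_comp (f := fun x : Fin n → ℂ => x i)
    (analyticAt_localPow (hp i hi) (hx i hi) _) (analyticAt_eval i x)

theorem analyticAt_factor {p x : Fin n → ℂ} (hp : ∀ i ∈ σ, p i ≠ 0)
    (hx : ∀ i ∈ σ, x i / p i ∈ Complex.slitPlane) :
    AnalyticAt ℂ (fun x => P.factor p x) x := by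
  refine Finset.analyticAt_fun_prod _ fun i hi => ?_
  exact AnalyticAt.fun_comp (f := fun x : Fin n → ℂ => x i)
    (analyticAt_localPow (hp i hi) (hx i hi) _) (analyticAt_eval i x)

theorem factor_ne_zero {p x : Fin n → ℂ} (hp : ∀ i ∈ σ, p i ≠ 0) (hx : ∀ i ∈ σ, x i ≠ 0) :
    P.factor p x ≠ 0 :=
  Finset.prod_ne_zero_iff.2 fun i hi => localPow_ne_zero (hp i hi) (hx i hi) _

theorem norm_ratio_self {p : Fin n → ℂ} (hp : ∀ i ∈ σ, p i ≠ 0) (j : Fin n) :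
    ‖P.ratio p p j‖ * ∏ i ∈ σ, ‖p i‖ ^ ((P.inv.coord j i : ℝ) / P.inv.D) = ‖p j‖ := by
  unfold ratio
  rw [norm_mul, norm_prod, mul_assoc, ← Finset.prod_mul_distrib, Finset.prod_eq_one, mul_one]
  intro i hi
  have h : -(P.inv.coord j i : ℂ) / P.inv.D = ((-((P.inv.coord j i : ℝ) / P.inv.D) : ℝ) : ℂ) := by
    push_cast
    ring
  rw [localPow_self (hp i hi), h, Complex.norm_cpow_real, Real.rpow_neg (norm_nonneg _)]
  exact inv_mul_cancel₀ (Real.rpow_pos_of_pos (norm_pos_iff.2 (hp i hi)) _).ne'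

/-- The conditions on `x` under which the series is written in terms of `factor` and `ratio`. -/
def Near (p : Fin n → ℂ) (r : Fin n → ℝ) (x : Fin n → ℂ) : Prop :=
  (∀ i ∈ σ, x i ≠ 0 ∧ x i / p i ∈ Complex.slitPlane) ∧ ∀ j, ‖P.ratio p x j‖ < r j

theorem eventually_near {p : Fin n → ℂ} (hp : ∀ i ∈ σ, p i ≠ 0) {r : Fin n → ℝ}
    (hz : ∀ j, ‖P.ratio p p j‖ < r j) : ∀ᶠ x in 𝓝 p, P.Near p r x := by
  have hslit : ∀ i ∈ σ, p i / p i ∈ Complex.slitPlane := fun i hi => by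
    rw [div_self (hp i hi)]
    exact Complex.one_mem_slitPlane
  refine Filter.Eventually.and ?_ ?_
  · refine (Filter.eventually_all_finset σ).2 fun i hi => Filter.Eventually.and ?_ ?_
    · exact (continuous_apply i).continuousAt.eventually_ne (hp i hi)
    · have hc : Continuous fun x : Fin n → ℂ => x i / p i := by
        simp only [div_eq_mul_inv]
        fun_prop
      exact (hc.tendsto p).eventually (Complex.isOpen_slitPlane.mem_nhds (hslit i hi))
  · refine Filter.eventually_all.2 fun j => ?_
    exact (P.analyticAt_ratio hp hslit j).continuousAt.norm.eventually (gt_mem_nhds (hz j))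

/-- The power series in the functions `ratio` which gives, up to the common factor, the
coefficient of `t^(γ + k)`. -/
def coeffSeries (m : supportSet A v → ℕ) (k : ℕ) (z : Fin n → ℂ) : ℂ :=
  ∑' u : {u : supportSet A v // m u = k}, phiCoeff v u * ∏ j, z j ^ P.expo u j

variable {κ : ℕ} {α γ : ℂ} {m : supportSet A v → ℕ}

/-- The two descriptions of the set of monomials with the exponent `γ + k` of `t`. -/
def fiberEquiv (hm : ∀ u : supportSet A v, tExponent (fun _ => -(κ : ℤ)) α v u = γ + m u) (k : ℕ) :
    {u : supportSet A v // m u = k} ≃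
      {u : Fin n → ℤ // u ∈ supportSet A v ∧ tExponent (fun _ => -(κ : ℤ)) α v u = γ + k} where
  toFun u := ⟨u.1.1, u.1.2, by rw [hm, u.2]⟩
  invFun u := ⟨⟨u.1, u.2.1⟩, by
    have h := u.2.2.symm.trans (hm ⟨u.1, u.2.1⟩)
    exact_mod_cast (add_left_cancel h).symm⟩
  left_inv _ := rfl
  right_inv _ := rfl

theorem hasSum_fiber (hm : ∀ u : supportSet A v, tExponent (fun _ => -(κ : ℤ)) α v u = γ + m u)
    {p : Fin n → ℂ} (hp : ∀ i ∈ σ, p i ≠ 0) {r : Fin n → ℝ} {e τ : ℝ} (hτ : 0 < τ)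
    (hs : Summable fun u : supportSet A v =>
      ‖phiCoeff v u‖ / ((m u).factorial : ℝ) ^ e * (∏ j, r j ^ P.expo u j) * τ ^ m u)
    {x : Fin n → ℂ} (hx : P.Near p r x) (k : ℕ) :
    HasSum (fun u : {u : Fin n → ℤ // u ∈ supportSet A v ∧
        tExponent (fun _ => -(κ : ℤ)) α v u = γ + k} =>
      phiCoeff v u.1 * localMonomial p x (fun i => v i + (u.1 i : ℂ)))
      (P.factor p x * P.coeffSeries m k (P.ratio p x)) := by
  rw [← (fiberEquiv hm k).hasSum_iff]
  have h1 : Summable fun u : {u : supportSet A v // m u = k} =>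
      phiCoeff v u * ∏ j, P.ratio p x j ^ P.expo u j := by
    refine Summable.of_norm_bounded (summable_fiber hτ hs k) fun u => ?_
    rw [norm_mul, norm_prod]
    refine mul_le_mul_of_nonneg_left ?_ (norm_nonneg _)
    refine Finset.prod_le_prod (fun _ _ => norm_nonneg _) fun i _ => ?_
    rw [norm_pow]
    exact pow_le_pow_left₀ (norm_nonneg _) (hx.2 i).le _
  refine (h1.hasSum.mul_left (P.factor p x)).congr_fun fun u => ?_
  show phiCoeff v u.1.1 * localMonomial p x (fun i => v i + (u.1.1 i : ℂ)) = _
  rw [P.localMonomial_eq hp (fun i hi => (hx.1 i hi).1) u.1.2]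
  ring

theorem analyticAt_coeffSeries {r : Fin n → ℝ} (hr : ∀ j, 0 < r j) {e τ : ℝ} (hτ : 0 < τ)
    (hs : Summable fun u : supportSet A v =>
      ‖phiCoeff v u‖ / ((m u).factorial : ℝ) ^ e * (∏ j, r j ^ P.expo u j) * τ ^ m u)
    {p x : Fin n → ℂ} (hp : ∀ i ∈ σ, p i ≠ 0) (hx : P.Near p r x) (k : ℕ) :
    AnalyticAt ℂ (fun x => P.factor p x * P.coeffSeries m k (P.ratio p x)) x := by
  have hslit := fun i hi => (hx.1 i hi).2
  refine (P.analyticAt_factor hp hslit).mul ?_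
  have h1 := analyticOnNhd_tsum_monomial (fun u : {u : supportSet A v // m u = k} => phiCoeff v u)
    (fun u => P.expo u) r hr (summable_fiber hτ hs k) (P.ratio p x) hx.2
  have h2 : AnalyticAt ℂ (P.ratio p) x :=
    analyticAt_pi_iff.2 fun j => P.analyticAt_ratio hp hslit j
  exact AnalyticAt.fun_comp h1 h2

theorem isExpansion (hm : ∀ u : supportSet A v, tExponent (fun _ => -(κ : ℤ)) α v u = γ + m u)
    {p : Fin n → ℂ} (hp : ∀ i ∈ σ, p i ≠ 0) {r : Fin n → ℝ} (hr : ∀ j, 0 < r j)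
    (hz : ∀ j, ‖P.ratio p p j‖ < r j) {e τ : ℝ} (hτ : 0 < τ)
    (hs : Summable fun u : supportSet A v =>
      ‖phiCoeff v u‖ / ((m u).factorial : ℝ) ^ e * (∏ j, r j ^ P.expo u j) * τ ^ m u) :
    IsExpansion A (fun _ => -(κ : ℤ)) α v γ p
      fun k x => P.factor p x * P.coeffSeries m k (P.ratio p x) := by
  obtain ⟨W, hW, hWo, hpW⟩ := eventually_nhds_iff.1 (P.eventually_near hp hz)
  refine ⟨fun i hi => ?_, fun u hu => ⟨m ⟨u, hu⟩, hm ⟨u, hu⟩⟩, W, hWo, hpW, fun k =>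
    ⟨fun x hx => P.analyticAt_coeffSeries hr hτ hs hp (hW x hx) k,
      fun x hx => P.hasSum_fiber hm hp hτ hs (hW x hx) k⟩⟩
  by_cases h : i ∈ σ
  · exact absurd hi (hp i h)
  · exact ⟨P.V i, P.v_eq i h⟩

theorem eventually_eq_of_isExpansion
    (hm : ∀ u : supportSet A v, tExponent (fun _ => -(κ : ℤ)) α v u = γ + m u)
    {p : Fin n → ℂ} (hp : ∀ i ∈ σ, p i ≠ 0) {r : Fin n → ℝ}
    (hz : ∀ j, ‖P.ratio p p j‖ < r j) {e τ : ℝ} (hτ : 0 < τ)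
    (hs : Summable fun u : supportSet A v =>
      ‖phiCoeff v u‖ / ((m u).factorial : ℝ) ^ e * (∏ j, r j ^ P.expo u j) * τ ^ m u)
    {f : ℕ → (Fin n → ℂ) → ℂ} (hf : IsExpansion A (fun _ => -(κ : ℤ)) α v γ p f) :
    ∀ᶠ x in 𝓝 p, P.Near p r x ∧
      ∀ k, f k x = P.factor p x * P.coeffSeries m k (P.ratio p x) := by
  obtain ⟨-, -, V, hVo, hpV, hV⟩ := hf
  filter_upwards [P.eventually_near hp hz, hVo.mem_nhds hpV] with x hx hxV
  exact ⟨hx, fun k => ((hV k).2 x hxV).unique (P.hasSum_fiber hm hp hτ hs hx k)⟩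

/-- The expansion is a Gevrey series of order `1 + 1/κ`: after division of the coefficients by
`(m!)^{1/κ}` it becomes an absolutely convergent power series in `ratio` and `t`. -/
theorem isGevrey_of_isExpansion
    (hm : ∀ u : supportSet A v, tExponent (fun _ => -(κ : ℤ)) α v u = γ + m u)
    {p : Fin n → ℂ} (hp : ∀ i ∈ σ, p i ≠ 0) {r : Fin n → ℝ} (hr : ∀ j, 0 < r j)
    (hz : ∀ j, ‖P.ratio p p j‖ < r j) {e τ : ℝ} (hτ : 0 < τ)
    (hs : Summable fun u : supportSet A v =>
      ‖phiCoeff v u‖ / ((m u).factorial : ℝ) ^ e * (∏ j, r j ^ P.expo u j) * τ ^ m u)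
    {f : ℕ → (Fin n → ℂ) → ℂ} (hf : IsExpansion A (fun _ => -(κ : ℤ)) α v γ p f) :
    IsGevrey (1 + e) p f := by
  have hev := P.eventually_eq_of_isExpansion hm hp hz hτ hs hf
  obtain ⟨-, -, V, hVo, hpV, hV⟩ := hf
  refine ⟨⟨V, hVo, hpV, fun k => (hV k).1⟩, ?_⟩
  rw [add_sub_cancel_left]
  set b : supportSet A v → ℂ := fun u =>
    phiCoeff v u / ((((m u).factorial : ℝ) ^ e : ℝ) : ℂ) with hb
  have hfac : ∀ k : ℕ, 0 < (k.factorial : ℝ) ^ e := fun k =>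
    Real.rpow_pos_of_pos (by exact_mod_cast k.factorial_pos) _
  have hbn : ∀ u, ‖b u‖ = ‖phiCoeff v u‖ / ((m u).factorial : ℝ) ^ e := by
    intro u
    rw [hb]
    simp only
    rw [norm_div, Complex.norm_real, Real.norm_of_nonneg (hfac _).le]
  -- the power series in `t` and the functions `ratio`
  set K : supportSet A v → Option (Fin n) → ℕ := fun u o => o.elim (m u) fun j => P.expo u j
  set r' : Option (Fin n) → ℝ := fun o => o.elim τ r
  have hr' : ∀ o, 0 < r' o := by
    rintro (_ | j)
    · exact hτ
    · exact hr j
  have hs' : Summable fun u => ‖b u‖ * ∏ o, r' o ^ K u o := by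
    refine hs.congr fun u => ?_
    rw [hbn, Fintype.prod_option]
    simp only [r', K, Option.elim]
    ring
  have han := analyticOnNhd_tsum_monomial b K r' hr' hs'
  set y : (Fin n → ℂ) × ℂ → Option (Fin n) → ℂ := fun q o => o.elim q.2 fun j => P.ratio p q.1 j
  set Q : (Option (Fin n) → ℂ) → ℂ := fun z => ∑' u, b u * ∏ o, z o ^ K u o with hQ
  have hslit : ∀ i ∈ σ, p i / p i ∈ Complex.slitPlane := fun i hi => by
    rw [div_self (hp i hi)]
    exact Complex.one_mem_slitPlane
  refine ⟨fun q => P.factor p q.1 * Q (y q), ?_, ?_⟩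
  · have hfst : AnalyticAt ℂ (fun q : (Fin n → ℂ) × ℂ => q.1) (p, 0) := analyticAt_fst
    have h1 : AnalyticAt ℂ (fun q : (Fin n → ℂ) × ℂ => P.factor p q.1) (p, 0) :=
      AnalyticAt.fun_comp (f := fun q : (Fin n → ℂ) × ℂ => q.1)
        (P.analyticAt_factor hp hslit) hfst
    refine h1.mul ?_
    have h2 : AnalyticAt ℂ y (p, 0) := by
      refine analyticAt_pi_iff.2 ?_
      rintro (_ | j)
      · exact analyticAt_snd
      · exact AnalyticAt.fun_comp (f := fun q : (Fin n → ℂ) × ℂ => q.1)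
          (P.analyticAt_ratio hp hslit j) hfst
    refine AnalyticAt.fun_comp (han (y (p, 0)) ?_) h2
    rintro (_ | j)
    · simpa [y, r'] using hτ
    · exact hz j
  · have h1 : ∀ᶠ q in 𝓝 ((p, 0) : (Fin n → ℂ) × ℂ), P.Near p r q.1 ∧
        ∀ k, f k q.1 = P.factor p q.1 * P.coeffSeries m k (P.ratio p q.1) :=
      (continuous_fst.tendsto (p, (0 : ℂ))).eventually hev
    have h2 : ∀ᶠ q in 𝓝 ((p, 0) : (Fin n → ℂ) × ℂ), ‖q.2‖ < τ := by
      have : ContinuousAt (fun q : (Fin n → ℂ) × ℂ => ‖q.2‖) (p, 0) := by fun_prop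
      exact this.eventually (gt_mem_nhds (by simpa using hτ))
    filter_upwards [h1, h2] with q hq hqt
    have hyr : ∀ o, ‖y q o‖ < r' o := by
      rintro (_ | j)
      · exact hqt
      · exact hq.1.2 j
    have h3 : Summable fun u => b u * ∏ o, y q o ^ K u o := by
      refine Summable.of_norm_bounded hs' fun u => ?_
      rw [norm_mul, norm_prod]
      refine mul_le_mul_of_nonneg_left ?_ (norm_nonneg _)
      refine Finset.prod_le_prod (fun _ _ => norm_nonneg _) fun o _ => ?_
      rw [norm_pow]
      exact pow_le_pow_left₀ (norm_nonneg _) (hyr o).le _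
    have h4 := h3.hasSum
    rw [← (Equiv.sigmaFiberEquiv m).hasSum_iff] at h4
    refine (h4.mul_left (P.factor p q.1)).sigma fun k => ?_
    have h5 : HasSum (fun u : {u : supportSet A v // m u = k} =>
        phiCoeff v u * ∏ j, P.ratio p q.1 j ^ P.expo u j)
        (P.coeffSeries m k (P.ratio p q.1)) := by
      refine Summable.hasSum (Summable.of_norm_bounded (summable_fiber hτ hs k) fun u => ?_)
      rw [norm_mul, norm_prod]
      refine mul_le_mul_of_nonneg_left ?_ (norm_nonneg _)
      refine Finset.prod_le_prod (fun _ _ => norm_nonneg _) fun i _ => ?_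
      rw [norm_pow]
      exact pow_le_pow_left₀ (norm_nonneg _) (hq.1.2 i).le _
    have h6 := (h5.mul_left (P.factor p q.1)).mul_right
      (((((k.factorial : ℝ) ^ e : ℝ) : ℂ))⁻¹ * q.2 ^ k)
    rw [← hq.2 k] at h6
    rw [div_eq_mul_inv, mul_assoc]
    refine h6.congr_fun ?_
    rintro ⟨u, rfl⟩
    simp only [Function.comp, Equiv.sigmaFiberEquiv, Equiv.coe_fn_mk, hb]
    rw [Fintype.prod_option]
    simp only [K, y, Option.elim]
    ring

end AssocData

/-! ### The lower bound for the Gevrey index -/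

namespace AssocData

variable {d n : ℕ} {A : Matrix (Fin d) (Fin n) ℤ} {σ : Finset (Fin n)} {v : Fin n → ℂ}
  (P : AssocData A σ v) {κ : ℕ} {α γ : ℂ} {m : supportSet A v → ℕ}

/-- A column beyond the hyperplane through `σ` gives a sequence of monomials whose coefficients
have, up to geometric factors, the size of `(m!)^{1/κ}`. -/
theorem exists_coeff_growth (hκ : 0 < κ)
    (hm : ∀ u : supportSet A v, tExponent (fun _ => -(κ : ℤ)) α v u = γ + m u)
    {j₀ : Fin n} (hj₀ : (P.inv.D : ℤ) < P.inv.height j₀) {C : ℝ} (hC : 1 ≤ C)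
    (hb : ∀ u ∈ supportSet A v, ∑ i, P.intExpo u i ≤ 0 →
      ((-∑ i, P.intExpo u i).toNat.factorial : ℝ) ≤
        C ^ (∑ j, P.expo u j + 1) * ‖phiCoeff v u‖) :
    ∃ (u : ℕ → supportSet A v) (c : ℝ) (E : ℕ), 0 < c ∧
      Filter.Tendsto (fun q => m (u q)) Filter.atTop Filter.atTop ∧
      (∀ q, c ^ (m (u q) + 1) * ((m (u q)).factorial : ℝ) ^ (1 / (κ : ℝ)) ≤
        ‖phiCoeff v (u q)‖) ∧
      ∀ q, ∑ j, P.expo (u q) j ≤ E * (m (u q) + 1) := by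
  classical
  obtain ⟨h, hh⟩ : ∃ h : ℕ, P.inv.height j₀ = P.inv.D + h :=
    ⟨(P.inv.height j₀ - P.inv.D).toNat, by omega⟩
  have hh1 : 1 ≤ h := by omega
  have hj₀σ : j₀ ∉ σ := fun hσ => by
    rw [P.inv.height_of_mem hσ] at hj₀
    exact lt_irrefl _ hj₀
  set u : ℕ → supportSet A v := fun q =>
    ⟨P.inv.kerVec j₀ ((q + P.total : ℕ) : ℤ), P.kerVec_mem_supportSet j₀ (q + P.total)⟩ with hu
  set m₀ : ℕ := m ⟨0, zero_mem_supportSet⟩ with hm₀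
  have hsum : ∀ q, ∑ i, (u q).1 i = -(((q + P.total) * h : ℕ) : ℤ) := by
    intro q
    show ∑ i, P.inv.kerVec j₀ ((q + P.total : ℕ) : ℤ) i = _
    rw [P.inv.sum_kerVec, hh]
    push_cast
    ring
  have hle : ∀ q, P.total ≤ (q + P.total) * h := fun q => by nlinarith
  have hM : ∀ q, (-∑ i, P.intExpo (u q) i).toNat = (q + P.total) * h - P.total := by
    intro q
    rw [P.sum_intExpo, hsum]
    omega
  have hneg : ∀ q, ∑ i, P.intExpo (u q) i ≤ 0 := by
    intro q
    rw [P.sum_intExpo, hsum]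
    have := hle q
    omega
  have hmq : ∀ q, m (u q) = κ * ((q + P.total) * h) + m₀ := by
    intro q
    have := grading_eq hm (u q)
    rw [hsum] at this
    zify
    rw [this]
    push_cast
    ring
  have hmq' : ∀ q, m (u q) = κ * ((q + P.total) * h - P.total) + (κ * P.total + m₀) := by
    intro q
    rw [hmq, ← add_assoc, ← mul_add, Nat.sub_add_cancel (hle q)]
  have hmge : ∀ q, q + P.total ≤ m (u q) := by
    intro q
    rw [hmq]
    have h1 : q + P.total ≤ (q + P.total) * h := Nat.le_mul_of_pos_right _ hh1
    have h2 : (q + P.total) * h ≤ κ * ((q + P.total) * h) := Nat.le_mul_of_pos_left _ hκ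
    omega
  have hexpo : ∀ q, ∑ j, P.expo (u q) j = P.total + (q + P.total) * P.inv.D := by
    intro q
    rw [← Finset.sum_add_sum_compl σ, Finset.sum_eq_zero fun j hj => P.expo_of_mem hj _, zero_add]
    zify
    rw [Finset.sum_congr rfl fun j hj => P.expo_of_notMem (Finset.mem_compl.1 hj) (u q).2,
      Finset.sum_add_distrib, total]
    push_cast
    congr 1
    show ∑ j ∈ σᶜ, P.inv.kerVec j₀ ((q + P.total : ℕ) : ℤ) j = _
    rw [Finset.sum_congr rfl fun j hj => P.inv.kerVec_of_notMem (Finset.mem_compl.1 hj) _]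
    rw [Finset.sum_ite_eq', if_pos (Finset.mem_compl.2 hj₀σ)]
    push_cast [total]
    rfl
  have hE : ∀ q, ∑ j, P.expo (u q) j ≤ (P.inv.D + P.total) * (m (u q) + 1) := by
    intro q
    rw [hexpo]
    have := hmge q
    nlinarith [Nat.zero_le (P.total * m (u q)), Nat.mul_le_mul_right P.inv.D this]
  set F : ℝ := 4 * ((κ * P.total + m₀).factorial : ℝ) with hF
  have hF1 : 1 ≤ F := by
    have : (1 : ℝ) ≤ ((κ * P.total + m₀).factorial : ℝ) := by
      exact_mod_cast Nat.factorial_pos _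
    linarith
  set E := P.inv.D + P.total with hEdef
  refine ⟨u, 1 / (F * C ^ (E + 1)), E, by positivity, ?_, fun q => ?_, hE⟩
  · exact Filter.tendsto_atTop_mono (fun q => (Nat.le_add_right q P.total).trans (hmge q))
      Filter.tendsto_id
  · have h1 := hb _ (u q).2 (hneg q)
    have h2 := rpow_le_factorial (M := (q + P.total) * h - P.total) (m₀ := κ * P.total + m₀) hκ
    rw [← hmq' q] at h2
    rw [hM] at h1
    set k := m (u q)
    have h3 : C ^ (∑ j, P.expo (u q) j + 1) ≤ (C ^ (E + 1)) ^ (k + 1) := by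
      rw [← pow_mul]
      refine pow_le_pow_right₀ hC ?_
      have := hE q
      nlinarith
    rw [one_div, inv_pow, inv_mul_le_iff₀ (by positivity), mul_pow]
    calc ((k.factorial : ℝ)) ^ (1 / (κ : ℝ))
        ≤ F ^ (k + 1) * (((q + P.total) * h - P.total).factorial : ℝ) := h2
      _ ≤ F ^ (k + 1) * ((C ^ (E + 1)) ^ (k + 1) * ‖phiCoeff v (u q)‖) := by
          refine mul_le_mul_of_nonneg_left (h1.trans ?_) (by positivity)
          exact mul_le_mul_of_nonneg_right h3 (norm_nonneg _)
      _ = _ := by ring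

/-- The expansion is of no Gevrey order less than `1 + 1/κ`. The coordinates in `σ` are kept equal to
those of `p`; then the common factor is constant and the functions `ratio` become coordinates, so that
the comparison of coefficients for power series applies. -/
theorem not_isGevrey_of_isExpansion (hκ : 0 < κ)
    (hm : ∀ u : supportSet A v, tExponent (fun _ => -(κ : ℤ)) α v u = γ + m u)
    {j₀ : Fin n} (hj₀ : (P.inv.D : ℤ) < P.inv.height j₀) {C : ℝ} (hC : 1 ≤ C)
    (hb : ∀ u ∈ supportSet A v, ∑ i, P.intExpo u i ≤ 0 →
      ((-∑ i, P.intExpo u i).toNat.factorial : ℝ) ≤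
        C ^ (∑ j, P.expo u j + 1) * ‖phiCoeff v u‖)
    {p : Fin n → ℂ} (hp : ∀ i ∈ σ, p i ≠ 0) {r : Fin n → ℝ}
    (hz : ∀ j, ‖P.ratio p p j‖ < r j) {τ : ℝ} (hτ : 0 < τ)
    (hs : Summable fun u : supportSet A v =>
      ‖phiCoeff v u‖ / ((m u).factorial : ℝ) ^ (1 / (κ : ℝ)) * (∏ j, r j ^ P.expo u j) * τ ^ m u)
    {f : ℕ → (Fin n → ℂ) → ℂ} (hf : IsExpansion A (fun _ => -(κ : ℤ)) α v γ p f)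
    {s : ℝ} (hs' : s < 1 + 1 / (κ : ℝ)) : ¬ IsGevrey s p f := by
  classical
  intro hG
  have hev := P.eventually_eq_of_isExpansion hm hp hz hτ hs hf
  obtain ⟨C₁, hC₁, hbound⟩ := hG.2.exists_bound
  obtain ⟨u, c, E, hc, hu, hlow, hE⟩ := P.exists_coeff_growth hκ hm hj₀ hC hb
  -- the section of `ratio` over which the coordinates in `σ` are those of `p`
  set μ : Fin n → ℂ := fun j =>
    ∏ i ∈ σ, localPow (p i) (p i) (-(P.inv.coord j i : ℂ) / P.inv.D) with hμ
  have hμ0 : ∀ j, μ j ≠ 0 := fun j =>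
    Finset.prod_ne_zero_iff.2 fun i hi => localPow_ne_zero (hp i hi) (hp i hi) _
  set ξ : (Fin n → ℂ) → Fin n → ℂ := fun z i => if i ∈ σ then p i else z i / μ i with hξ
  have hξp : ξ (P.ratio p p) = p := by
    funext i
    simp only [hξ]
    split_ifs with hi
    · rfl
    · exact mul_div_cancel_right₀ _ (hμ0 i)
  have hξσ : ∀ z, ∀ i ∈ σ, ξ z i = p i := fun z i hi => if_pos hi
  have hξc : Continuous ξ := by
    refine continuous_pi fun i => ?_
    simp only [hξ, div_eq_mul_inv]
    split_ifs
    · exact continuous_const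
    · fun_prop
  have hratio : ∀ z, ∀ j, j ∉ σ → P.ratio p (ξ z) j = z j := by
    intro z j hj
    unfold ratio
    rw [Finset.prod_congr rfl fun i hi => by rw [hξσ z i hi]]
    simp only [hξ, if_neg hj]
    exact div_mul_cancel₀ _ (hμ0 j)
  have hfactor : ∀ z, P.factor p (ξ z) = P.factor p p := by
    intro z
    unfold factor
    exact Finset.prod_congr rfl fun i hi => by rw [hξσ z i hi]
  have hseries : ∀ k z, P.coeffSeries m k (P.ratio p (ξ z)) = P.coeffSeries m k z := by
    intro k z
    refine tsum_congr fun w => ?_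
    congr 1
    refine Finset.prod_congr rfl fun j _ => ?_
    by_cases hj : j ∈ σ
    · rw [P.expo_of_mem hj, pow_zero, pow_zero]
    · rw [hratio z j hj]
  set F : ℝ := ‖P.factor p p‖ with hF
  have hF0 : 0 < F := norm_pos_iff.2 (P.factor_ne_zero hp hp)
  have hsmall : ∀ᶠ z in 𝓝 (P.ratio p p), ∀ k : ℕ,
      ‖∑' w : {w // m w = k}, phiCoeff v w * ∏ i, z i ^ P.expo w i‖ ≤
        (C₁ * (1 / F + 1)) ^ (k + 1) * (k.factorial : ℝ) ^ (s - 1) := by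
    have ht : Filter.Tendsto ξ (𝓝 (P.ratio p p)) (𝓝 p) := by
      have := hξc.tendsto (P.ratio p p)
      rwa [hξp] at this
    filter_upwards [ht.eventually hev, ht.eventually hbound] with z hz1 hz2 k
    have h1 : f k (ξ z) = P.factor p p * P.coeffSeries m k z := by
      rw [hz1.2 k, hfactor, hseries]
    have h2 := hz2 k
    have hfac : 0 < (k.factorial : ℝ) ^ (s - 1) :=
      Real.rpow_pos_of_pos (by exact_mod_cast k.factorial_pos) _
    rw [norm_div, Complex.norm_real, Real.norm_of_nonneg hfac.le, div_le_iff₀ hfac, h1,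
      norm_mul] at h2
    show ‖P.coeffSeries m k z‖ ≤ _
    have h3 : ‖P.coeffSeries m k z‖ ≤ (1 / F) * (C₁ ^ (k + 1) * (k.factorial : ℝ) ^ (s - 1)) := by
      rw [one_div, ← div_eq_inv_mul, le_div_iff₀ hF0, mul_comm]
      exact h2
    refine h3.trans ?_
    have h4 : 1 / F ≤ (1 / F + 1) ^ (k + 1) :=
      (by linarith : 1 / F ≤ 1 / F + 1).trans
        (le_self_pow₀ (by have : 0 < 1 / F := by positivity
                          linarith) (by omega))
    calc (1 / F) * (C₁ ^ (k + 1) * (k.factorial : ℝ) ^ (s - 1))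
        ≤ (1 / F + 1) ^ (k + 1) * (C₁ ^ (k + 1) * (k.factorial : ℝ) ^ (s - 1)) :=
          mul_le_mul_of_nonneg_right h4 (by positivity)
      _ = _ := by rw [mul_pow]; ring
  have := le_of_coeff_growth (fun w : supportSet A v => phiCoeff v w) (fun w => P.expo w)
    P.expo_injective m (1 / (κ : ℝ)) (s - 1) (P.ratio p p) r hz τ hτ hs
    (C₁ * (1 / F + 1)) (by positivity) hsmall u hu c hc hlow E hE
  linarith

end AssocData

/-! ### Differentiation term by term -/

/-- The series of analytic functions `F u` converges to the analytic function `f` on the open set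
`W`, normally near each point. -/
structure NormalSum {n : ℕ} {U : Type} (F : U → (Fin n → ℂ) → ℂ) (f : (Fin n → ℂ) → ℂ)
    (W : Set (Fin n → ℂ)) : Prop where
  isOpen : IsOpen W
  analytic_term : ∀ u, AnalyticOnNhd ℂ (F u) W
  analytic_sum : AnalyticOnNhd ℂ f W
  bound : ∀ x ∈ W, ∃ a : U → ℝ, Summable a ∧ ∀ᶠ y in 𝓝 x, ∀ u, ‖F u y‖ ≤ a u
  hasSum : ∀ x ∈ W, HasSum (fun u => F u x) (f x)

theorem pderiv_eq_deriv {n : ℕ} {g : (Fin n → ℂ) → ℂ} {x : Fin n → ℂ}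
    (hg : DifferentiableAt ℂ g x) (j : Fin n) :
    pderiv j g x = deriv (fun s : ℂ => g (x + s • Pi.single j 1)) 0 :=
  (hg.lineDeriv_eq_fderiv (v := Pi.single j 1)).symm

theorem analyticOnNhd_pderiv {n : ℕ} {g : (Fin n → ℂ) → ℂ} {W : Set (Fin n → ℂ)}
    (hg : AnalyticOnNhd ℂ g W) (j : Fin n) : AnalyticOnNhd ℂ (pderiv j g) W := fun x hx =>
  ((ContinuousLinearMap.apply ℂ ℂ (Pi.single j 1 : Fin n → ℂ)).analyticAt (fderiv ℂ g x)).comp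
    (hg.fderiv x hx)

namespace NormalSum

variable {n : ℕ} {U : Type} {F : U → (Fin n → ℂ) → ℂ} {f : (Fin n → ℂ) → ℂ}
  {W : Set (Fin n → ℂ)}

theorem congr (h : NormalSum F f W) {F' : U → (Fin n → ℂ) → ℂ}
    (hF : ∀ u, ∀ x ∈ W, F u x = F' u x) : NormalSum F' f W where
  isOpen := h.isOpen
  analytic_term u := (h.analytic_term u).congr h.isOpen (hF u)
  analytic_sum := h.analytic_sum
  bound x hx := by
    obtain ⟨a, ha, hb⟩ := h.bound x hx
    refine ⟨a, ha, ?_⟩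
    filter_upwards [hb, h.isOpen.mem_nhds hx] with y hy hyW u
    rw [← hF u y hyW]
    exact hy u
  hasSum x hx := (h.hasSum x hx).congr_fun fun u => (hF u x hx).symm

theorem pderiv (h : NormalSum F f W) (j : Fin n) :
    NormalSum (fun u => pderiv j (F u)) (ModifiedGKZ.pderiv j f) W := by
  -- near each point, the derivatives are bounded by the Cauchy estimates on lines
  have key : ∀ x ∈ W, ∃ a : U → ℝ, ∃ ε > 0, Summable a ∧
      ∀ y ∈ Metric.ball x ε, ∀ s ∈ Metric.ball (0 : ℂ) ε,
        y + s • Pi.single j 1 ∈ W ∧ ∀ u, ‖F u (y + s • Pi.single j 1)‖ ≤ a u := by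
    intro x hx
    obtain ⟨a, ha, hb⟩ := h.bound x hx
    obtain ⟨ε, hε, hball⟩ := Metric.eventually_nhds_iff_ball.1 (hb.and (h.isOpen.mem_nhds hx))
    refine ⟨a, ε / 2, half_pos hε, ha, fun y hy s hs => ?_⟩
    have hmem : y + s • Pi.single j 1 ∈ Metric.ball x ε := by
      rw [mem_ball_iff_norm] at hy ⊢
      rw [mem_ball_zero_iff] at hs
      have h1 : ‖s • (Pi.single j 1 : Fin n → ℂ)‖ < ε / 2 := by
        rw [norm_smul, Pi.norm_single, norm_one, mul_one]
        exact hs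
      calc ‖y + s • Pi.single j 1 - x‖ = ‖(y - x) + s • Pi.single j 1‖ := by
            congr 1; abel
        _ ≤ ‖y - x‖ + ‖s • (Pi.single j 1 : Fin n → ℂ)‖ := norm_add_le _ _
        _ < ε := by linarith
    exact ⟨(hball _ hmem).2, (hball _ hmem).1⟩
  have hline : ∀ x : Fin n → ℂ, ∀ s : ℂ,
      DifferentiableAt ℂ (fun s : ℂ => x + s • (Pi.single j 1 : Fin n → ℂ)) s := by
    intro x s
    fun_prop
  refine ⟨h.isOpen, fun u => analyticOnNhd_pderiv (h.analytic_term u) j,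
    analyticOnNhd_pderiv h.analytic_sum j, ?_, ?_⟩
  · intro x hx
    obtain ⟨a, ε, hε, ha, hb⟩ := key x hx
    refine ⟨fun u => a u / (ε / 2), ha.div_const _, ?_⟩
    filter_upwards [Metric.ball_mem_nhds x hε] with y hy u
    have hyW : y ∈ W := by simpa using (hb y hy 0 (Metric.mem_ball_self hε)).1
    rw [pderiv_eq_deriv (h.analytic_term u y hyW).differentiableAt]
    have hsub : Metric.closedBall (0 : ℂ) (ε / 2) ⊆ Metric.ball 0 ε :=
      Metric.closedBall_subset_ball (half_lt_self hε)
    refine Complex.norm_deriv_le_of_forall_mem_sphere_norm_le (half_pos hε) ?_ ?_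
    · apply DifferentiableOn.diffContOnCl
      rw [closure_ball _ (half_pos hε).ne']
      intro s hs
      exact (DifferentiableAt.comp (f := fun s : ℂ => y + s • (Pi.single j 1 : Fin n → ℂ)) s
        (h.analytic_term u _ (hb y hy s (hsub hs)).1).differentiableAt
        (hline y s)).differentiableWithinAt
    · intro s hs
      exact (hb y hy s (hsub (Metric.sphere_subset_closedBall hs))).2 u
  · intro x hx
    obtain ⟨a, ε, hε, ha, hb⟩ := key x hx
    have hx0 := Metric.mem_ball_self (x := x) hε
    have h1 := Complex.hasSum_deriv_of_summable_norm (z := 0) ha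
      (F := fun u (s : ℂ) => F u (x + s • Pi.single j 1)) (U := Metric.ball 0 ε)
      (fun u s hs => (DifferentiableAt.comp
        (f := fun s : ℂ => x + s • (Pi.single j 1 : Fin n → ℂ)) s
        (h.analytic_term u _ (hb x hx0 s hs).1).differentiableAt
        (hline x s)).differentiableWithinAt)
      Metric.isOpen_ball (fun u s hs => (hb x hx0 s hs).2 u) (Metric.mem_ball_self hε)
    have h2 : (fun s : ℂ => ∑' u, F u (x + s • Pi.single j 1)) =ᶠ[𝓝 0]
        fun s => f (x + s • Pi.single j 1) := by
      filter_upwards [Metric.ball_mem_nhds (0 : ℂ) hε] with s hs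
      exact (h.hasSum _ (hb x hx0 s hs).1).tsum_eq
    rw [h2.deriv_eq, ← pderiv_eq_deriv (h.analytic_sum x hx).differentiableAt] at h1
    exact h1.congr_fun fun u =>
      pderiv_eq_deriv (h.analytic_term u x hx).differentiableAt j

end NormalSum

/-! ### The divided powers `z^e / Γ(e + 1)` -/

/-- The divided power `z^e / Γ(e + 1)`, in the determination at `p`. Its derivative is the divided
power with exponent `e - 1`. -/
def dividedPow (p z e : ℂ) : ℂ := (Complex.Gamma (e + 1))⁻¹ * localPow p z e

theorem inv_Gamma_neg_int {k : ℤ} (hk : k < 0) : (Complex.Gamma ((k : ℂ) + 1))⁻¹ = 0 := by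
  obtain ⟨l, hl⟩ : ∃ l : ℕ, k + 1 = -l := ⟨(-(k + 1)).toNat, by omega⟩
  have : (k : ℂ) + 1 = -(l : ℂ) := by exact_mod_cast congrArg (Int.cast : ℤ → ℂ) hl
  rw [this, Complex.Gamma_neg_nat_eq_zero, inv_zero]

theorem dividedPow_neg_int {k : ℤ} (hk : k < 0) (p z : ℂ) : dividedPow p z k = 0 := by
  rw [dividedPow, inv_Gamma_neg_int hk, zero_mul]

theorem inv_Gamma_sub_one (e : ℂ) :
    (Complex.Gamma (e - 1 + 1))⁻¹ = e * (Complex.Gamma (e + 1))⁻¹ := by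
  rw [sub_add_cancel, Complex.one_div_Gamma_eq_self_mul_one_div_Gamma_add_one]

/-- The exponents `e` for which the divided powers are used: if `p = 0`, only the integers, where
they are polynomials in `z`. -/
def AllowedExponent (p e : ℂ) : Prop := p = 0 → ∃ k : ℤ, e = k

theorem hasDerivAt_dividedPow {p z e : ℂ} (hz : p ≠ 0 → z / p ∈ Complex.slitPlane)
    (he : AllowedExponent p e) :
    HasDerivAt (fun z => dividedPow p z e) (dividedPow p z (e - 1)) z := by
  by_cases hp : p = 0
  · obtain ⟨k, rfl⟩ := he hp
    have h1 : (k : ℂ) - 1 = ((k - 1 : ℤ) : ℂ) := by push_cast; rfl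
    rcases lt_or_ge 0 k with hk | hk
    · obtain ⟨l, rfl⟩ : ∃ l : ℕ, k = l + 1 := ⟨(k - 1).toNat, by omega⟩
      unfold dividedPow
      rw [inv_Gamma_sub_one, mul_comm (_ : ℂ) (Complex.Gamma _)⁻¹, mul_assoc]
      refine HasDerivAt.const_mul _ ?_
      have h1 : (((l : ℤ) + 1 : ℤ) : ℂ) = ((l + 1 : ℕ) : ℂ) := by push_cast; ring
      have h2 : ((l + 1 : ℕ) : ℂ) - 1 = (l : ℂ) := by push_cast; ring
      rw [h1, h2]
      simp only [localPow_natCast]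
      simpa using hasDerivAt_pow (l + 1) z
    · rw [h1, dividedPow_neg_int (show k - 1 < 0 by omega)]
      rcases hk.lt_or_eq with hk | rfl
      · simp only [dividedPow_neg_int hk]
        exact hasDerivAt_const z (0 : ℂ)
      · simpa [dividedPow, localPow_zero] using hasDerivAt_const z (1 : ℂ)
  · unfold dividedPow
    rw [inv_Gamma_sub_one, mul_comm e, mul_assoc]
    refine HasDerivAt.const_mul _ ?_
    simp only [localPow_of_ne hp]
    have h1 : HasDerivAt (fun z : ℂ => z / p) (1 / p) z := (hasDerivAt_id z).div_const p
    have h2 := (h1.cpow_const (c := e) (hz hp)).const_mul (p ^ e)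
    refine h2.congr_deriv ?_
    rw [Complex.cpow_sub _ _ hp, Complex.cpow_one]
    ring

theorem isOpen_slit (p : ℂ) : IsOpen {z : ℂ | p ≠ 0 → z / p ∈ Complex.slitPlane} := by
  by_cases hp : p = 0
  · simp [hp]
  · have hc : Continuous fun z : ℂ => z / p := by
      simp only [div_eq_mul_inv]
      fun_prop
    simp only [ne_eq, hp, not_false_eq_true, forall_const]
    exact Complex.isOpen_slitPlane.preimage hc

theorem analyticAt_dividedPow {p z e : ℂ} (hz : p ≠ 0 → z / p ∈ Complex.slitPlane)
    (he : AllowedExponent p e) : AnalyticAt ℂ (fun z => dividedPow p z e) z :=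
  DifferentiableOn.analyticAt (s := {z : ℂ | p ≠ 0 → z / p ∈ Complex.slitPlane})
    (fun _ hx => (hasDerivAt_dividedPow hx he).differentiableAt.differentiableWithinAt)
    ((isOpen_slit p).mem_nhds hz)

theorem mul_dividedPow_sub_one {p z e : ℂ} (hz : p ≠ 0 → z / p ∈ Complex.slitPlane)
    (he : AllowedExponent p e) : z * dividedPow p z (e - 1) = e * dividedPow p z e := by
  by_cases hp : p = 0
  · obtain ⟨k, rfl⟩ := he hp
    have h1 : (k : ℂ) - 1 = ((k - 1 : ℤ) : ℂ) := by push_cast; rfl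
    rcases lt_or_ge 0 k with hk | hk
    · obtain ⟨l, rfl⟩ : ∃ l : ℕ, k = l + 1 := ⟨(k - 1).toNat, by omega⟩
      have h1 : (((l : ℤ) + 1 : ℤ) : ℂ) = ((l + 1 : ℕ) : ℂ) := by push_cast; ring
      have h2 : ((l + 1 : ℕ) : ℂ) - 1 = (l : ℂ) := by push_cast; ring
      unfold dividedPow
      rw [inv_Gamma_sub_one, h1, h2, localPow_natCast, localPow_natCast]
      ring
    · rw [h1, dividedPow_neg_int (show k - 1 < 0 by omega)]
      rcases hk.lt_or_eq with hk | rfl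
      · rw [dividedPow_neg_int hk, mul_zero, mul_zero]
      · simp
  · have hz0 : z ≠ 0 := by
      rintro rfl
      simpa using hz hp
    have h1 : localPow p z e = localPow p z (e - 1) * z := by
      have h2 := localPow_natCast p z 1
      rw [Nat.cast_one, pow_one] at h2
      conv_lhs => rw [← sub_add_cancel e 1, localPow_add hp hz0, h2]
    unfold dividedPow
    rw [inv_Gamma_sub_one, h1]
    ring

/-- The monomial `x^(v+u) / ∏ Γ(v_i + u_i + 1)`, in the determination at `p`. -/
def dividedMonomial {n : ℕ} (v p : Fin n → ℂ) (u : Fin n → ℤ) (x : Fin n → ℂ) : ℂ :=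
  ∏ i, dividedPow (p i) (x i) (v i + u i)

/-- The points at which the determinations at `p` of the powers of the coordinates are
holomorphic. -/
def slitSet {n : ℕ} (p : Fin n → ℂ) : Set (Fin n → ℂ) :=
  {x | ∀ i, p i ≠ 0 → x i / p i ∈ Complex.slitPlane}

theorem isOpen_slitSet {n : ℕ} (p : Fin n → ℂ) : IsOpen (slitSet p) := by
  have h : slitSet p = ⋂ i, (fun x : Fin n → ℂ => x i) ⁻¹'
      {z : ℂ | p i ≠ 0 → z / p i ∈ Complex.slitPlane} := by
    ext x
    simp [slitSet]
  rw [h]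
  exact isOpen_iInter_of_finite fun i => (isOpen_slit (p i)).preimage (continuous_apply i)

theorem self_mem_slitSet {n : ℕ} (p : Fin n → ℂ) : p ∈ slitSet p := fun i hi => by
  rw [div_self hi]
  exact Complex.one_mem_slitPlane

section dividedMonomial

variable {n : ℕ} {v p : Fin n → ℂ} (hv : ∀ i, AllowedExponent (p i) (v i))

include hv

theorem allowedExponent_add (u : Fin n → ℤ) (i : Fin n) : AllowedExponent (p i) (v i + u i) := by
  intro hi
  obtain ⟨k, hk⟩ := hv i hi
  exact ⟨k + u i, by rw [hk]; push_cast; rfl⟩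

theorem analyticOnNhd_dividedMonomial (u : Fin n → ℤ) :
    AnalyticOnNhd ℂ (dividedMonomial v p u) (slitSet p) := fun x hx =>
  Finset.analyticAt_fun_prod _ fun i _ =>
    AnalyticAt.fun_comp (f := fun x : Fin n → ℂ => x i)
      (analyticAt_dividedPow (hx i) (allowedExponent_add hv u i)) (analyticAt_eval i x)

theorem pderiv_dividedMonomial (u : Fin n → ℤ) (j : Fin n) {x : Fin n → ℂ} (hx : x ∈ slitSet p) :
    pderiv j (dividedMonomial v p u) x = dividedMonomial v p (u - Pi.single j 1) x := by
  rw [pderiv_eq_deriv (analyticOnNhd_dividedMonomial hv u x hx).differentiableAt]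
  refine HasDerivAt.deriv ?_
  have h1 : ∀ s : ℂ, dividedMonomial v p u (x + s • Pi.single j 1) =
      dividedPow (p j) (x j + s) (v j + u j) *
        ∏ i ∈ Finset.univ.erase j, dividedPow (p i) (x i) (v i + u i) := by
    intro s
    unfold dividedMonomial
    rw [← Finset.mul_prod_erase _ _ (Finset.mem_univ j)]
    congr 1
    · simp
    · refine Finset.prod_congr rfl fun i hi => ?_
      simp [Finset.ne_of_mem_erase hi]
  have h2 : dividedMonomial v p (u - Pi.single j 1) x =
      dividedPow (p j) (x j + 0) (v j + u j - 1) *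
        ∏ i ∈ Finset.univ.erase j, dividedPow (p i) (x i) (v i + u i) := by
    unfold dividedMonomial
    rw [← Finset.mul_prod_erase _ _ (Finset.mem_univ j)]
    congr 1
    · simp [add_sub_assoc]
    · refine Finset.prod_congr rfl fun i hi => ?_
      simp [Finset.ne_of_mem_erase hi]
  simp only [h1]
  rw [h2]
  refine HasDerivAt.mul_const ?_ _
  exact HasDerivAt.comp_const_add (x j) 0
    (hasDerivAt_dividedPow (by simpa using hx j) (allowedExponent_add hv u j))

theorem mul_dividedMonomial_sub_single (u : Fin n → ℤ) (j : Fin n) {x : Fin n → ℂ}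
    (hx : x ∈ slitSet p) :
    x j * dividedMonomial v p (u - Pi.single j 1) x = (v j + u j) * dividedMonomial v p u x := by
  unfold dividedMonomial
  rw [← Finset.mul_prod_erase _ _ (Finset.mem_univ j), ← Finset.mul_prod_erase _
    (fun i => dividedPow (p i) (x i) (v i + u i)) (Finset.mem_univ j), ← mul_assoc, ← mul_assoc,
    ← mul_dividedPow_sub_one (hx j) (allowedExponent_add hv u j)]
  congr 1
  · simp [add_sub_assoc]
  · refine Finset.prod_congr rfl fun i hi => ?_
    simp [Finset.ne_of_mem_erase hi]

theorem NormalSum.pderiv_dividedMonomial {c : (Fin n → ℤ) → ℂ} {g : (Fin n → ℂ) → ℂ}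
    {W : Set (Fin n → ℂ)} (hW : W ⊆ slitSet p) {s : Fin n → ℤ} (j : Fin n)
    (h : NormalSum (fun u x => c u * dividedMonomial v p (u - s) x) g W) :
    NormalSum (fun u x => c u * dividedMonomial v p (u - (Pi.single j 1 + s)) x)
      (ModifiedGKZ.pderiv j g) W := by
  refine (h.pderiv j).congr fun u x hx => ?_
  have h1 : u - (Pi.single j 1 + s) = u - s - Pi.single j 1 := by abel
  rw [h1, ← ModifiedGKZ.pderiv_dividedMonomial hv _ j (hW hx)]
  unfold ModifiedGKZ.pderiv
  rw [fderiv_const_mul (analyticOnNhd_dividedMonomial hv _ x (hW hx)).differentiableAt]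
  rfl

/-- A monomial differential operator shifts the exponents of the divided monomials. -/
theorem NormalSum.monomialDeriv_dividedMonomial {c : (Fin n → ℤ) → ℂ} {g : (Fin n → ℂ) → ℂ}
    {W : Set (Fin n → ℂ)} (hW : W ⊆ slitSet p) (a : Fin n → ℕ)
    (h : NormalSum (fun u x => c u * dividedMonomial v p u x) g W) :
    NormalSum (fun u x => c u * dividedMonomial v p (u - fun i => (a i : ℤ)) x)
      (monomialDeriv a g) W := by
  have hpow : ∀ (j : Fin n) (k : ℕ) (s : Fin n → ℤ) (g : (Fin n → ℂ) → ℂ),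
      NormalSum (fun u x => c u * dividedMonomial v p (u - s) x) g W →
      NormalSum (fun u x => c u * dividedMonomial v p (u - (k • Pi.single j 1 + s)) x)
        ((ModifiedGKZ.pderiv j)^[k] g) W := by
    intro j k s g h
    induction k with
    | zero => simpa using h
    | succ k ih =>
      rw [Function.iterate_succ_apply', succ_nsmul', add_assoc]
      exact ih.pderiv_dividedMonomial hv hW j
  have hlist : ∀ l : List (Fin n),
      NormalSum (fun u x => c u * dividedMonomial v p
        (u - (l.map fun j => a j • (Pi.single j 1 : Fin n → ℤ)).sum) x)
        (l.foldr (fun j h => (ModifiedGKZ.pderiv j)^[a j] h) g) W := by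
    intro l
    induction l with
    | nil => simpa using h
    | cons j l ih => simpa using hpow j (a j) _ _ ih
  have hsum : (fun i => (a i : ℤ)) =
      ((List.finRange n).map fun j => a j • (Pi.single j 1 : Fin n → ℤ)).sum := by
    rw [← Fin.sum_univ_def]
    ext i
    simp [Finset.sum_apply, Pi.single_apply]
  rw [hsum]
  exact hlist _

end dividedMonomial

/-! ### The differential equations -/

/-- The coefficients of the part of the series with the power `t^e`, with respect to the divided
monomials: the constant `∏ Γ(v_i + 1)` for all `u` in the kernel which give this power of `t`. No
condition on the support is needed, since the other divided monomials vanish. -/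
def termCoeff {d n : ℕ} (A : Matrix (Fin d) (Fin n) ℤ) (w : Fin n → ℤ) (α : ℂ) (v : Fin n → ℂ)
    (e : ℂ) (u : Fin n → ℤ) : ℂ :=
  open Classical in
  if A.mulVec u = 0 ∧ tExponent w α v u = e then ∏ i, Complex.Gamma (v i + 1) else 0

/-- The coefficients of `∑_m f_m t^m`, indexed by the integers, so that multiplication by a power of
`t` is a shift of the index. -/
def intCoeff {n : ℕ} (f : ℕ → (Fin n → ℂ) → ℂ) (k : ℤ) : (Fin n → ℂ) → ℂ :=
  if 0 ≤ k then f k.toNat else 0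

theorem mulTPow_eq {n : ℕ} (k : ℕ) (f : ℕ → (Fin n → ℂ) → ℂ) (m : ℕ) :
    mulTPow k f m = intCoeff f (m - k) := by
  unfold mulTPow intCoeff
  by_cases h : k ≤ m
  · have h1 : ((m : ℤ) - k).toNat = m - k := by omega
    rw [if_pos h, if_pos (by omega), h1]
  · rw [if_neg h, if_neg (by omega)]

theorem intCoeff_natCast {n : ℕ} (f : ℕ → (Fin n → ℂ) → ℂ) (m : ℕ) : intCoeff f m = f m := by
  simp [intCoeff]

theorem tExponent_add {n : ℕ} (w : Fin n → ℤ) (α : ℂ) (v : Fin n → ℂ) (u u' : Fin n → ℤ) :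
    tExponent w α v (u + u') = tExponent w α v u + ((∑ i, w i * u' i : ℤ) : ℂ) := by
  unfold tExponent
  push_cast
  rw [add_assoc, ← Finset.sum_add_distrib]
  congr 1
  refine Finset.sum_congr rfl fun i _ => ?_
  simp only [Pi.add_apply]
  push_cast
  ring

/-- If all the coefficients are normal sums of multiples of divided monomials, then the modified
system holds. -/
theorem isModifiedSolution_of_normalSum {d n : ℕ} {A : Matrix (Fin d) (Fin n) ℤ} {w : Fin n → ℤ}
    {α γ : ℂ} {β : Fin d → ℂ} {v p : Fin n → ℂ} (hv : ∀ i, AllowedExponent (p i) (v i))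
    (hβ : ∀ r, ∑ j, (A r j : ℂ) * v j = β r) {f : ℕ → (Fin n → ℂ) → ℂ}
    {W : Set (Fin n → ℂ)} (hW : W ⊆ slitSet p) (hpW : p ∈ W)
    (h : ∀ k : ℤ, NormalSum
      (fun u x => termCoeff A w α v (γ + k) u * dividedMonomial v p u x) (intCoeff f k) W) :
    IsModifiedSolution A w α β γ p f := by
  have hf : ∀ m : ℕ, NormalSum
      (fun u x => termCoeff A w α v (γ + m) u * dividedMonomial v p u x) (f m) W := fun m => by
    have := h m
    rw [intCoeff_natCast] at this
    simpa using this
  -- the monomials are eigenvectors of the operators `∑ l_j x_j ∂_j`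
  have heuler : ∀ (m : ℕ) (l : Fin n → ℂ) (μ : ℂ),
      (∀ u, A.mulVec u = 0 → tExponent w α v u = γ + m → ∑ j, l j * (v j + u j) = μ) →
      ∀ x ∈ W, ∑ j, l j * (x j * pderiv j (f m) x) = μ * f m x := by
    intro m l μ hμ x hx
    have h1 : ∀ j, HasSum (fun u => termCoeff A w α v (γ + m) u *
        dividedMonomial v p (u - Pi.single j 1) x) (pderiv j (f m) x) := fun j => by
      have h2 := NormalSum.pderiv_dividedMonomial hv hW (s := 0) j (by simpa using hf m)
      simpa using h2.hasSum x hx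
    have h2 := hasSum_sum (s := Finset.univ) fun j _ => ((h1 j).mul_left (x j)).mul_left (l j)
    refine h2.unique (((hf m).hasSum x hx).mul_left μ |>.congr_fun fun u => ?_)
    by_cases hu : A.mulVec u = 0 ∧ tExponent w α v u = γ + m
    · rw [← hμ u hu.1 hu.2, Finset.sum_mul]
      refine Finset.sum_congr rfl fun j _ => ?_
      linear_combination (l j * termCoeff A w α v (γ + m) u) *
        mul_dividedMonomial_sub_single hv u j (hW hx)
    · have h0 : termCoeff A w α v (γ + m) u = 0 := if_neg hu
      simp [h0]
  refine ⟨W, (h 0).isOpen, hpW, fun m => (hf m).analytic_sum, fun x hx m => ⟨fun r => ?_, ?_, ?_⟩⟩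
  · rw [heuler m (fun j => (A r j : ℂ)) (β r) ?_ x hx, sub_self]
    intro u hu _
    have h1 : ∑ j, (A r j : ℂ) * (u j : ℂ) = 0 := by
      have h2 : ∑ j, A r j * u j = 0 := congrFun hu r
      exact_mod_cast congrArg (Int.cast : ℤ → ℂ) h2
    simp only [mul_add, Finset.sum_add_distrib]
    rw [hβ, h1, add_zero]
  · rw [heuler m (fun j => (w j : ℂ)) (γ + m + α) ?_ x hx]
    · ring
    · intro u _ hu
      unfold tExponent at hu
      linear_combination hu
  · intro a b hab
    have hinl : ∀ r, ∑ j, A r j * (a (Sum.inl j) : ℤ) = ∑ j, A r j * (b (Sum.inl j) : ℤ) := by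
      intro r
      simpa [modifiedMatrix, Matrix.mulVec, dotProduct] using congrFun hab (Sum.inl r)
    have hinr : ∑ j, w j * (a (Sum.inl j) : ℤ) + a (Sum.inr ()) =
        ∑ j, w j * (b (Sum.inl j) : ℤ) + b (Sum.inr ()) := by
      simpa [modifiedMatrix, Matrix.mulVec, dotProduct] using congrFun hab (Sum.inr ())
    -- after the shift of the exponents, the derivative is a sum over the monomials `x^(v+u)`
    have hsum : ∀ c : Fin n ⊕ Unit → ℕ, HasSum (fun u => termCoeff A w α v
        (γ + ((m - c (Sum.inr ()) : ℤ) : ℂ)) (u + fun i => (c (Sum.inl i) : ℤ)) *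
          dividedMonomial v p u x)
        (monomialDeriv (fun i => c (Sum.inl i)) (mulTPow (c (Sum.inr ())) f m) x) := by
      intro c
      rw [mulTPow_eq]
      have h1 := (NormalSum.monomialDeriv_dividedMonomial hv hW (fun i => c (Sum.inl i))
        (h (m - c (Sum.inr ())))).hasSum x hx
      rw [← (Equiv.addRight fun i => (c (Sum.inl i) : ℤ)).hasSum_iff] at h1
      refine h1.congr_fun fun u => ?_
      simp
    refine sub_eq_zero.2 ((hsum a).unique ((hsum b).congr_fun fun u => ?_))
    congr 1
    have hA : A.mulVec (u + fun i => (a (Sum.inl i) : ℤ)) =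
        A.mulVec (u + fun i => (b (Sum.inl i) : ℤ)) := by
      rw [Matrix.mulVec_add, Matrix.mulVec_add]
      congr 1
      exact funext hinl
    have hT : tExponent w α v (u + fun i => (a (Sum.inl i) : ℤ)) =
          γ + ((m - a (Sum.inr ()) : ℤ) : ℂ) ↔
        tExponent w α v (u + fun i => (b (Sum.inl i) : ℤ)) =
          γ + ((m - b (Sum.inr ()) : ℤ) : ℂ) := by
      have h1 := congrArg (Int.cast : ℤ → ℂ) hinr
      rw [tExponent_add, tExponent_add]
      push_cast at h1 ⊢
      constructor <;> intro h2
      · linear_combination h2 - h1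
      · linear_combination h2 + h1
    unfold termCoeff
    rw [hA]
    simp only [hT]

namespace AssocData

variable {d n : ℕ} {A : Matrix (Fin d) (Fin n) ℤ} {σ : Finset (Fin n)} {v : Fin n → ℂ}
  {κ : ℕ} {α γ : ℂ} {m : supportSet A v → ℕ}

/-- The vectors of the kernel outside the support give zero, because one of the factors is a
divided power with a negative integral exponent. -/
theorem dividedMonomial_eq_zero (P : AssocData A σ v) {u : Fin n → ℤ} (hA : A.mulVec u = 0) (hu : u ∉ supportSet A v)
    (p x : Fin n → ℂ) : dividedMonomial v p u x = 0 := by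
  rw [P.mem_supportSet_iff] at hu
  push Not at hu
  obtain ⟨j, hj, hlt⟩ := hu hA
  refine Finset.prod_eq_zero (Finset.mem_univ j) ?_
  have h : v j + u j = (((P.V j : ℤ) + u j : ℤ) : ℂ) := by
    rw [P.v_eq j hj]
    push_cast
    rfl
  rw [h, dividedPow_neg_int hlt]

theorem termCoeff_mul (P : AssocData A σ v) (w : Fin n → ℤ) (e : ℂ) (u : Fin n → ℤ) (p x : Fin n → ℂ) :
    termCoeff A w α v e u * dividedMonomial v p u x =
      {u | u ∈ supportSet A v ∧ tExponent w α v u = e}.indicator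
        (fun u => phiCoeff v u * localMonomial p x fun i => v i + (u i : ℂ)) u := by
  by_cases hu : u ∈ supportSet A v ∧ tExponent w α v u = e
  · rw [Set.indicator_of_mem (by exact hu), termCoeff,
      if_pos ⟨((P.mem_supportSet_iff u).1 hu.1).1, hu.2⟩, phiCoeff_eq P.v_ne_neg, dividedMonomial,
      localMonomial, mul_assoc]
    simp only [dividedPow, Finset.prod_mul_distrib]
  · rw [Set.indicator_of_notMem (by exact hu), termCoeff]
    split_ifs with h
    · rw [P.dividedMonomial_eq_zero h.1 fun h' => hu ⟨h', h.2⟩, mul_zero]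
    · exact zero_mul _

theorem isModifiedSolution_of_isExpansion (P : AssocData A σ v) {β : Fin d → ℂ}
    (hβ : ∀ r, ∑ j, (A r j : ℂ) * v j = β r)
    (hm : ∀ u : supportSet A v, tExponent (fun _ => -(κ : ℤ)) α v u = γ + m u)
    {p : Fin n → ℂ} (hp : ∀ i ∈ σ, p i ≠ 0) {r : Fin n → ℝ}
    (hz : ∀ j, ‖P.ratio p p j‖ < r j) {e τ : ℝ} (hτ : 0 < τ)
    (hs : Summable fun u : supportSet A v =>
      ‖phiCoeff v u‖ / ((m u).factorial : ℝ) ^ e * (∏ j, r j ^ P.expo u j) * τ ^ m u)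
    {f : ℕ → (Fin n → ℂ) → ℂ} (hf : IsExpansion A (fun _ => -(κ : ℤ)) α v γ p f) :
    IsModifiedSolution A (fun _ => -(κ : ℤ)) α β γ p f := by
  obtain ⟨-, -, V, hVo, hpV, hV⟩ := hf
  have hv : ∀ i, AllowedExponent (p i) (v i) := by
    intro i hi
    by_cases hiσ : i ∈ σ
    · exact absurd hi (hp i hiσ)
    · exact ⟨P.V i, by simpa using P.v_eq i hiσ⟩
  obtain ⟨N, hN, hNo, hpN⟩ := eventually_nhds_iff.1 (P.eventually_near hp hz)
  have hWo : IsOpen (V ∩ N ∩ slitSet p) := (hVo.inter hNo).inter (isOpen_slitSet p)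
  refine isModifiedSolution_of_normalSum hv hβ (W := V ∩ N ∩ slitSet p) Set.inter_subset_right
    ⟨⟨hpV, hpN⟩, self_mem_slitSet p⟩ fun k => ?_
  have hterm : ∀ u, AnalyticOnNhd ℂ (fun x => termCoeff A (fun _ => -(κ : ℤ)) α v (γ + k) u *
      dividedMonomial v p u x) (V ∩ N ∩ slitSet p) := fun u x hx =>
    analyticAt_const.mul (analyticOnNhd_dividedMonomial hv u x hx.2)
  rcases lt_or_ge k 0 with hk | hk
  · -- the series contains no power `t^(γ + k)` with `k < 0`
    have hzero : ∀ u x, termCoeff A (fun _ => -(κ : ℤ)) α v (γ + k) u *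
        dividedMonomial v p u x = 0 := by
      intro u x
      rw [P.termCoeff_mul]
      refine Set.indicator_of_notMem ?_ _
      rintro ⟨hu, hu'⟩
      have h1 := add_left_cancel (hu'.symm.trans (hm ⟨u, hu⟩))
      have h2 : k = m ⟨u, hu⟩ := by exact_mod_cast h1
      omega
    have h0 : intCoeff f k = 0 := if_neg (by omega)
    rw [h0]
    exact ⟨hWo, hterm, fun x _ => analyticAt_const, fun x _ => ⟨0, summable_zero,
      Filter.Eventually.of_forall fun y u => by rw [hzero]; simp⟩,
      fun x _ => by simpa only [hzero, Pi.zero_apply] using hasSum_zero⟩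
  · obtain ⟨k, rfl⟩ := Int.eq_ofNat_of_zero_le hk
    rw [intCoeff_natCast]
    refine ⟨hWo, hterm, fun x hx => (hV k).1 x hx.1.1, fun x hx => ?_, fun x hx => ?_⟩
    · set S : Set (Fin n → ℤ) :=
        {u | u ∈ supportSet A v ∧ tExponent (fun _ => -(κ : ℤ)) α v u = γ + ((k : ℤ) : ℂ)} with hS
      set B : ℝ := ‖P.factor p x‖ + 1 with hB
      refine ⟨S.indicator fun u => B * (‖phiCoeff v u‖ * ∏ j, r j ^ P.expo u j), ?_, ?_⟩
      · rw [← summable_subtype_iff_indicator]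
        have h1 := (summable_fiber hτ hs k).mul_left B
        rw [← (fiberEquiv hm k).symm.summable_iff] at h1
        exact h1
      · have hc : ∀ᶠ y in 𝓝 x, ‖P.factor p y‖ < B :=
          (P.analyticAt_factor hp fun i hi => ((hN x hx.1.2).1 i hi).2).continuousAt.norm.eventually
            (gt_mem_nhds (lt_add_one _))
        filter_upwards [hc, hWo.mem_nhds hx] with y hy hyW u
        have hyN := hN y hyW.1.2
        rw [P.termCoeff_mul]
        by_cases hu : u ∈ S
        · rw [Set.indicator_of_mem hu, Set.indicator_of_mem hu,
            P.localMonomial_eq hp (fun i hi => (hyN.1 i hi).1) hu.1, norm_mul, norm_mul, norm_prod]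
          have h1 : ∏ j, ‖P.ratio p y j ^ P.expo u j‖ ≤ ∏ j, r j ^ P.expo u j := by
            refine Finset.prod_le_prod (fun _ _ => norm_nonneg _) fun j _ => ?_
            rw [norm_pow]
            exact pow_le_pow_left₀ (norm_nonneg _) (hyN.2 j).le _
          calc ‖phiCoeff v u‖ * (‖P.factor p y‖ * ∏ j, ‖P.ratio p y j ^ P.expo u j‖)
              ≤ ‖phiCoeff v u‖ * (B * ∏ j, r j ^ P.expo u j) := by gcongr
            _ = _ := by ring
        · rw [Set.indicator_of_notMem hu, Set.indicator_of_notMem hu, norm_zero]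
    · simp only [P.termCoeff_mul]
      rw [← hasSum_subtype_iff_indicator]
      exact (hV k).2 x hx.1.1

end AssocData

/-! ### The domain of convergence -/

namespace AssocData

variable {d n : ℕ} {A : Matrix (Fin d) (Fin n) ℤ} {σ : Finset (Fin n)} {v : Fin n → ℂ}
  (P : AssocData A σ v)

theorem norm_ratio_lt {R : ℝ} {p : Fin n → ℂ} (hpR : p ∈ region A σ R) {j : Fin n} (hj : j ∉ σ)
    (h : P.inv.height j = P.inv.D) : ‖P.ratio p p j‖ < R := by
  classical
  have hD : (P.inv.D : ℝ) ≠ 0 := by exact_mod_cast P.inv.D_pos.ne'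
  have hsum : ∑ i ∈ σ, (P.inv.coord j i : ℝ) / P.inv.D = 1 := by
    have h1 : ∑ i ∈ σ, P.inv.coord j i = P.inv.D := by
      rw [← h, SimplexInverse.height]
      exact Finset.sum_subset (Finset.subset_univ _) fun i _ hi => P.inv.coord_of_notMem hi j
    have h2 : ∑ i ∈ σ, (P.inv.coord j i : ℝ) = P.inv.D := by exact_mod_cast h1
    rw [← Finset.sum_div, h2, div_self hD]
  have h1 := hpR.2 j hj _ (P.inv.isCoords j) hsum
  rw [← P.norm_ratio_self hpR.1 j] at h1
  exact lt_of_mul_lt_mul_right h1 (Finset.prod_nonneg fun i _ => by positivity)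

/-- At the points of the region, the weighted sum of the norms of the coefficients converges on a
polydisc that contains the values of the functions `ratio`. -/
theorem exists_summable_of_mem_region {κ : ℕ} (hκ : 0 < κ) {α : ℂ}
    (hD : ∀ j, (P.inv.D : ℤ) ≤ P.inv.height j) {C : ℝ} (hC : 1 ≤ C)
    (hb : ∀ u ∈ supportSet A v, ‖phiCoeff v u‖ ≤ C ^ (∑ j, P.expo u j + 1) *
      ((-∑ i, P.intExpo u i).toNat.factorial : ℝ))
    {p : Fin n → ℂ} (hpR : p ∈ region A σ (1 / (2 * C))) :
    ∃ r : Fin n → ℝ, (∀ j, 0 < r j) ∧ (∀ j, ‖P.ratio p p j‖ < r j) ∧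
      ∀ (γ : ℂ) (m : supportSet A v → ℕ),
        (∀ u : supportSet A v, tExponent (fun _ => -(κ : ℤ)) α v u = γ + m u) →
        ∃ τ : ℝ, 0 < τ ∧ Summable fun u : supportSet A v =>
          ‖phiCoeff v u‖ / ((m u).factorial : ℝ) ^ (1 / (κ : ℝ)) * (∏ j, r j ^ P.expo u j) *
            τ ^ m u := by
  classical
  have hC0 : 0 < C := by linarith
  -- only the columns on the hyperplane through `σ` restrict the polyradius
  refine ⟨fun j => if j ∉ σ ∧ P.inv.height j = P.inv.D then 1 / (2 * C) else ‖P.ratio p p j‖ + 1,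
    fun j => ?_, fun j => ?_, fun γ m hm => P.exists_summable hκ hm hD hC hb _ (fun j => ?_)
      fun j hj hjD => ?_⟩
  · dsimp only
    split_ifs <;> positivity
  · dsimp only
    split_ifs with h
    · exact P.norm_ratio_lt hpR h.1 h.2
    · exact lt_add_one _
  · split_ifs <;> positivity
  · rw [if_pos ⟨hj, hjD⟩]
    apply le_of_eq
    field_simp

end AssocData

theorem indicator_mem_region {d n : ℕ} (A : Matrix (Fin d) (Fin n) ℤ) (σ : Finset (Fin n)) {R : ℝ}
    (hR : 0 < R) : (fun i => if i ∈ σ then (1 : ℂ) else 0) ∈ region A σ R := by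
  refine ⟨fun i hi => by simp [hi], fun j hj c _ _ => ?_⟩
  rw [Finset.prod_eq_one, mul_one]
  · simpa [hj] using hR
  · intro i hi
    simp [hi]

end ModifiedGKZ

end

theorem mainTheorem11 {d n : ℕ} (A : Matrix (Fin d) (Fin n) ℤ)
    (hA : (fun _ : Fin n => (1 : ℚ)) ∉
      Submodule.span ℚ (Set.range (fun (r : Fin d) (j : Fin n) => (A r j : ℚ)))) :
    ModifiedGKZ.ForVeryGeneric (fun β : Fin d → ℂ =>
      ∀ (κ : ℕ), 0 < κ → ∀ (α : ℂ) (σ : Finset (Fin n)), ModifiedGKZ.IsSimplex A σ →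
        ∀ v : Fin n → ℂ, ModifiedGKZ.IsAssociated A β σ v →
          ((∃ (γ : ℂ) (p : Fin n → ℂ) (f : ℕ → (Fin n → ℂ) → ℂ),
              ModifiedGKZ.IsExpansion A (fun _ => -(κ : ℤ)) α v γ p f) ↔
            ModifiedGKZ.LiesInInnerFacet A σ) ∧
          (ModifiedGKZ.LiesInInnerFacet A σ →
            ∃ R : ℝ, 0 < R ∧ ∀ p ∈ ModifiedGKZ.region A σ R,
              (∃ (γ : ℂ) (f : ℕ → (Fin n → ℂ) → ℂ),
                ModifiedGKZ.IsExpansion A (fun _ => -(κ : ℤ)) α v γ p f) ∧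
              ∀ (γ : ℂ) (f : ℕ → (Fin n → ℂ) → ℂ),
                ModifiedGKZ.IsExpansion A (fun _ => -(κ : ℤ)) α v γ p f →
                  ModifiedGKZ.IsModifiedSolution A (fun _ => -(κ : ℤ)) α β γ p f ∧
                  ModifiedGKZ.HasGevreyIndex (1 + 1 / (κ : ℝ)) p f)) := by
  refine (ModifiedGKZ.forVeryGeneric_notInt A).mono fun β hβ κ hκ α σ hσ v hv => ?_
  classical
  obtain ⟨S⟩ := hσ.nonempty_simplexInverse
  have hV : ∀ j, ∃ k : ℕ, j ∉ σ → v j = k := fun j => by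
    by_cases hj : j ∈ σ
    · exact ⟨0, fun h => absurd hj h⟩
    · obtain ⟨k, hk⟩ := hv.1 j hj
      exact ⟨k, fun _ => hk⟩
  choose V hV using hV
  let P : ModifiedGKZ.AssocData A σ v := ⟨S, V, hV, hβ σ hσ v hv⟩
  obtain ⟨j₀, hj₀⟩ := S.exists_height_ne hA
  have hfacet := ModifiedGKZ.liesInInnerFacet_iff S ⟨j₀, hj₀⟩
  obtain ⟨C, hC, hb⟩ := P.exists_phiCoeff_bounds
  have hR : (0 : ℝ) < 1 / (2 * C) := by positivity
  have hexists : (∀ j, (S.D : ℤ) ≤ S.height j) → ∀ p ∈ ModifiedGKZ.region A σ (1 / (2 * C)),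
      ∃ (γ : ℂ) (f : ℕ → (Fin n → ℂ) → ℂ),
        ModifiedGKZ.IsExpansion A (fun _ => -(κ : ℤ)) α v γ p f := by
    intro hD p hp
    obtain ⟨r, hr, hz, hs⟩ :=
      P.exists_summable_of_mem_region (α := α) hκ hD hC (fun u hu => (hb u hu).1) hp
    obtain ⟨γ, hγ⟩ := P.exists_bounded (κ := κ) (α := α) hD
    choose m hm using fun u : ModifiedGKZ.supportSet A v => hγ u u.2
    obtain ⟨τ, hτ, hsum⟩ := hs γ m hm
    exact ⟨γ, _, P.isExpansion hm hp.1 hr hz hτ hsum⟩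
  refine ⟨⟨fun ⟨γ, p, f, hf⟩ => ?_, fun h => ?_⟩, fun h => ⟨1 / (2 * C), hR, fun p hp => ?_⟩⟩
  · exact hfacet.2 fun j => P.le_height_of_bounded hκ hf.2.1 j
  · obtain ⟨γ, f, hf⟩ := hexists (hfacet.1 h) _ (ModifiedGKZ.indicator_mem_region A σ hR)
    exact ⟨γ, _, f, hf⟩
  · have hD := hfacet.1 h
    refine ⟨hexists hD p hp, fun γ f hf => ?_⟩
    obtain ⟨r, hr, hz, hs⟩ :=
      P.exists_summable_of_mem_region (α := α) hκ hD hC (fun u hu => (hb u hu).1) hp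
    choose m hm using fun u : ModifiedGKZ.supportSet A v => hf.2.1 u u.2
    obtain ⟨τ, hτ, hsum⟩ := hs γ m hm
    exact ⟨P.isModifiedSolution_of_isExpansion hv.2 hm hp.1 hz hτ hsum hf,
      P.isGevrey_of_isExpansion hm hp.1 hr hz hτ hsum hf, fun s hs' =>
        P.not_isGevrey_of_isExpansion hκ hm (lt_of_le_of_ne (hD j₀) hj₀.symm) hC
          (fun u hu => (hb u hu).2) hp.1 hz hτ hsum hf hs'⟩
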